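/- \textbf{Setting.} Let $\Gamma$ be the chain graph consisting of rings $j\in\mathbb Z$ of circumference $2\pi$; ring $j$ joins the vertex $x_j=j\pi$ to the vertex $x_{j+1}=(j+1)\pi$ by two edges (an upper and a lower half-circle) of length $\pi$. For real sequences $(\mathcal A_j)_{j\in\mathbb Z}$, $(\beta_j)_{j\in\mathbb Z}$ the magnetic Laplacian in $L^2(\Gamma)$ acts as $-\mathscr D^2$ on each edge, with $\mathscr D=\frac{d}{dx}+i\mathcal A_j$ on the upper and $\mathscr D=\frac{d}{dx}-i\mathcal A_j$ on the lower edge of ring $j$; its domain consists of the functions in $L^2(\Gamma)$ that are $H^2$ on each edge, whose image is in $L^2(\Gamma)$, and which satisfy the $\delta$-coupling at each vertex $x_j$: writing $\psi_j,\varphi_j$ for the upper and lower branches on ring $j$, \[\psi_j(x_j)=\varphi_j(x_j)=\psi_{j-1}(x_j)=\varphi_{j-1}(x_j),\qquad \mathscr D\psi_j(x_j)+\mathscr D\varphi_j(x_j)-\mathscr D\psi_{j-1}(x_j)-\mathscr D\varphi_{j-1}(x_j)=\beta_j\psi_j(x_j).\] Let $A\in\mathbb R\setminus\mathbb Z$,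 $\alpha\in\mathbb R$, $n\in\mathbb N$ and $A_1,\dots,A_n,\alpha_1,\dots,\alpha_n\in\mathbb R$. For $\varepsilon>0$ let $-\Delta_\varepsilon$ be the operator with $\mathcal A_j=A+\varepsilon A_j$, $\beta_j=\alpha+\varepsilon\alpha_j$ for $1\le j\le n$ and $\mathcal A_j=A$, $\beta_j=\alpha$ otherwise. By \emph{gaps} we mean the connected components of the complement in $\mathbb R$ of the essential spectrum of $-\Delta_\varepsilon$, numbered $1,2,\dots$ from below (the first one is unbounded below). ``For small $\varepsilon$'' means for all $\varepsilon\in(0,\varepsilon_0)$ with some $\varepsilon_0>0$ that may depend on $A,\alpha,n,A_j,\alpha_j$ but is the same for all gaps; exceptional sets of gaps are finite sets of gap numbers that do not depend on $\varepsilon$. \textbf{Theorem.} (1) Assume $\cot(A\pi)\sum_{j=1}^nA_j>0$. If $\sum_{j=1}^n\alpha_j>0$ (respectively, $<0$), then for small $\varepsilon$ the operator $-\Delta_\varepsilon$ has no eigenvalues in its gaps except in a finite number of even (respectively, odd) gaps, each of which contains at most one eigenvalue, counted with multiplicity. Moreover, given $A$, $\alpha$ and the value $s=\sum_j\alpha_j\ne0$,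 there are $C,c>0$ such that: if $|\sum_jA_j|>C$, then for small $\varepsilon$ there are no eigenvalues in the gaps; if $|\sum_jA_j|<c$, then for small $\varepsilon$ there is an eigenvalue in the second gap when $s>0$, and in the first gap when $s<0$. (2) Assume $\cot(A\pi)\sum_{j=1}^nA_j<0$. If $\sum_{j=1}^n\alpha_j>0$ (respectively, $<0$), then for small $\varepsilon$ the operator $-\Delta_\varepsilon$ has precisely one eigenvalue, and it is simple, in every gap except possibly a finite number of odd (respectively, even) gaps. Moreover, given $A$, $\alpha$ and the value $s=\sum_j\alpha_j\ne0$, there are $C,c>0$ such that: if $|\sum_jA_j|>C$, then for small $\varepsilon$ there is precisely one eigenvalue, and it is simple, in every gap; if $|\sum_jA_j|<c$, then for small $\varepsilon$ there is no eigenvalue in the first gap when $s>0$, and in the second gap when $s<0$. -/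

import Mathlib

open MeasureTheory Set Filter Topology

noncomputable section

namespace RingChain

/-! ### The chain graph and its magnetic Laplacian

The graph is the union of rings `j ∈ ℤ` of circumference `2π`. Ring `j` joins the vertex `x_j = jπ`
to the vertex `x_{j+1} = (j+1)π` by two edges, the upper half-circle (`s = true`) and the lower
half-circle (`s = false`); both are parametrized by the local coordinate `x ∈ [0, π]` running
from `x_j` to `x_{j+1}`. -/

/-- The space `L²(0, π)` of one half-circle. -/
abbrev EdgeL2 : Type := Lp ℂ 2 (volume.restrict (Ioo (0 : ℝ) Real.pi))

/-- The space `L²(Γ)`: the Hilbert sum of the spaces `L²(0, π)` over all half-circles. -/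
abbrev ChainL2 : Type := lp (fun _ : ℤ × Bool => EdgeL2) 2

/-- `f` belongs to the Sobolev space `H²(0, π)`, with derivative `f'` and second derivative `f''`:
`f` and `f'` are absolutely continuous on `[0, π]` and `f'' ∈ L²(0, π)`. -/
structure IsSobolevH2 (f f' f'' : ℝ → ℂ) : Prop where
  memLp : MemLp f'' 2 (volume.restrict (Ioo (0 : ℝ) Real.pi))
  eq_integral : ∀ x ∈ Icc (0 : ℝ) Real.pi, f x = f 0 + ∫ t in (0 : ℝ)..x, f' t
  deriv_eq_integral : ∀ x ∈ Icc (0 : ℝ) Real.pi, f' x = f' 0 + ∫ t in (0 : ℝ)..x, f'' t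

/-- The tangential vector potential enters with opposite signs on the two half-circles of a ring:
the quasi-derivative is `𝒟 = d/dx + iA` on the upper and `𝒟 = d/dx - iA` on the lower one.
This is the coefficient `± iA`. -/
def potential (A : ℤ → ℝ) (j : ℤ) (s : Bool) : ℂ :=
  if s then Complex.I * (A j : ℂ) else -(Complex.I * (A j : ℂ))

/-- The quasi-derivative `𝒟f = f' ± iA f` on an edge, for a function `f` with derivative `f'`. -/
def quasiDeriv (A : ℤ → ℝ) (f f' : ℤ → Bool → ℝ → ℂ) (j : ℤ) (s : Bool) (x : ℝ) : ℂ :=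
  f' j s x + potential A j s * f j s x

/-- `-𝒟²f = -(d/dx ± iA)² f` on an edge, for a function `f` with derivatives `f'` and `f''`. -/
def negQuasiDerivSq (A : ℤ → ℝ) (f f' f'' : ℤ → Bool → ℝ → ℂ) (j : ℤ) (s : Bool) (x : ℝ) : ℂ :=
  -(f'' j s x + 2 * potential A j s * f' j s x + potential A j s ^ 2 * f j s x)

/-- The `δ`-coupling at all vertices: the values of the four branches at the vertex `x_j` (two of
ring `j` at its left end and two of ring `j - 1` at its right end) coincide, and the sum of the
outward quasi-derivatives at `x_j` is `α_j` times the common value. -/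
structure DeltaCoupling (A α : ℤ → ℝ) (f f' : ℤ → Bool → ℝ → ℂ) : Prop where
  upper_lower : ∀ j, f j false 0 = f j true 0
  left : ∀ j s, f (j - 1) s Real.pi = f j true 0
  jump : ∀ j, quasiDeriv A f f' j true 0 + quasiDeriv A f f' j false 0
      - quasiDeriv A f f' (j - 1) true Real.pi - quasiDeriv A f f' (j - 1) false Real.pi
      = (α j : ℂ) * f j true 0

/-! #### Closure properties needed to see that the operator is well defined -/

theorem IsSobolevH2.intervalIntegrable_deriv2 {f f' f'' : ℝ → ℂ} (h : IsSobolevH2 f f' f'') :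
    IntervalIntegrable f'' volume 0 Real.pi := by
  rw [intervalIntegrable_iff_integrableOn_Ioo_of_le Real.pi_pos.le]
  exact h.memLp.integrable (by norm_num)

theorem IsSobolevH2.continuousOn_deriv {f f' f'' : ℝ → ℂ} (h : IsSobolevH2 f f' f'') :
    ContinuousOn f' (Icc 0 Real.pi) := by
  have h1 : ContinuousOn (fun x => f' 0 + ∫ t in (0 : ℝ)..x, f'' t) (Icc 0 Real.pi) := by
    refine continuousOn_const.add ?_
    have := intervalIntegral.continuousOn_primitive_interval (μ := volume) (f := f'')
      (a := 0) (b := Real.pi) (by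
        have := h.intervalIntegrable_deriv2
        rw [intervalIntegrable_iff_integrableOn_Icc_of_le Real.pi_pos.le] at this
        rwa [uIcc_of_le Real.pi_pos.le])
    rwa [uIcc_of_le Real.pi_pos.le] at this
  exact h1.congr h.deriv_eq_integral

theorem IsSobolevH2.intervalIntegrable_deriv {f f' f'' : ℝ → ℂ} (h : IsSobolevH2 f f' f'') :
    IntervalIntegrable f' volume 0 Real.pi :=
  ContinuousOn.intervalIntegrable_of_Icc Real.pi_pos.le h.continuousOn_deriv

theorem intervalIntegrable_of_mem {g : ℝ → ℂ} (hg : IntervalIntegrable g volume 0 Real.pi)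
    {x : ℝ} (hx : x ∈ Icc (0 : ℝ) Real.pi) : IntervalIntegrable g volume 0 x :=
  hg.mono_set (by rw [uIcc_of_le hx.1, uIcc_of_le Real.pi_pos.le]; exact Icc_subset_Icc_right hx.2)

theorem IsSobolevH2.zero : IsSobolevH2 0 0 0 :=
  ⟨MemLp.zero, fun x _ => by simp, fun x _ => by simp⟩

theorem IsSobolevH2.add {f f' f'' g g' g'' : ℝ → ℂ} (hf : IsSobolevH2 f f' f'')
    (hg : IsSobolevH2 g g' g'') : IsSobolevH2 (f + g) (f' + g') (f'' + g'') := by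
  refine ⟨hf.memLp.add hg.memLp, fun x hx => ?_, fun x hx => ?_⟩
  · simp only [Pi.add_apply]
    rw [intervalIntegral.integral_add (intervalIntegrable_of_mem hf.intervalIntegrable_deriv hx)
      (intervalIntegrable_of_mem hg.intervalIntegrable_deriv hx), hf.eq_integral x hx,
      hg.eq_integral x hx]
    ring
  · simp only [Pi.add_apply]
    rw [intervalIntegral.integral_add (intervalIntegrable_of_mem hf.intervalIntegrable_deriv2 hx)
      (intervalIntegrable_of_mem hg.intervalIntegrable_deriv2 hx), hf.deriv_eq_integral x hx,
      hg.deriv_eq_integral x hx]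
    ring

theorem IsSobolevH2.smul {f f' f'' : ℝ → ℂ} (c : ℂ) (hf : IsSobolevH2 f f' f'') :
    IsSobolevH2 (c • f) (c • f') (c • f'') := by
  refine ⟨hf.memLp.const_smul c, fun x hx => ?_, fun x hx => ?_⟩
  · simp only [Pi.smul_apply, smul_eq_mul]
    rw [intervalIntegral.integral_const_mul, hf.eq_integral x hx]
    ring
  · simp only [Pi.smul_apply, smul_eq_mul]
    rw [intervalIntegral.integral_const_mul, hf.deriv_eq_integral x hx]
    ring

/-- The first and second derivatives are determined by the `L²` class of the function. -/
theorem IsSobolevH2.eq_zero {f f' f'' : ℝ → ℂ} (h : IsSobolevH2 f f' f'')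
    (h0 : f =ᵐ[volume.restrict (Ioo (0 : ℝ) Real.pi)] 0) :
    (∀ x ∈ Ioo (0 : ℝ) Real.pi, f x = 0 ∧ f' x = 0) ∧
      f'' =ᵐ[volume.restrict (Ioo (0 : ℝ) Real.pi)] 0 := by
  have hd : ∀ x ∈ Ioo (0 : ℝ) Real.pi, HasDerivAt f (f' x) x := by
    intro x hx
    have hnhds : Icc (0 : ℝ) Real.pi ∈ 𝓝 x := Icc_mem_nhds hx.1 hx.2
    have h1 : HasDerivAt (fun y => f 0 + ∫ t in (0 : ℝ)..y, f' t) (f' x) x :=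
      (intervalIntegral.integral_hasDerivAt_right
        (intervalIntegrable_of_mem h.intervalIntegrable_deriv (Ioo_subset_Icc_self hx))
        (ContinuousOn.stronglyMeasurableAtFilter isOpen_Ioo
          (h.continuousOn_deriv.mono Ioo_subset_Icc_self) x hx)
        (h.continuousOn_deriv.continuousAt hnhds)).const_add _
    refine h1.congr_of_eventuallyEq ?_
    filter_upwards [hnhds] with y hy using h.eq_integral y hy
  have hf0 : ∀ x ∈ Ioo (0 : ℝ) Real.pi, f x = 0 := by
    intro x hx
    exact Measure.eqOn_open_of_ae_eq (μ := volume) h0 isOpen_Ioo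
      (fun y hy => (hd y hy).continuousAt.continuousWithinAt) continuousOn_const hx
  have hf'0 : ∀ x ∈ Ioo (0 : ℝ) Real.pi, f' x = 0 := by
    intro x hx
    have h2 : HasDerivAt (fun _ : ℝ => (0 : ℂ)) (f' x) x := by
      refine (hd x hx).congr_of_eventuallyEq ?_
      filter_upwards [Ioo_mem_nhds hx.1 hx.2] with y hy using (hf0 y hy).symm
    exact h2.unique (hasDerivAt_const x 0)
  refine ⟨fun x hx => ⟨hf0 x hx, hf'0 x hx⟩, ?_⟩
  rw [EventuallyEq, ae_restrict_iff' measurableSet_Ioo]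
  filter_upwards [h.intervalIntegrable_deriv2.ae_hasDerivAt_integral] with x hx hxm
  have h3 := hx (by rw [uIcc_of_le Real.pi_pos.le]; exact Ioo_subset_Icc_self hxm) 0
    (by simp)
  have h4 : HasDerivAt (fun _ : ℝ => - f' 0) (f'' x) x := by
    refine h3.congr_of_eventuallyEq ?_
    filter_upwards [Ioo_mem_nhds hxm.1 hxm.2] with y hy
    have := h.deriv_eq_integral y (Ioo_subset_Icc_self hy)
    rw [hf'0 y hy] at this
    exact (eq_neg_of_add_eq_zero_right this.symm).symm
  exact h4.unique (hasDerivAt_const x _)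

/-- The graph of the magnetic Laplacian with potentials `A_j` and coupling constants `α_j`: the
pairs `(u, h)` such that `u ∈ L²(Γ)` is of class `H²` on every edge, satisfies the `δ`-coupling at
every vertex, and `h = -𝒟²u ∈ L²(Γ)`. -/
def laplacianGraph (A α : ℤ → ℝ) : Submodule ℂ (ChainL2 × ChainL2) where
  carrier := {p | ∃ f f' f'' : ℤ → Bool → ℝ → ℂ,
    (∀ j s, IsSobolevH2 (f j s) (f' j s) (f'' j s)) ∧
    DeltaCoupling A α f f' ∧
    (∀ j s, p.1 (j, s) =ᵐ[volume.restrict (Ioo (0 : ℝ) Real.pi)] f j s) ∧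
    (∀ j s, p.2 (j, s) =ᵐ[volume.restrict (Ioo (0 : ℝ) Real.pi)] negQuasiDerivSq A f f' f'' j s)}
  zero_mem' := by
    refine ⟨0, 0, 0, fun j s => IsSobolevH2.zero, ⟨?_, ?_, ?_⟩, fun j s => ?_, fun j s => ?_⟩
    · intro j; simp
    · intro j s; simp
    · intro j; simp [quasiDeriv]
    · exact Lp.coeFn_zero _ _ _
    · refine (Lp.coeFn_zero _ _ _).trans (Eventually.of_forall fun x => ?_)
      simp [negQuasiDerivSq]
  add_mem' := by
    rintro ⟨u, v⟩ ⟨u₁, v₁⟩ ⟨f, f', f'', h1, h2, h3, h4⟩ ⟨g, g', g'', k1, k2, k3, k4⟩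
    refine ⟨f + g, f' + g', f'' + g'', fun j s => (h1 j s).add (k1 j s), ⟨?_, ?_, ?_⟩,
      fun j s => ?_, fun j s => ?_⟩
    · intro j; simp [h2.upper_lower, k2.upper_lower]
    · intro j s; simp [h2.left, k2.left]
    · intro j
      have e1 := h2.jump j
      have e2 := k2.jump j
      simp only [quasiDeriv, Pi.add_apply] at e1 e2 ⊢
      linear_combination e1 + e2
    · exact (Lp.coeFn_add (u (j, s)) (u₁ (j, s))).trans ((h3 j s).add (k3 j s))
    · refine (Lp.coeFn_add (v (j, s)) (v₁ (j, s))).trans (((h4 j s).add (k4 j s)).trans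
        (Eventually.of_forall fun x => ?_))
      simp only [negQuasiDerivSq, Pi.add_apply]
      ring
  smul_mem' := by
    rintro c ⟨u, v⟩ ⟨f, f', f'', h1, h2, h3, h4⟩
    refine ⟨c • f, c • f', c • f'', fun j s => (h1 j s).smul c, ⟨?_, ?_, ?_⟩,
      fun j s => ?_, fun j s => ?_⟩
    · intro j; simp [h2.upper_lower]
    · intro j s; simp [h2.left]
    · intro j
      have e1 := h2.jump j
      simp only [quasiDeriv, Pi.smul_apply, smul_eq_mul] at e1 ⊢
      linear_combination c * e1
    · exact (Lp.coeFn_smul c (u (j, s))).trans ((h3 j s).const_smul c)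
    · refine (Lp.coeFn_smul c (v (j, s))).trans (((h4 j s).const_smul c).trans
        (Eventually.of_forall fun x => ?_))
      simp only [negQuasiDerivSq, Pi.smul_apply, smul_eq_mul]
      ring

/-- The graph is single-valued, so that it is the graph of an operator. -/
theorem laplacianGraph_single_valued (A α : ℤ → ℝ) (p : ChainL2 × ChainL2)
    (hp : p ∈ laplacianGraph A α) (h0 : p.1 = 0) : p.2 = 0 := by
  obtain ⟨f, f', f'', h1, -, h3, h4⟩ := hp
  apply lp.ext
  funext ⟨j, s⟩
  have hz : f j s =ᵐ[volume.restrict (Ioo (0 : ℝ) Real.pi)] 0 := by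
    refine (h3 j s).symm.trans ?_
    rw [h0]
    exact Lp.coeFn_zero _ _ _
  obtain ⟨a, b⟩ := (h1 j s).eq_zero hz
  apply Lp.ext
  refine (h4 j s).trans (EventuallyEq.trans ?_ (Lp.coeFn_zero _ _ _).symm)
  filter_upwards [b, ae_restrict_mem measurableSet_Ioo] with x hx hxm
  obtain ⟨a1, a2⟩ := a x hxm
  simp only [negQuasiDerivSq, a1, a2, hx, Pi.zero_apply]
  ring

/-- The magnetic Laplacian of the ring chain with vector potential `A_j` on the `j`th ring and
`δ`-coupling of strength `α_j` at the vertex `x_j`, as an unbounded operator in `L²(Γ)`. -/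
def laplacian (A α : ℤ → ℝ) : ChainL2 →ₗ.[ℂ] ChainL2 :=
  (laplacianGraph A α).toLinearPMap

theorem laplacian_graph (A α : ℤ → ℝ) : (laplacian A α).graph = laplacianGraph A α :=
  Submodule.toLinearPMap_graph_eq _ (laplacianGraph_single_valued A α)

/-- The sequence equal to `c + ε c_j` for `1 ≤ j ≤ n` and to `c` otherwise. -/
def perturb (c : ℝ) (n : ℕ) (d : ℤ → ℝ) (ε : ℝ) (j : ℤ) : ℝ :=
  if j ∈ Finset.Icc (1 : ℤ) n then c + ε * d j else c

/-- The operator `-Δ_ε`: the homogeneous chain with parameters `A`, `α`, with `A` replaced by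
`A + ε A_j` on the rings `j = 1, …, n` and `α` by `α + ε α_j` at the vertices `jπ`,
`j = 1, …, n`. -/
def perturbedLaplacian (A α : ℝ) (n : ℕ) (a b : ℤ → ℝ) (ε : ℝ) : ChainL2 →ₗ.[ℂ] ChainL2 :=
  laplacian (perturb A n a ε) (perturb α n b ε)

/-! ### Spectral notions -/

section Spectral

variable {H : Type*} [NormedAddCommGroup H] [InnerProductSpace ℂ H]

/-- The eigenspace `ker (T - E)`. -/
def eigenspace (T : H →ₗ.[ℂ] H) (E : ℝ) : Submodule ℂ T.domain :=
  LinearMap.ker (T.toFun - (E : ℂ) • T.domain.subtype)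

/-- `E` is an eigenvalue of `T`. -/
def IsEigenvalue (T : H →ₗ.[ℂ] H) (E : ℝ) : Prop := eigenspace T E ≠ ⊥

/-- `E` is a simple eigenvalue of `T`. -/
def IsSimpleEigenvalue (T : H →ₗ.[ℂ] H) (E : ℝ) : Prop := Module.finrank ℂ (eigenspace T E) = 1

/-- The essential spectrum of a self-adjoint operator, by singular Weyl sequences: `E` belongs to it
if there is an orthonormal sequence `u_n` in the domain with `(T - E) u_n → 0`. -/
def essentialSpectrum (T : H →ₗ.[ℂ] H) : Set ℝ :=
  {E | ∃ u : ℕ → T.domain, Orthonormal ℂ (fun n => (u n : H)) ∧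
    Tendsto (fun n => T (u n) - (E : ℂ) • (u n : H)) atTop (𝓝 0)}

/-- The gaps of the essential spectrum: the connected components of its complement in `ℝ`. -/
def gaps (T : H →ₗ.[ℂ] H) : Set (Set ℝ) :=
  {G | ∃ x ∈ (essentialSpectrum T)ᶜ, G = connectedComponentIn (essentialSpectrum T)ᶜ x}

/-- The number of a gap, gaps being counted from below starting from `1`. -/
def gapNumber (T : H →ₗ.[ℂ] H) (G : Set ℝ) : ℕ∞ :=
  {G' ∈ gaps T | ∀ x ∈ G', ∀ y ∈ G, x < y}.encard + 1

/-- `T` has no eigenvalue in `G`. -/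
def NoEigenvalueIn (T : H →ₗ.[ℂ] H) (G : Set ℝ) : Prop := ∀ E ∈ G, ¬ IsEigenvalue T E

/-- `T` has at most one eigenvalue in `G`, counted with multiplicity. -/
def AtMostOneEigenvalueIn (T : H →ₗ.[ℂ] H) (G : Set ℝ) : Prop :=
  (∀ E ∈ G, IsEigenvalue T E → IsSimpleEigenvalue T E) ∧
    ∀ E ∈ G, ∀ E' ∈ G, IsEigenvalue T E → IsEigenvalue T E' → E = E'

/-- `T` has precisely one eigenvalue in `G`, and it is simple. -/
def OneSimpleEigenvalueIn (T : H →ₗ.[ℂ] H) (G : Set ℝ) : Prop :=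
  ∃ E ∈ G, IsSimpleEigenvalue T E ∧ ∀ E' ∈ G, IsEigenvalue T E' → E' = E

/-- `T` has no eigenvalues in its gaps, except for those numbered by elements of `F`, each of which
contains at most one eigenvalue. -/
def NoGapEigenvaluesExcept (T : H →ₗ.[ℂ] H) (F : Finset ℕ) : Prop :=
  ∀ G ∈ gaps T, AtMostOneEigenvalueIn T G ∧
    ((∀ m ∈ F, gapNumber T G ≠ m) → NoEigenvalueIn T G)

/-- `T` has precisely one simple eigenvalue in each of its gaps, except possibly for those numbered
by elements of `F`. -/
def OneGapEigenvalueExcept (T : H →ₗ.[ℂ] H) (F : Finset ℕ) : Prop :=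
  ∀ G ∈ gaps T, (∀ m ∈ F, gapNumber T G ≠ m) → OneSimpleEigenvalueIn T G

end Spectral

end RingChain

end

open MeasureTheory Set Filter Topology

noncomputable section

namespace RingChain

/-! The problem reduces to a Jacobi difference equation for the vertex values p_j. Write `cPi E` =
cos(√E π), `sPi E` = sin(√E π)/√E. Solving -𝒟²f = Ef on each edge and inserting the end derivatives
into the δ-coupling gives 2 cos(A_j π) p_{j+1} + 2 cos(A_{j-1} π) p_{j-1} = (4 cPi E + β_j sPi E)
p_j. `exists_recurrence_bound` states this for every function in the domain, with an error governed
by (T - E)u.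

Put η = cPi + (α/4) sPi. The essential spectrum consists of the flat bands (m+1)² and of the
energies with |η| ≤ |cos Aπ| (`essentialSpectrum_laplacian`); it does not depend on ε. Since (cPi -
t)/sPi is strictly decreasing between consecutive flat bands (`strictAntiOn_quot`), η crosses each
level t in (-1, 1) exactly once there. Hence every interval between flat bands holds one band and
two gaps, on which η has opposite signs; A ∉ ℤ makes |cos Aπ| < 1, and the sign condition on the
cotangent makes cos Aπ ≠ 0.

In a gap, after removal of alternating signs, solutions outside the perturbed part are combinations
of λ^j and λ^{-j}, where λ + 1/λ = 2|η|/|cos Aπ| and λ > 1. The ratios r_j of the solution decaying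
at -∞ obey a Riccati recursion, and E is an eigenvalue exactly if r_{n+1} = 1/λ
(`IsWeak.isEigenvalue_iff`). Uniformly over all gaps (`exists_isWeak`), r_{n+1}/λ - λ^{-2} = (1 -
λ^{-2}) + ε · slope + O(ε² + ε(1 - λ^{-2})), where in the gap with number k + 1 slope = (-1)^k (∑
α_j) |sPi E| / (2 |cos Aπ| λ) + 2π tan(Aπ) ∑ A_j. The leading term 1 - λ^{-2} is nonnegative and
vanishes at the band edge. So a slope bounded below by a positive constant near the edge excludes
eigenvalues (`eventually_not_isEigenvalue`), while a negative slope at the edge forces a zero by the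
intermediate value theorem (`eventually_exists_isEigenvalue`).

The sign of the flux term is that of cot(Aπ) ∑ A_j. The coupling term alternates in sign from gap to
gap and tends to 0 in the far gaps because sPi does; it can therefore overrule the flux term only in
finitely many gaps of one parity. Large |∑ A_j| prevents this everywhere, small |∑ A_j| lets the
coupling term decide in the first two gaps.

That a gap holds at most one eigenvalue is a separate argument (`exists_quot_eq`,
`eventually_eigenvalue_unique`): two eigenvalues have positive solutions P and P', and summing both
equations against P P' eliminates the coupling constants and yields (cPi - t)/sPi at the same value
for both energies, with one common |t| < 1. Monotonicity then identifies them. -/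

/-! ### Solutions of `y'' = -E y` -/

/-- The solution of `y'' = -E y` with `y(0) = 1`, `y'(0) = 0`. -/
def cs (E x : ℝ) : ℝ := Real.cos (√E * x) * Real.cosh (√(-E) * x)

/-- The solution of `y'' = -E y` with `y(0) = 0`, `y'(0) = 1`. -/
def sn (E x : ℝ) : ℝ := ∫ t in (0 : ℝ)..x, cs E t

/-- The real square root of a negative number is 0, so one of the two factors of `cs` is always 1.
The product form thus covers both signs of the energy and is jointly continuous across E = 0. -/
theorem cs_of_nonneg {E : ℝ} (hE : 0 ≤ E) (x : ℝ) : cs E x = Real.cos (√E * x) := by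
  simp [cs, Real.sqrt_eq_zero_of_nonpos (neg_nonpos.2 hE)]

theorem cs_of_nonpos {E : ℝ} (hE : E ≤ 0) (x : ℝ) : cs E x = Real.cosh (√(-E) * x) := by
  simp [cs, Real.sqrt_eq_zero_of_nonpos hE]

theorem continuous_cs_uncurry : Continuous fun p : ℝ × ℝ => cs p.1 p.2 := by
  unfold cs
  have := Real.continuous_cosh
  fun_prop

theorem continuous_cs (E : ℝ) : Continuous (cs E) :=
  continuous_cs_uncurry.comp (Continuous.prodMk_right E)

theorem continuous_cs_energy (x : ℝ) : Continuous fun E => cs E x :=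
  continuous_cs_uncurry.comp (Continuous.prodMk_left x)

/-- Taking `sn` as a primitive of `cs`, rather than as sin(√E x)/√E, makes continuity at E = 0
automatic. -/
theorem continuous_sn_energy (x : ℝ) : Continuous fun E => sn E x := by
  have h := intervalIntegral.continuous_parametric_primitive_of_continuous (μ := volume)
    (f := cs) (a₀ := 0) continuous_cs_uncurry
  exact h.comp (Continuous.prodMk_left x)

theorem hasDerivAt_sn (E x : ℝ) : HasDerivAt (sn E) (cs E x) x :=
  intervalIntegral.integral_hasDerivAt_right ((continuous_cs E).intervalIntegrable _ _)
    ((continuous_cs E).stronglyMeasurableAtFilter _ _) (continuous_cs E).continuousAt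

@[simp] theorem cs_zero (E : ℝ) : cs E 0 = 1 := by simp [cs]

@[simp] theorem sn_zero (E : ℝ) : sn E 0 = 0 := by simp [sn]

theorem sn_of_pos {E : ℝ} (hE : 0 < E) (x : ℝ) : sn E x = Real.sin (√E * x) / √E := by
  have hk : √E ≠ 0 := (Real.sqrt_pos.2 hE).ne'
  have h : ∀ y ∈ uIcc 0 x, HasDerivAt (fun y => Real.sin (√E * y) / √E) (cs E y) y := by
    intro y _
    rw [cs_of_nonneg hE.le]
    have := (((hasDerivAt_id y).const_mul √E).sin).div_const √E
    refine this.congr_deriv ?_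
    simp only [id, mul_one]
    field_simp
  rw [sn, intervalIntegral.integral_eq_sub_of_hasDerivAt h
    ((continuous_cs E).intervalIntegrable _ _)]
  simp

theorem sn_of_neg {E : ℝ} (hE : E < 0) (x : ℝ) : sn E x = Real.sinh (√(-E) * x) / √(-E) := by
  have hk : √(-E) ≠ 0 := (Real.sqrt_pos.2 (neg_pos.2 hE)).ne'
  have h : ∀ y ∈ uIcc 0 x, HasDerivAt (fun y => Real.sinh (√(-E) * y) / √(-E)) (cs E y) y := by
    intro y _
    rw [cs_of_nonpos hE.le]
    have := (((hasDerivAt_id y).const_mul √(-E)).sinh).div_const √(-E)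
    refine this.congr_deriv ?_
    simp only [id, mul_one]
    field_simp
  rw [sn, intervalIntegral.integral_eq_sub_of_hasDerivAt h
    ((continuous_cs E).intervalIntegrable _ _)]
  simp

theorem cs_zero_energy (x : ℝ) : cs 0 x = 1 := by simp [cs]

theorem sn_zero_energy (x : ℝ) : sn 0 x = x := by simp [sn, cs_zero_energy]

theorem hasDerivAt_cs (E x : ℝ) : HasDerivAt (cs E) (-E * sn E x) x := by
  rcases lt_trichotomy E 0 with hE | rfl | hE
  · have h := ((hasDerivAt_id x).const_mul √(-E)).cosh
    have e : cs E = fun y => Real.cosh (√(-E) * id y) := funext fun y => cs_of_nonpos hE.le y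
    rw [e]
    convert h using 1
    have hk : √(-E) ≠ 0 := (Real.sqrt_pos.2 (neg_pos.2 hE)).ne'
    have hs : √(-E) ^ 2 = -E := Real.sq_sqrt (neg_nonneg.2 hE.le)
    rw [sn_of_neg hE]
    nth_rewrite 1 [← hs]
    simp only [id]
    field_simp
  · have e : cs 0 = fun _ => (1 : ℝ) := funext cs_zero_energy
    rw [e]
    simpa using hasDerivAt_const x (1 : ℝ)
  · have h := ((hasDerivAt_id x).const_mul √E).cos
    have e : cs E = fun y => Real.cos (√E * id y) := funext fun y => cs_of_nonneg hE.le y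
    rw [e]
    convert h using 1
    have hk : √E ≠ 0 := (Real.sqrt_pos.2 hE).ne'
    have hs : √E ^ 2 = E := Real.sq_sqrt hE.le
    rw [sn_of_pos hE]
    nth_rewrite 1 [← hs]
    simp only [id]
    field_simp

theorem continuous_sn (E : ℝ) : Continuous (sn E) :=
  continuous_iff_continuousAt.2 fun x => (hasDerivAt_sn E x).continuousAt

theorem cs_sq_add (E x : ℝ) : cs E x ^ 2 + E * sn E x ^ 2 = 1 := by
  have h : ∀ y, HasDerivAt (fun y => cs E y ^ 2 + E * sn E y ^ 2) 0 y := by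
    intro y
    refine (((hasDerivAt_cs E y).pow 2).add (((hasDerivAt_sn E y).pow 2).const_mul E)).congr_deriv ?_
    push_cast
    ring
  have := is_const_of_deriv_eq_zero (fun y => (h y).differentiableAt) (fun y => (h y).deriv) x 0
  simpa using this

/-! #### The energy intervals between consecutive flat bands -/

/-- The interval `(m², (m+1)²)`, to be read as `(-∞, 1)` for `m = 0`. -/
def energyInterval (m : ℕ) : Set ℝ := {E | E < ((m : ℝ) + 1) ^ 2 ∧ (m = 0 ∨ (m : ℝ) ^ 2 < E)}

/-- `cos kπ` for `E = k²`. -/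
def cPi (E : ℝ) : ℝ := cs E Real.pi

/-- `sin(kπ)/k` for `E = k²`. -/
def sPi (E : ℝ) : ℝ := sn E Real.pi

theorem continuous_cPi : Continuous cPi := continuous_cs_energy _

theorem continuous_sPi : Continuous sPi := continuous_sn_energy _

theorem cPi_sq_add (E : ℝ) : cPi E ^ 2 + E * sPi E ^ 2 = 1 := cs_sq_add E _

theorem cPi_natCast_sq (m : ℕ) : cPi ((m : ℝ) ^ 2) = (-1) ^ m := by
  rw [cPi, cs_of_nonneg (by positivity), Real.sqrt_sq (by positivity), Real.cos_nat_mul_pi]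

theorem sPi_natCast_sq (m : ℕ) : sPi (((m : ℝ) + 1) ^ 2) = 0 := by
  rw [sPi, sn_of_pos (by positivity), Real.sqrt_sq (by positivity)]
  have := Real.sin_nat_mul_pi (m + 1)
  push_cast at this
  rw [this, zero_div]

theorem sPi_pos_of_lt_one {E : ℝ} (hE : E < 1) : 0 < sPi E := by
  rcases lt_trichotomy E 0 with h | rfl | h
  · have hk : 0 < √(-E) := Real.sqrt_pos.2 (neg_pos.2 h)
    rw [sPi, sn_of_neg h]
    exact div_pos (Real.sinh_pos_iff.2 (mul_pos hk Real.pi_pos)) hk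
  · rw [sPi, sn_zero_energy]; exact Real.pi_pos
  · have hk : 0 < √E := Real.sqrt_pos.2 h
    have hk1 : √E < 1 := by rw [Real.sqrt_lt' one_pos]; simpa using hE
    rw [sPi, sn_of_pos h]
    refine div_pos (Real.sin_pos_of_pos_of_lt_pi (mul_pos hk Real.pi_pos) ?_) hk
    nlinarith [Real.pi_pos]

/-- Here √E lies strictly between m and m + 1 (for m = 0 nonpositive energies are added), so the
sine has the sign (-1)^m. -/
theorem sPi_sign {m : ℕ} {E : ℝ} (hE : E ∈ energyInterval m) : 0 < (-1) ^ m * sPi E := by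
  obtain ⟨h1, h2⟩ := hE
  rcases Nat.eq_zero_or_pos m with rfl | hm
  · simpa using sPi_pos_of_lt_one (by simpa using h1)
  · have h2 : (m : ℝ) ^ 2 < E := by
      rcases h2 with h | h
      · omega
      · exact h
    have h0 : 0 < E := lt_of_le_of_lt (by positivity) h2
    have hk : 0 < √E := Real.sqrt_pos.2 h0
    have hkm : (m : ℝ) < √E := Real.lt_sqrt_of_sq_lt h2
    have hkm1 : √E < m + 1 := by rwa [Real.sqrt_lt' (by positivity)]
    rw [sPi, sn_of_pos h0, ← mul_div_assoc]
    refine div_pos ?_ hk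
    have e : Real.sin (√E * Real.pi - m * Real.pi) = (-1) ^ m * Real.sin (√E * Real.pi) :=
      Real.sin_sub_nat_mul_pi _ _
    rw [← e]
    refine Real.sin_pos_of_pos_of_lt_pi ?_ ?_ <;> nlinarith [Real.pi_pos]

theorem sPi_ne_zero {m : ℕ} {E : ℝ} (hE : E ∈ energyInterval m) : sPi E ≠ 0 := by
  intro h
  have := sPi_sign hE
  simp [h] at this

theorem exists_energyInterval (E : ℝ) :
    (∃ m : ℕ, E = ((m : ℝ) + 1) ^ 2) ∨ ∃ m : ℕ, E ∈ energyInterval m := by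
  rcases lt_or_ge E 1 with h | h
  · exact Or.inr ⟨0, by simpa using h, Or.inl rfl⟩
  · have hk : 1 ≤ √E := Real.one_le_sqrt.2 h
    have hs : √E ^ 2 = E := Real.sq_sqrt (by linarith)
    have h1 := Nat.floor_le (show 0 ≤ √E by linarith)
    have h2 := Nat.lt_floor_add_one √E
    have h3 : 1 ≤ ⌊√E⌋₊ := (Nat.one_le_floor_iff _).2 hk
    rcases h1.eq_or_lt with h4 | h4
    · left
      refine ⟨⌊√E⌋₊ - 1, ?_⟩
      rw [Nat.cast_sub h3]
      rw [← hs, ← h4]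
      simp
    · right
      refine ⟨⌊√E⌋₊, ?_, Or.inr ?_⟩
      · nlinarith
      · nlinarith

/-! #### Monotonicity in the energy -/

theorem hasDerivAt_cPi {E : ℝ} (hE : E ≠ 0) : HasDerivAt cPi (-(Real.pi / 2) * sPi E) E := by
  rcases hE.lt_or_gt with h | h
  · have hk : √(-E) ≠ 0 := (Real.sqrt_pos.2 (neg_pos.2 h)).ne'
    have h1 := ((((hasDerivAt_id E).neg).sqrt (by simpa using hE)).mul_const Real.pi).cosh
    have h2 : cPi =ᶠ[𝓝 E] fun y => Real.cosh (√((-id) y) * Real.pi) := by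
      filter_upwards [Iio_mem_nhds h] with y hy
      rw [cPi, cs_of_nonpos (le_of_lt hy)]; simp
    refine (h1.congr_of_eventuallyEq h2).congr_deriv ?_
    rw [sPi, sn_of_neg h]
    simp only [Pi.neg_apply, id]
    field_simp
  · have hk : √E ≠ 0 := (Real.sqrt_pos.2 h).ne'
    have h1 := ((((hasDerivAt_id E)).sqrt (by simpa using hE)).mul_const Real.pi).cos
    have h2 : cPi =ᶠ[𝓝 E] fun y => Real.cos (√(id y) * Real.pi) := by
      filter_upwards [Ioi_mem_nhds h] with y hy
      rw [cPi, cs_of_nonneg (le_of_lt hy)]; simp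
    refine (h1.congr_of_eventuallyEq h2).congr_deriv ?_
    rw [sPi, sn_of_pos h]
    simp only [id]
    field_simp

theorem hasDerivAt_sPi {E : ℝ} (hE : E ≠ 0) :
    HasDerivAt sPi ((Real.pi * cPi E - sPi E) / (2 * E)) E := by
  rcases hE.lt_or_gt with h | h
  · have hk : √(-E) ≠ 0 := (Real.sqrt_pos.2 (neg_pos.2 h)).ne'
    have hs : √(-E) ^ 2 = -E := Real.sq_sqrt (by linarith)
    have h0 := ((hasDerivAt_id E).neg).sqrt (by simpa using hE)
    have h1 := ((h0.mul_const Real.pi).sinh).div h0 hk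
    have h2 : sPi =ᶠ[𝓝 E] fun y => Real.sinh (√((-id) y) * Real.pi) / √((-id) y) := by
      filter_upwards [Iio_mem_nhds h] with y hy
      rw [sPi, sn_of_neg hy]; simp
    refine (h1.congr_of_eventuallyEq h2).congr_deriv ?_
    rw [sPi, sn_of_neg h, cPi, cs_of_nonpos h.le]
    simp only [Pi.neg_apply, id]
    rw [hs]
    field_simp
    ring
  · have hk : √E ≠ 0 := (Real.sqrt_pos.2 h).ne'
    have hs : √E ^ 2 = E := Real.sq_sqrt (by linarith)
    have h0 := (hasDerivAt_id E).sqrt (by simpa using hE)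
    have h1 := ((h0.mul_const Real.pi).sin).div h0 hk
    have h2 : sPi =ᶠ[𝓝 E] fun y => Real.sin (√(id y) * Real.pi) / √(id y) := by
      filter_upwards [Ioi_mem_nhds h] with y hy
      rw [sPi, sn_of_pos hy]; simp
    refine (h1.congr_of_eventuallyEq h2).congr_deriv ?_
    rw [sPi, sn_of_pos h, cPi, cs_of_nonneg h.le]
    simp only [id]
    rw [hs]
    field_simp

theorem abs_sPi_lt {E : ℝ} (hE : 0 < E) : |sPi E| < Real.pi := by
  have hk : 0 < √E := Real.sqrt_pos.2 hE
  rw [sPi, sn_of_pos hE, abs_div, abs_of_pos hk, div_lt_iff₀ hk]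
  have := Real.abs_sin_lt_abs (x := √E * Real.pi) (mul_pos hk Real.pi_pos).ne'
  rw [mul_comm Real.pi]
  rwa [abs_of_pos (mul_pos hk Real.pi_pos)] at this

theorem pi_lt_sPi {E : ℝ} (hE : E < 0) : Real.pi < sPi E := by
  have hk : 0 < √(-E) := Real.sqrt_pos.2 (neg_pos.2 hE)
  rw [sPi, sn_of_neg hE, lt_div_iff₀ hk, mul_comm]
  exact Real.self_lt_sinh_iff.2 (mul_pos hk Real.pi_pos)

theorem one_lt_cPi {E : ℝ} (hE : E < 0) : 1 < cPi E := by
  have hk : 0 < √(-E) := Real.sqrt_pos.2 (neg_pos.2 hE)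
  rw [cPi, cs_of_nonpos hE.le, Real.one_lt_cosh]
  exact (mul_pos hk Real.pi_pos).ne'

theorem abs_cPi_le {E : ℝ} (hE : 0 ≤ E) : |cPi E| ≤ 1 := by
  rw [cPi, cs_of_nonneg hE]
  exact Real.abs_cos_le_one _

theorem hasDerivAt_quot {E : ℝ} (hE : E ≠ 0) (hs : sPi E ≠ 0) (t : ℝ) :
    HasDerivAt (fun E => (cPi E - t) / sPi E)
      (((cPi E - t) * sPi E - Real.pi * (1 - t * cPi E)) / (2 * E) / sPi E ^ 2) E := by
  refine (((hasDerivAt_cPi hE).sub_const t).div (hasDerivAt_sPi hE) hs).congr_deriv ?_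
  congr 1
  have h := cPi_sq_add E
  field_simp
  linear_combination (-Real.pi) * h

/-- The numerator is affine in t, hence a convex combination, with weights (1 ± t)/2, of its values
at t = ±1, which factor. For E > 0 both are nonpositive and not both zero, since |cPi| ≤ 1 and |sPi|
< π. For E < 0 both are positive, since cPi > 1 and sPi > π, and the factor 2E is negative. -/
theorem quot_deriv_neg {E : ℝ} (hE : E ≠ 0) (hs : sPi E ≠ 0) {t : ℝ} (ht : |t| < 1) :
    ((cPi E - t) * sPi E - Real.pi * (1 - t * cPi E)) / (2 * E) / sPi E ^ 2 < 0 := by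
  refine div_neg_of_neg_of_pos ?_ (by positivity)
  obtain ⟨t1, t2⟩ := abs_lt.1 ht
  have e : (cPi E - t) * sPi E - Real.pi * (1 - t * cPi E)
      = (1 + t) / 2 * (-((1 - cPi E) * (sPi E + Real.pi)))
        + (1 - t) / 2 * ((1 + cPi E) * (sPi E - Real.pi)) := by ring
  rcases hE.lt_or_gt with h | h
  · refine div_neg_of_pos_of_neg ?_ (by linarith)
    have h1 := pi_lt_sPi h
    have h2 := one_lt_cPi h
    rw [e]
    have a1 : 0 < (1 + t) / 2 := by linarith
    have a2 : 0 < (1 - t) / 2 := by linarith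
    have a3 : 0 < -((1 - cPi E) * (sPi E + Real.pi)) := by nlinarith [Real.pi_pos]
    have a4 : 0 < (1 + cPi E) * (sPi E - Real.pi) := by nlinarith [Real.pi_pos]
    positivity
  · refine div_neg_of_neg_of_pos ?_ (by linarith)
    obtain ⟨h1, h1'⟩ := abs_lt.1 (abs_sPi_lt h)
    obtain ⟨h2, h2'⟩ := abs_le.1 (abs_cPi_le h.le)
    rw [e]
    have a1 : 0 < (1 + t) / 2 := by linarith
    have a2 : 0 < (1 - t) / 2 := by linarith
    have b1 : 0 < sPi E + Real.pi := by linarith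
    have b2 : 0 < Real.pi - sPi E := by linarith
    rcases h2.eq_or_lt with h3 | h3
    · rw [← h3]
      nlinarith [mul_pos a1 b1]
    · have := mul_pos a2 (mul_pos (show 0 < 1 + cPi E by linarith) b2)
      have := mul_nonneg a1.le (mul_nonneg (show 0 ≤ 1 - cPi E by linarith) b1.le)
      nlinarith

theorem energyInterval_eq_of_pos {m : ℕ} (hm : m ≠ 0) :
    energyInterval m = Ioo ((m : ℝ) ^ 2) (((m : ℝ) + 1) ^ 2) := by
  ext E
  simp [energyInterval, hm, and_comm]

theorem energyInterval_zero : energyInterval 0 = Iio 1 := by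
  ext E
  simp [energyInterval]

/-- In each energy interval the function `(cos kπ - t) k / sin kπ` is strictly decreasing. -/
theorem strictAntiOn_quot (m : ℕ) {t : ℝ} (ht : |t| < 1) :
    StrictAntiOn (fun E => (cPi E - t) / sPi E) (energyInterval m) := by
  have hc : ContinuousOn (fun E => (cPi E - t) / sPi E) (energyInterval m) :=
    (continuous_cPi.continuousOn.sub continuousOn_const).div continuous_sPi.continuousOn
      fun E hE => sPi_ne_zero hE
  have key : ∀ s : Set ℝ, Convex ℝ s → s ⊆ energyInterval m → (∀ E ∈ interior s, E ≠ 0) →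
      StrictAntiOn (fun E => (cPi E - t) / sPi E) s := by
    intro s hs hsub h0
    refine strictAntiOn_of_deriv_neg hs (hc.mono hsub) fun E hE => ?_
    have hE' := sPi_ne_zero (hsub (interior_subset hE))
    rw [(hasDerivAt_quot (h0 E hE) hE' t).deriv]
    exact quot_deriv_neg (h0 E hE) hE' ht
  rcases Nat.eq_zero_or_pos m with rfl | hm
  -- The derivative is known only for E ≠ 0; splitting at 0 puts that point on the boundary of both
  -- pieces, where continuity suffices.
  · have e : energyInterval 0 = Iic 0 ∪ Ico 0 1 := by
      rw [energyInterval_zero, Iic_union_Ico_eq_Iio one_pos]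
    rw [e]
    refine StrictAntiOn.union (c := 0) (key _ (convex_Iic 0) (e ▸ subset_union_left) ?_)
      (key _ (convex_Ico 0 1) (e ▸ subset_union_right) ?_) isGreatest_Iic (isLeast_Ico one_pos)
    · intro E hE; rw [interior_Iic] at hE; exact (ne_of_lt hE)
    · intro E hE; rw [interior_Ico] at hE; exact (ne_of_gt hE.1)
  · have e := energyInterval_eq_of_pos hm.ne'
    refine key _ (by rw [e]; exact convex_Ioo _ _) subset_rfl fun E hE => ?_
    have h2 := interior_subset hE
    rw [e] at h2
    exact (lt_of_le_of_lt (by positivity) h2.1).ne'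

/-! #### The half-trace of the transfer matrix -/

/-- `cos kπ + α sin(kπ) / (4k)` for `E = k²`. -/
def eta (α E : ℝ) : ℝ := cPi E + α / 4 * sPi E

theorem continuous_eta (α : ℝ) : Continuous (eta α) :=
  continuous_cPi.add (continuous_const.mul continuous_sPi)

theorem eta_flat (α : ℝ) (m : ℕ) : eta α (((m : ℝ) + 1) ^ 2) = (-1) ^ (m + 1) := by
  rw [eta, sPi_natCast_sq, mul_zero, add_zero]
  exact_mod_cast cPi_natCast_sq (m + 1)

theorem eta_growth {α E : ℝ} (hE : E ≤ -(|α| / 2 + 1) ^ 2) :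
    sPi E ≤ 2 * eta α E ∧ √(-E) ≤ eta α E := by
  have ha := abs_nonneg α
  have h0 : E < 0 := by nlinarith
  have hk : 0 < √(-E) := Real.sqrt_pos.2 (neg_pos.2 h0)
  have hk1 : |α| / 2 + 1 ≤ √(-E) := Real.le_sqrt_of_sq_le (by linarith)
  have hc : sPi E * √(-E) ≤ cPi E := by
    rw [sPi, sn_of_neg h0, cPi, cs_of_nonpos h0.le, div_mul_cancel₀ _ hk.ne']
    exact (Real.sinh_lt_cosh _).le
  have hc1 : √(-E) * Real.pi ≤ cPi E := by
    rw [cPi, cs_of_nonpos h0.le]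
    exact (Real.self_le_sinh_iff.2 (by positivity)).trans (Real.sinh_lt_cosh _).le
  have hs : 0 < sPi E := Real.pi_pos.trans (pi_lt_sPi h0)
  have h1 : sPi E * (|α| / 2 + 1) ≤ cPi E := le_trans (by gcongr) hc
  have h2 : -(|α|) * sPi E ≤ α * sPi E := by
    gcongr
    exact neg_abs_le α
  have h3 := Real.pi_gt_three
  have h4 : 0 ≤ |α| * sPi E := by positivity
  unfold eta
  constructor
  · nlinarith
  · nlinarith

/-- This makes sPi/λ bounded over all gaps at once, including the first one, where both sPi and η
grow exponentially as E → -∞. Very negative energies are covered by `eta_growth`, positive ones by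
|sPi| < π, and the rest is compact. -/
theorem exists_sPi_bound (α : ℝ) : ∃ S > 0, ∀ E, |sPi E| ≤ S * max 1 |eta α E| := by
  obtain ⟨M, hM⟩ := (isCompact_Icc (a := -(|α| / 2 + 1) ^ 2) (b := 0)).bddAbove_image
    continuous_sPi.abs.continuousOn
  refine ⟨max (max M 2) Real.pi, by positivity, fun E => ?_⟩
  have h1 : (1 : ℝ) ≤ max 1 |eta α E| := le_max_left _ _
  rcases le_or_gt E (-(|α| / 2 + 1) ^ 2) with h | h
  · have := eta_growth h
    have h0 : E < 0 := by nlinarith [abs_nonneg α]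
    rw [abs_of_pos (sPi_pos_of_lt_one (by linarith))]
    calc sPi E ≤ 2 * eta α E := this.1
      _ ≤ max (max M 2) Real.pi * max 1 |eta α E| := by
        gcongr
        · exact (Real.sqrt_nonneg _).trans this.2
        · exact (le_max_right _ _).trans (le_max_left _ _)
        · exact (le_abs_self _).trans (le_max_right _ _)
  · refine le_trans ?_ (le_mul_of_one_le_right (by positivity) h1)
    rcases le_or_gt E 0 with h0 | h0
    · exact (hM ⟨E, ⟨h.le, h0⟩, rfl⟩).trans ((le_max_left _ _).trans (le_max_left _ _))
    · exact (abs_sPi_lt h0).le.trans (le_max_right _ _)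

theorem exists_low_energy (α K : ℝ) : ∃ E₀ < 0, ∀ E ≤ E₀, K ≤ eta α E := by
  refine ⟨-(|α| / 2 + 1 + |K|) ^ 2, by nlinarith [abs_nonneg α, abs_nonneg K], fun E hE => ?_⟩
  have hα := abs_nonneg α
  have hK := abs_nonneg K
  refine le_trans ?_ (eta_growth (hE.trans ?_)).2
  · exact (le_abs_self K).trans (Real.le_sqrt_of_sq_le (by nlinarith))
  · exact neg_le_neg (pow_le_pow_left₀ (by positivity) (by linarith) 2)

/-- At the ends of the interval η is 1 and -1 in some order; for m = 0 the missing left end is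
replaced by an energy so low that η ≥ 1. -/
theorem exists_eta_eq (α : ℝ) (m : ℕ) {t : ℝ} (ht : |t| < 1) :
    ∃ E ∈ energyInterval m, eta α E = t := by
  obtain ⟨t1, t2⟩ := abs_lt.1 ht
  rcases Nat.eq_zero_or_pos m with rfl | hm
  · obtain ⟨E₀, h0, h1⟩ := exists_low_energy α 1
    have h2 := intermediate_value_Ioo' (a := E₀) (b := 1) (by linarith)
      (continuous_eta α).continuousOn
    have e := eta_flat α 0
    norm_num at e
    obtain ⟨E, hE, h3⟩ := h2 (show t ∈ Ioo (eta α 1) (eta α E₀) by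
      rw [e]; exact ⟨t1, t2.trans_le (h1 _ le_rfl)⟩)
    exact ⟨E, by rw [energyInterval_zero]; exact hE.2, h3⟩
  · obtain ⟨k, rfl⟩ := Nat.exists_eq_add_of_lt hm
    rw [zero_add, energyInterval_eq_of_pos (by omega)]
    have e1 := eta_flat α k
    have e2 := eta_flat α (k + 1)
    push_cast at e2 ⊢
    have hle : ((k : ℝ) + 1) ^ 2 ≤ ((k : ℝ) + 1 + 1) ^ 2 := by gcongr; linarith
    rcases Nat.even_or_odd k with hk | hk
    · have h := intermediate_value_Ioo hle (continuous_eta α).continuousOn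
      rw [e1, e2, hk.add_one.neg_one_pow, hk.add_one.add_one.neg_one_pow] at h
      obtain ⟨E, hE, h3⟩ := h ⟨t1, t2⟩
      exact ⟨E, hE, h3⟩
    · have h := intermediate_value_Ioo' hle (continuous_eta α).continuousOn
      rw [e1, e2, hk.add_one.neg_one_pow, hk.add_one.add_one.neg_one_pow] at h
      obtain ⟨E, hE, h3⟩ := h ⟨t1, t2⟩
      exact ⟨E, hE, h3⟩

/-- η need not be monotone, but η = t means (cPi - t)/sPi = -α/4, and that quotient is strictly
decreasing. So each level in (-1, 1) is crossed once, in a direction fixed by the sign of sPi. -/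
theorem eta_sub_sign {α : ℝ} {m : ℕ} {t E E' : ℝ} (ht : |t| < 1) (hE : E ∈ energyInterval m)
    (hE' : E' ∈ energyInterval m) (h' : eta α E' = t) :
    0 < (-1) ^ m * (eta α E - t) ↔ E < E' := by
  have hs := sPi_ne_zero hE
  have hs' := sPi_ne_zero hE'
  have e : (-1) ^ m * (eta α E - t)
      = ((-1) ^ m * sPi E) * ((cPi E - t) / sPi E - (cPi E' - t) / sPi E') := by
    have e2 : (cPi E' - t) / sPi E' = -(α / 4) := by
      rw [div_eq_iff hs', ← h', eta]; ring
    rw [e2, eta]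
    field_simp
    ring
  rw [e, mul_pos_iff_of_pos_left (sPi_sign hE), sub_pos]
  exact (strictAntiOn_quot m ht).lt_iff_gt hE' hE

/-! ### Integration by parts for absolutely continuous functions -/

/-- The increments are dominated by those of the primitive of ‖g‖, which is real-valued and
absolutely continuous. -/
theorem absolutelyContinuousOnInterval_primitive {g : ℝ → ℂ} {a b : ℝ}
    (hg : IntervalIntegrable g volume a b) :
    AbsolutelyContinuousOnInterval (fun x => ∫ t in a..x, g t) a b := by
  have h := (IntervalIntegrable.absolutelyContinuousOnInterval_intervalIntegral
    (f := fun t => ‖g t‖) hg.norm (c := a) left_mem_uIcc)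
  rw [absolutelyContinuousOnInterval_iff] at h ⊢
  intro ε hε
  obtain ⟨δ, hδ, h⟩ := h ε hε
  refine ⟨δ, hδ, fun I hI hlt => lt_of_le_of_lt (Finset.sum_le_sum fun i hi => ?_) (h I hI hlt)⟩
  have hm := hI.1 i hi
  have h1 : IntervalIntegrable g volume a (I.2 i).1 :=
    hg.mono_set (uIcc_subset_uIcc left_mem_uIcc hm.1)
  have h2 : IntervalIntegrable g volume a (I.2 i).2 :=
    hg.mono_set (uIcc_subset_uIcc left_mem_uIcc hm.2)
  rw [dist_eq_norm, dist_eq_norm, intervalIntegral.integral_interval_sub_left h1 h2,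
    intervalIntegral.integral_interval_sub_left h1.norm h2.norm]
  exact intervalIntegral.norm_integral_le_abs_integral_norm

/-- Product rule in integrated form for an absolutely continuous and a continuously differentiable
factor. -/
theorem mul_eq_add_integral {u u₁ v v' : ℝ → ℂ} {b : ℝ} (hb : 0 ≤ b)
    (hu₁ : IntervalIntegrable u₁ volume 0 b)
    (hu : ∀ x ∈ Icc 0 b, u x = u 0 + ∫ t in (0 : ℝ)..x, u₁ t)
    (hv : ∀ x, HasDerivAt v (v' x) x) (hv' : Continuous v') {x : ℝ} (hx : x ∈ Icc 0 b) :
    u x * v x = u 0 * v 0 + ∫ t in (0 : ℝ)..x, (u₁ t * v t + u t * v' t) := by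
  have hvc : Continuous v := continuous_iff_continuousAt.2 fun x => (hv x).continuousAt
  set U : ℝ → ℂ := fun x => u 0 + ∫ t in (0 : ℝ)..x, u₁ t with hU
  have hprim := absolutelyContinuousOnInterval_primitive hu₁
  have hUac : AbsolutelyContinuousOnInterval U 0 b := by
    have hc : AbsolutelyContinuousOnInterval (fun _ : ℝ => u 0) 0 b :=
      ContDiffOn.absolutelyContinuousOnInterval contDiffOn_const
    exact hc.add hprim
  have hvac : AbsolutelyContinuousOnInterval v 0 b := by
    apply ContDiffOn.absolutelyContinuousOnInterval
    apply ContDiff.contDiffOn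
    rw [contDiff_one_iff_deriv]
    exact ⟨fun x => (hv x).differentiableAt, by
      rw [show deriv v = v' from funext fun x => (hv x).deriv]; exact hv'⟩
  have hUc : ContinuousOn U (uIcc 0 b) := hUac.continuousOn
  have hint : IntervalIntegrable (fun t => u₁ t * v t + U t * v' t) volume 0 b := by
    refine (hu₁.mul_continuousOn hvc.continuousOn).add ?_
    exact (hUc.mul hv'.continuousOn).intervalIntegrable
  -- The difference of the two sides is absolutely continuous with derivative zero almost
  -- everywhere, hence constant.
  have hac : AbsolutelyContinuousOnInterval
      (fun x => U x * v x - ∫ t in (0 : ℝ)..x, (u₁ t * v t + U t * v' t)) 0 b :=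
    (hUac.smul hvac).sub (absolutelyContinuousOnInterval_primitive hint)
  have hd : ∀ᵐ x, x ∈ uIcc 0 b → HasDerivAt
      (fun x => U x * v x - ∫ t in (0 : ℝ)..x, (u₁ t * v t + U t * v' t)) 0 x := by
    filter_upwards [hu₁.ae_hasDerivAt_integral, hint.ae_hasDerivAt_integral] with x h1 h2 hx
    have e1 := (((h1 hx 0 left_mem_uIcc).const_add (u 0)).mul (hv x)).sub (h2 hx 0 left_mem_uIcc)
    refine e1.congr_deriv ?_
    simp [hU]
  obtain ⟨c, hc⟩ := hac.const_of_ae_hasDerivAt_zero hd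
  have hx' : x ∈ uIcc 0 b := by rwa [uIcc_of_le hb]
  have e1 := hc x hx'
  have e0 := hc 0 left_mem_uIcc
  have hUu : ∀ t ∈ Icc 0 b, U t = u t := fun t ht => (hu t ht).symm
  have hI : ∫ t in (0 : ℝ)..x, (u₁ t * v t + U t * v' t)
      = ∫ t in (0 : ℝ)..x, (u₁ t * v t + u t * v' t) := by
    refine intervalIntegral.integral_congr fun t ht => ?_
    rw [uIcc_of_le hx.1] at ht
    simp only [hUu t ⟨ht.1, ht.2.trans hx.2⟩]
  rw [hI] at e1
  simp only [intervalIntegral.integral_same, sub_zero, hUu 0 ⟨le_rfl, hb⟩, hUu x hx] at e0 e1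
  rw [e0, ← e1]
  ring

/-! ### Green's identity on an edge -/

/-- The gauge factor e^{wx} turns d/dx + w into d/dx, so this is Lagrange's identity for e^{wx} f
and θ. With θ a solution of θ'' = -Eθ it becomes variation of constants; with a θ vanishing to
second order at π it expresses the vertex value f(0) by integrals over the edge. -/
theorem IsSobolevH2.green {f f' f'' : ℝ → ℂ} (h : IsSobolevH2 f f' f'') (w E : ℂ)
    {θ θ' θ'' : ℝ → ℂ} (h1 : ∀ x, HasDerivAt θ (θ' x) x) (h2 : ∀ x, HasDerivAt θ' (θ'' x) x)
    (h3 : Continuous θ'') {x : ℝ} (hx : x ∈ Icc (0 : ℝ) Real.pi) :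
    Complex.exp (w * x) * ((f' x + w * f x) * θ x - f x * θ' x)
      = ((f' 0 + w * f 0) * θ 0 - f 0 * θ' 0)
        - ∫ t in (0 : ℝ)..x, Complex.exp (w * t) *
          ((-(f'' t + 2 * w * f' t + w ^ 2 * f t) - E * f t) * θ t
            + f t * (θ'' t + E * θ t)) := by
  have hc1 : Continuous θ := continuous_iff_continuousAt.2 fun x => (h1 x).continuousAt
  have hc2 : Continuous θ' := continuous_iff_continuousAt.2 fun x => (h2 x).continuousAt
  have he : ∀ x : ℝ, HasDerivAt (fun x : ℝ => Complex.exp (w * x)) (Complex.exp (w * x) * w) x := by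
    intro x
    have := ((Complex.ofRealCLM.hasDerivAt (x := x)).const_mul w).cexp
    simpa using this
  have hec : Continuous fun x : ℝ => Complex.exp (w * x) := by fun_prop
  have hv1 : ∀ x : ℝ, HasDerivAt (fun x : ℝ => Complex.exp (w * x) * θ x)
      (Complex.exp (w * x) * (w * θ x + θ' x)) x := fun x =>
    ((he x).mul (h1 x)).congr_deriv (by ring)
  have hv2 : ∀ x : ℝ, HasDerivAt (fun x : ℝ => Complex.exp (w * x) * (w * θ x - θ' x))
      (Complex.exp (w * x) * (w ^ 2 * θ x - θ'' x)) x := fun x =>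
    ((he x).mul (((h1 x).const_mul w).sub (h2 x))).congr_deriv (by
      simp only [Pi.sub_apply]; ring)
  have e1 := mul_eq_add_integral Real.pi_pos.le h.intervalIntegrable_deriv2 h.deriv_eq_integral
    hv1 (by fun_prop) hx
  have e2 := mul_eq_add_integral Real.pi_pos.le h.intervalIntegrable_deriv h.eq_integral
    hv2 (by fun_prop) hx
  have hf' : ContinuousOn f (Icc 0 Real.pi) := by
    have := intervalIntegral.continuousOn_primitive_interval (μ := volume) (f := f')
      (a := 0) (b := Real.pi) (by
        have := h.intervalIntegrable_deriv
        rw [intervalIntegrable_iff_integrableOn_Icc_of_le Real.pi_pos.le] at this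
        rwa [uIcc_of_le Real.pi_pos.le])
    rw [uIcc_of_le Real.pi_pos.le] at this
    exact (continuousOn_const.add this).congr h.eq_integral
  have hsub : uIcc 0 x ⊆ Icc 0 Real.pi := by
    rw [uIcc_of_le hx.1]; exact Icc_subset_Icc_right hx.2
  have i1 : IntervalIntegrable (fun t => f'' t * (Complex.exp (w * t) * θ t)
      + f' t * (Complex.exp (w * t) * (w * θ t + θ' t))) volume 0 x := by
    refine ((intervalIntegrable_of_mem h.intervalIntegrable_deriv2 hx).mul_continuousOn
      (by fun_prop)).add ?_
    exact ((h.continuousOn_deriv.mono hsub).mul (by fun_prop)).intervalIntegrable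
  have i2 : IntervalIntegrable (fun t => f' t * (Complex.exp (w * t) * (w * θ t - θ' t))
      + f t * (Complex.exp (w * t) * (w ^ 2 * θ t - θ'' t))) volume 0 x := by
    refine ContinuousOn.intervalIntegrable ?_
    exact ((h.continuousOn_deriv.mono hsub).mul (by fun_prop)).add
      ((hf'.mono hsub).mul (by fun_prop))
  have e3 := intervalIntegral.integral_add i1 i2
  have e4 : ∫ t in (0 : ℝ)..x, Complex.exp (w * t) *
          ((-(f'' t + 2 * w * f' t + w ^ 2 * f t) - E * f t) * θ t
            + f t * (θ'' t + E * θ t))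
      = - ∫ t in (0 : ℝ)..x, ((f'' t * (Complex.exp (w * t) * θ t)
      + f' t * (Complex.exp (w * t) * (w * θ t + θ' t)))
      + (f' t * (Complex.exp (w * t) * (w * θ t - θ' t))
      + f t * (Complex.exp (w * t) * (w ^ 2 * θ t - θ'' t)))) := by
    rw [← intervalIntegral.integral_neg]
    congr 1
    ext t
    ring
  rw [e4, e3]
  simp only [Complex.ofReal_zero, mul_zero, Complex.exp_zero, one_mul] at e1 e2
  linear_combination e1 + e2

theorem hasDerivAt_sn_sub (E x t : ℝ) :
    HasDerivAt (fun t => ((sn E (x - t) : ℝ) : ℂ)) (-(cs E (x - t) : ℝ) : ℂ) t := by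
  have := ((hasDerivAt_sn E (x - t)).comp t ((hasDerivAt_id t).const_sub x)).ofReal_comp
  refine this.congr_deriv ?_
  simp

theorem hasDerivAt_cs_sub (E x t : ℝ) :
    HasDerivAt (fun t => ((cs E (x - t) : ℝ) : ℂ)) ((E * sn E (x - t) : ℝ) : ℂ) t := by
  have := ((hasDerivAt_cs E (x - t)).comp t ((hasDerivAt_id t).const_sub x)).ofReal_comp
  refine this.congr_deriv ?_
  simp

/-- Variation of constants for the function. -/
theorem IsSobolevH2.exp_mul_eq {f f' f'' : ℝ → ℂ} (h : IsSobolevH2 f f' f'') (w : ℂ) (E : ℝ)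
    {x : ℝ} (hx : x ∈ Icc (0 : ℝ) Real.pi) :
    Complex.exp (w * x) * f x
      = (f' 0 + w * f 0) * sn E x + f 0 * cs E x
        - ∫ t in (0 : ℝ)..x, Complex.exp (w * t) *
          ((-(f'' t + 2 * w * f' t + w ^ 2 * f t) - E * f t) * sn E (x - t)) := by
  have key := h.green w E (θ := fun t => ((sn E (x - t) : ℝ) : ℂ))
    (θ' := fun t => (-(cs E (x - t) : ℝ) : ℂ)) (θ'' := fun t => (-(E * sn E (x - t) : ℝ) : ℂ))
    (hasDerivAt_sn_sub E x) (fun t => (hasDerivAt_cs_sub E x t).neg)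
    (by have := continuous_sn E; fun_prop) hx
  simp only [sub_self, sn_zero, cs_zero, Complex.ofReal_zero, Complex.ofReal_one, sub_zero] at key
  have e : ∀ t : ℝ, (-(E * sn E (x - t) : ℝ) : ℂ) + E * (sn E (x - t) : ℝ) = 0 := by
    intro t; push_cast; ring
  simp only [e, mul_zero, add_zero] at key
  linear_combination key

/-- Variation of constants for the quasi-derivative. -/
theorem IsSobolevH2.exp_mul_quasiDeriv_eq {f f' f'' : ℝ → ℂ} (h : IsSobolevH2 f f' f'') (w : ℂ)
    (E : ℝ) {x : ℝ} (hx : x ∈ Icc (0 : ℝ) Real.pi) :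
    Complex.exp (w * x) * (f' x + w * f x)
      = (f' 0 + w * f 0) * cs E x - f 0 * (E * sn E x)
        - ∫ t in (0 : ℝ)..x, Complex.exp (w * t) *
          ((-(f'' t + 2 * w * f' t + w ^ 2 * f t) - E * f t) * cs E (x - t)) := by
  have key := h.green w E (θ := fun t => ((cs E (x - t) : ℝ) : ℂ))
    (θ' := fun t => ((E * sn E (x - t) : ℝ) : ℂ)) (θ'' := fun t => ((E : ℂ) * -(cs E (x - t) : ℝ)))
    (hasDerivAt_cs_sub E x) (fun t => by
      have := (hasDerivAt_sn_sub E x t).const_mul (E : ℂ)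
      refine HasDerivAt.congr_of_eventuallyEq this (Eventually.of_forall fun y => ?_)
      push_cast; rfl)
    (by have := continuous_cs E; fun_prop) hx
  simp only [sub_self, sn_zero, cs_zero, Complex.ofReal_one, sub_zero] at key
  have e : ∀ t : ℝ, (E : ℂ) * -(cs E (x - t) : ℝ) + E * (cs E (x - t) : ℝ) = 0 := by
    intro t; ring
  simp only [e, mul_zero, add_zero] at key
  push_cast at key
  linear_combination key

/-- A smooth function on the edge with `θ(0) = 0`, `θ'(0) = 1` that vanishes to second order at
the other end. -/
def bump (t : ℝ) : ℂ := t * (1 - t / Real.pi) ^ 2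

/-- The second derivative of `bump`. -/
def bump'' (t : ℝ) : ℂ := (-4 / Real.pi + 6 * t / Real.pi ^ 2)

/-- The value at the vertex as an integral over the edge. -/
theorem IsSobolevH2.apply_zero_eq {f f' f'' : ℝ → ℂ} (h : IsSobolevH2 f f' f'') (w : ℂ) (E : ℝ) :
    f 0 = - ∫ t in (0 : ℝ)..Real.pi, Complex.exp (w * t) *
          ((-(f'' t + 2 * w * f' t + w ^ 2 * f t) - E * f t) * bump t
            + f t * (bump'' t + E * bump t)) := by
  have hpi : (Real.pi : ℂ) ≠ 0 := by exact_mod_cast Real.pi_ne_zero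
  have hid : ∀ t : ℝ, HasDerivAt (fun t : ℝ => (t : ℂ)) 1 t := fun t =>
    (Complex.ofRealCLM.hasDerivAt (x := t)).congr_deriv (by simp)
  have key := h.green w E (θ := bump)
    (θ' := fun t => 1 - 4 * t / Real.pi + 3 * t ^ 2 / Real.pi ^ 2) (θ'' := bump'')
    (fun t => by
      have := (hid t).mul ((((hid t).div_const (Real.pi : ℂ)).const_sub 1).pow 2)
      refine this.congr_deriv ?_
      simp only [Nat.cast_ofNat, Nat.add_one_sub_one, pow_one, Pi.pow_apply]
      field_simp
      ring)
    (fun t => by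
      have := ((((hid t).const_mul 4).div_const (Real.pi : ℂ)).const_sub 1).add
        ((((hid t).pow 2).const_mul 3).div_const ((Real.pi : ℂ) ^ 2))
      refine this.congr_deriv ?_
      simp only [Nat.cast_ofNat, Nat.add_one_sub_one, pow_one, bump'']
      field_simp
      ring)
    (by unfold bump''; fun_prop) ⟨Real.pi_pos.le, le_rfl⟩
  have e1 : bump Real.pi = 0 := by simp [bump, hpi]
  have e2 : (1 : ℂ) - 4 * Real.pi / Real.pi + 3 * Real.pi ^ 2 / Real.pi ^ 2 = 0 := by
    field_simp; norm_num
  have e3 : bump 0 = 0 := by simp [bump]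
  simp only [e1, e2, e3, Complex.ofReal_zero, mul_zero, zero_div, sub_zero, add_zero, ne_eq,
    OfNat.ofNat_ne_zero, not_false_eq_true, zero_pow, mul_one, zero_sub] at key
  linear_combination key

/-! ### Vertex values of functions in the domain -/

/-- The functions `f`, with derivatives `f'` and `f''`, exhibit `(u, h)` as an element of the graph
of the magnetic Laplacian. -/
structure Realizes (A β : ℤ → ℝ) (u h : ChainL2) (f f' f'' : ℤ → Bool → ℝ → ℂ) : Prop where
  sobolev : ∀ j s, IsSobolevH2 (f j s) (f' j s) (f'' j s)
  coupling : DeltaCoupling A β f f'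
  fst_ae : ∀ j s, u (j, s) =ᵐ[volume.restrict (Ioo (0 : ℝ) Real.pi)] f j s
  snd_ae : ∀ j s,
    h (j, s) =ᵐ[volume.restrict (Ioo (0 : ℝ) Real.pi)] negQuasiDerivSq A f f' f'' j s

theorem mem_laplacianGraph_iff {A β : ℤ → ℝ} {u h : ChainL2} :
    (u, h) ∈ laplacianGraph A β ↔ ∃ f f' f'', Realizes A β u h f f' f'' :=
  ⟨fun ⟨f, f', f'', h1, h2, h3, h4⟩ => ⟨f, f', f'', h1, h2, h3, h4⟩,
    fun ⟨f, f', f'', h1, h2, h3, h4⟩ => ⟨f, f', f'', h1, h2, h3, h4⟩⟩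

/-- The function `-𝒟²f - Ef` on an edge. -/
def residual (A : ℤ → ℝ) (E : ℝ) (f f' f'' : ℤ → Bool → ℝ → ℂ) (j : ℤ) (s : Bool) (t : ℝ) : ℂ :=
  -(f'' j s t + 2 * potential A j s * f' j s t + potential A j s ^ 2 * f j s t) - E * f j s t

theorem Realizes.residual_ae {A β : ℤ → ℝ} {u h : ChainL2} {f f' f'' : ℤ → Bool → ℝ → ℂ}
    (H : Realizes A β u h f f' f'') (E : ℝ) (j : ℤ) (s : Bool) :
    (h - (E : ℂ) • u) (j, s) =ᵐ[volume.restrict (Ioo (0 : ℝ) Real.pi)]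
      residual A E f f' f'' j s := by
  have e : (h - (E : ℂ) • u) (j, s) = h (j, s) - (E : ℂ) • u (j, s) := rfl
  rw [e]
  filter_upwards [Lp.coeFn_sub (h (j, s)) ((E : ℂ) • u (j, s)),
    Lp.coeFn_smul (E : ℂ) (u (j, s)), H.fst_ae j s, H.snd_ae j s] with t h1 h2 h3 h4
  rw [h1, Pi.sub_apply, h2, Pi.smul_apply, h3, h4]
  rfl

theorem norm_exp_potential_mul (A : ℤ → ℝ) (j : ℤ) (s : Bool) (t : ℝ) :
    ‖Complex.exp (potential A j s * t)‖ = 1 := by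
  rw [Complex.norm_exp]
  cases s <;> simp [potential]

theorem exp_neg_potential_mul (A : ℤ → ℝ) (j : ℤ) (s : Bool) (t : ℝ) :
    Complex.exp (-(potential A j s * t)) = Complex.exp (potential A j (!s) * t) := by
  cases s <;> simp [potential]

/-- The two half-circles of a ring carry opposite phases; their sum is the source of cos(A_j π) in
the recurrence. -/
theorem exp_potential_add (A : ℤ → ℝ) (j : ℤ) (t : ℝ) :
    Complex.exp (potential A j true * t) + Complex.exp (potential A j false * t)
      = 2 * (Real.cos (A j * t) : ℝ) := by
  rw [Complex.ofReal_cos, Complex.two_cos]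
  simp only [potential, if_true, Bool.false_eq_true, if_false, Complex.ofReal_mul]
  congr 2 <;> ring

theorem integral_norm_edge_le (k : EdgeL2) :
    ∫ t in Ioo (0 : ℝ) Real.pi, ‖k t‖ ≤ √Real.pi * ‖k‖ := by
  have h1 : eLpNorm k 1 (volume.restrict (Ioo (0 : ℝ) Real.pi))
      ≤ eLpNorm k 2 (volume.restrict (Ioo (0 : ℝ) Real.pi)) *
        (volume.restrict (Ioo (0 : ℝ) Real.pi)) univ ^ (1 / (1 : ENNReal).toReal
          - 1 / (2 : ENNReal).toReal) :=
    eLpNorm_le_eLpNorm_mul_rpow_measure_univ (by norm_num) (Lp.aestronglyMeasurable k)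
  rw [integral_norm_eq_lintegral_enorm (Lp.aestronglyMeasurable k),
    ← eLpNorm_one_eq_lintegral_enorm, Lp.norm_def, mul_comm, Real.sqrt_eq_rpow]
  refine (ENNReal.toReal_mono ?_ h1).trans_eq ?_
  · refine ENNReal.mul_ne_top (Lp.eLpNorm_ne_top k) ?_
    simp only [Measure.restrict_apply_univ, Real.volume_Ioo, sub_zero]
    exact ENNReal.rpow_ne_top_of_nonneg (by norm_num) ENNReal.ofReal_ne_top
  · rw [ENNReal.toReal_mul]
    congr 1
    rw [Measure.restrict_apply_univ, Real.volume_Ioo, sub_zero, ← ENNReal.toReal_rpow,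
      ENNReal.toReal_ofReal Real.pi_pos.le]
    norm_num

theorem norm_integral_edge_le {k : EdgeL2} {g F : ℝ → ℂ} {K : ℝ} (hK : 0 ≤ K)
    (hk : k =ᵐ[volume.restrict (Ioo (0 : ℝ) Real.pi)] g) {x : ℝ} (hx : x ∈ Icc (0 : ℝ) Real.pi)
    (hF : ∀ t ∈ Ioc 0 x, ‖F t‖ ≤ K * ‖g t‖) :
    ‖∫ t in (0 : ℝ)..x, F t‖ ≤ K * √Real.pi * ‖k‖ := by
  have hgi : IntervalIntegrable (fun t => K * ‖g t‖) volume 0 Real.pi := by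
    rw [intervalIntegrable_iff_integrableOn_Ioo_of_le Real.pi_pos.le]
    have : Integrable k (volume.restrict (Ioo (0 : ℝ) Real.pi)) :=
      (Lp.memLp k).integrable (by norm_num)
    exact ((this.congr hk).norm.const_mul K)
  have hsub : uIcc 0 x ⊆ uIcc 0 Real.pi := by
    rw [uIcc_of_le hx.1, uIcc_of_le Real.pi_pos.le]; exact Icc_subset_Icc_right hx.2
  calc ‖∫ t in (0 : ℝ)..x, F t‖ ≤ ∫ t in (0 : ℝ)..x, K * ‖g t‖ :=
        intervalIntegral.norm_integral_le_of_norm_le hx.1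
          (Eventually.of_forall fun t ht => hF t ht) (hgi.mono_set hsub)
    _ ≤ ∫ t in (0 : ℝ)..Real.pi, K * ‖g t‖ :=
        intervalIntegral.integral_mono_interval le_rfl hx.1 hx.2
          (Eventually.of_forall fun t => by positivity) hgi
    _ = K * ∫ t in Ioo (0 : ℝ) Real.pi, ‖k t‖ := by
        rw [intervalIntegral.integral_const_mul, intervalIntegral.integral_of_le Real.pi_pos.le,
          integral_Ioc_eq_integral_Ioo]
        congr 1
        exact integral_congr_ae (hk.symm.mono fun t ht => by simp only [ht])
    _ ≤ K * √Real.pi * ‖k‖ := by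
        rw [mul_assoc]
        exact mul_le_mul_of_nonneg_left (integral_norm_edge_le k) hK

theorem exists_solution_bound (E : ℝ) : ∃ K > 0, ∀ t ∈ Icc (0 : ℝ) Real.pi,
    |cs E t| ≤ K ∧ |sn E t| ≤ K ∧ ‖bump t‖ ≤ K ∧ ‖bump'' t + E * bump t‖ ≤ K := by
  have hc : Continuous fun t => |cs E t| + |sn E t| + ‖bump t‖ + ‖bump'' t + E * bump t‖ := by
    have := continuous_cs E
    have := continuous_sn E
    unfold bump bump''
    fun_prop
  obtain ⟨M, hM⟩ := (isCompact_Icc (a := (0 : ℝ)) (b := Real.pi)).bddAbove_image hc.continuousOn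
  refine ⟨max M 1, by positivity, fun t ht => ?_⟩
  have h := (hM ⟨t, ht, rfl⟩).trans (le_max_left M 1)
  simp only at h
  have := abs_nonneg (cs E t)
  have := abs_nonneg (sn E t)
  have := norm_nonneg (bump t)
  have := norm_nonneg (bump'' t + E * bump t)
  refine ⟨?_, ?_, ?_, ?_⟩ <;> linarith

/-- Vertex values are controlled by the graph norm, uniformly over the edges. -/
theorem exists_vertex_bound (E : ℝ) : ∃ K > 0, ∀ (A β : ℤ → ℝ) (u h : ChainL2)
    (f f' f'' : ℤ → Bool → ℝ → ℂ), Realizes A β u h f f' f'' → ∀ j s,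
      ‖f j s 0‖ ≤ K * (‖u (j, s)‖ + ‖(h - (E : ℂ) • u) (j, s)‖) := by
  obtain ⟨K, hK, hb⟩ := exists_solution_bound E
  refine ⟨K * √Real.pi, by positivity, fun A β u h f f' f'' H j s => ?_⟩
  have e := (H.sobolev j s).apply_zero_eq (potential A j s) E
  set k : EdgeL2 := (h - (E : ℂ) • u) (j, s) with hk
  have hkr : k =ᵐ[volume.restrict (Ioo (0 : ℝ) Real.pi)] residual A E f f' f'' j s :=
    H.residual_ae E j s
  have hmeas : ∀ᵐ t : ℝ ∂(volume.restrict (Ioo (0 : ℝ) Real.pi)),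
      ‖Complex.exp (potential A j s * t) *
          (residual A E f f' f'' j s t * bump t + f j s t * (bump'' t + E * bump t))‖
        ≤ K * ‖k t‖ + K * ‖(u (j, s)) t‖ := by
    filter_upwards [hkr, H.fst_ae j s, ae_restrict_mem measurableSet_Ioo] with t h1 h2 ht
    rw [h1, h2, norm_mul, norm_exp_potential_mul, one_mul]
    refine (norm_add_le _ _).trans (add_le_add ?_ ?_)
    · rw [norm_mul, mul_comm]
      gcongr
      exact (hb t (Ioo_subset_Icc_self ht)).2.2.1
    · rw [norm_mul, mul_comm]
      gcongr
      exact (hb t (Ioo_subset_Icc_self ht)).2.2.2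
  have hi : ∀ v : EdgeL2, Integrable (fun t => K * ‖v t‖) (volume.restrict (Ioo 0 Real.pi)) :=
    fun v => (((Lp.memLp v).integrable (by norm_num)).norm.const_mul K)
  rw [e, norm_neg, intervalIntegral.integral_of_le Real.pi_pos.le, integral_Ioc_eq_integral_Ioo]
  refine (norm_integral_le_of_norm_le ((hi k).add (hi (u (j, s)))) hmeas).trans ?_
  have e1 := integral_add (hi k) (hi (u (j, s)))
  simp only [Pi.add_apply]
  rw [e1, integral_const_mul, integral_const_mul]
  have h1 := mul_le_mul_of_nonneg_left (integral_norm_edge_le k) hK.le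
  have h2 := mul_le_mul_of_nonneg_left (integral_norm_edge_le (u (j, s))) hK.le
  linarith

/-- The value at a vertex is a bounded functional up to a term controlled by `(T - E)u`. -/
theorem exists_vertex_functional (A : ℤ → ℝ) (E : ℝ) (j : ℤ) (s : Bool) : ∃ (Φ : ChainL2) (K : ℝ),
    ∀ (β : ℤ → ℝ) (u h : ChainL2) (f f' f'' : ℤ → Bool → ℝ → ℂ), Realizes A β u h f f' f'' →
      ‖f j s 0‖ ≤ ‖inner ℂ Φ u‖ + K * ‖(h - (E : ℂ) • u) (j, s)‖ := by
  obtain ⟨K, hK, hb⟩ := exists_solution_bound E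
  -- The part of the formula for f(0) that involves f itself is an inner product with this function;
  -- it is conjugated because the inner product is conjugate-linear in its first argument.
  set ψ : ℝ → ℂ := fun t => (starRingEnd ℂ) (Complex.exp (potential A j s * t) *
    (bump'' t + E * bump t)) with hψ
  have hψc : Continuous ψ := by
    have : Continuous fun t : ℝ => Complex.exp (potential A j s * t) *
        (bump'' t + E * bump t) := by unfold bump bump''; fun_prop
    exact Complex.continuous_conj.comp this
  have hψm : MemLp ψ 2 (volume.restrict (Ioo (0 : ℝ) Real.pi)) :=
    MemLp.of_bound hψc.aestronglyMeasurable K (by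
      filter_upwards [ae_restrict_mem measurableSet_Ioo] with t ht
      rw [hψ]
      simp only [RCLike.norm_conj, norm_mul, norm_exp_potential_mul, one_mul]
      exact (hb t (Ioo_subset_Icc_self ht)).2.2.2)
  refine ⟨lp.single 2 (j, s) (hψm.toLp ψ), K * √Real.pi, fun β u h f f' f'' H => ?_⟩
  have e := (H.sobolev j s).apply_zero_eq (potential A j s) E
  have hkr := H.residual_ae E j s
  set k : EdgeL2 := (h - (E : ℂ) • u) (j, s) with hk
  have hinner : inner ℂ (lp.single 2 (j, s) (hψm.toLp ψ) : ChainL2) u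
      = ∫ t in (0 : ℝ)..Real.pi, Complex.exp (potential A j s * t) *
          (f j s t * (bump'' t + E * bump t)) := by
    rw [lp.inner_single_left, L2.inner_def, intervalIntegral.integral_of_le Real.pi_pos.le,
      integral_Ioc_eq_integral_Ioo]
    refine integral_congr_ae ?_
    filter_upwards [hψm.coeFn_toLp, H.fst_ae j s] with t h1 h2
    rw [h1, h2, RCLike.inner_apply, hψ]
    simp only [RingHomCompTriple.comp_apply, RingHom.id_apply]
    ring
  have hki : Integrable k (volume.restrict (Ioo (0 : ℝ) Real.pi)) :=
    (Lp.memLp k).integrable (by norm_num)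
  have hui : Integrable (u (j, s)) (volume.restrict (Ioo (0 : ℝ) Real.pi)) :=
    (Lp.memLp (u (j, s))).integrable (by norm_num)
  have i1 : IntervalIntegrable (fun t => Complex.exp (potential A j s * t) *
          (residual A E f f' f'' j s t * bump t)) volume 0 Real.pi := by
    have : IntervalIntegrable (residual A E f f' f'' j s) volume 0 Real.pi := by
      rw [intervalIntegrable_iff_integrableOn_Ioo_of_le Real.pi_pos.le]
      exact hki.congr hkr
    have hc : Continuous bump := by unfold bump; fun_prop
    exact (this.mul_continuousOn hc.continuousOn).continuousOn_mul (by fun_prop)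
  have i2 : IntervalIntegrable (fun t => Complex.exp (potential A j s * t) *
          (f j s t * (bump'' t + E * bump t))) volume 0 Real.pi := by
    have : IntervalIntegrable (f j s) volume 0 Real.pi := by
      rw [intervalIntegrable_iff_integrableOn_Ioo_of_le Real.pi_pos.le]
      exact hui.congr (H.fst_ae j s)
    have hc : Continuous fun t => bump'' t + E * bump t := by unfold bump bump''; fun_prop
    exact (this.mul_continuousOn hc.continuousOn).continuousOn_mul (by fun_prop)
  have e1 := intervalIntegral.integral_add i1 i2
  have e2 : f j s 0 = -((∫ t in (0 : ℝ)..Real.pi, Complex.exp (potential A j s * t) *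
          (residual A E f f' f'' j s t * bump t)) +
          inner ℂ (lp.single 2 (j, s) (hψm.toLp ψ) : ChainL2) u) := by
    rw [hinner, ← e1, e]
    congr 2
    ext t
    simp only [residual]
    ring
  rw [e2, norm_neg, add_comm]
  refine (norm_add_le _ _).trans (add_le_add_right ?_ _)
  refine norm_integral_edge_le hK.le hkr ⟨Real.pi_pos.le, le_rfl⟩ fun t ht => ?_
  rw [norm_mul, norm_exp_potential_mul, one_mul, norm_mul, mul_comm]
  gcongr
  exact (hb t (Ioc_subset_Icc_self ht)).2.2.1

/-- The function on an edge is determined by its vertex values and `(T - E)u`. -/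
theorem Realizes.sPi_mul_quasiDeriv_zero {A β : ℤ → ℝ} {u h : ChainL2}
    {f f' f'' : ℤ → Bool → ℝ → ℂ} (H : Realizes A β u h f f' f'') (E : ℝ) (j : ℤ) (s : Bool) :
    (sPi E : ℂ) * quasiDeriv A f f' j s 0
      = Complex.exp (potential A j s * Real.pi) * f (j + 1) true 0 - cPi E * f j true 0
        + ∫ t in (0 : ℝ)..Real.pi, Complex.exp (potential A j s * t) *
          (residual A E f f' f'' j s t * sn E (Real.pi - t)) := by
  have e := (H.sobolev j s).exp_mul_eq (potential A j s) E (x := Real.pi) ⟨Real.pi_pos.le, le_rfl⟩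
  have e1 : f j s Real.pi = f (j + 1) true 0 := by
    rw [← H.coupling.left (j + 1) s, add_sub_cancel_right]
  have e2 : f j s 0 = f j true 0 := by
    cases s
    · exact H.coupling.upper_lower j
    · rfl
  rw [e1, e2] at e
  simp only [sPi, cPi, quasiDeriv, residual, e2]
  linear_combination -e

/-- Variation of constants at π with the initial quasi-derivative eliminated; cPi² + E sPi² = 1
collapses the coefficient of the initial value to -1. Keeping the factor sPi E instead of dividing
by it leaves the formula valid on the flat bands. -/
theorem Realizes.sPi_mul_quasiDeriv_pi {A β : ℤ → ℝ} {u h : ChainL2}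
    {f f' f'' : ℤ → Bool → ℝ → ℂ} (H : Realizes A β u h f f' f'') (E : ℝ) (j : ℤ) (s : Bool) :
    (sPi E : ℂ) * quasiDeriv A f f' j s Real.pi
      = cPi E * f (j + 1) true 0 + Complex.exp (potential A j (!s) * Real.pi) *
        (-f j true 0 + cPi E * (∫ t in (0 : ℝ)..Real.pi, Complex.exp (potential A j s * t) *
          (residual A E f f' f'' j s t * sn E (Real.pi - t)))
          - sPi E * (∫ t in (0 : ℝ)..Real.pi, Complex.exp (potential A j s * t) *
          (residual A E f f' f'' j s t * cs E (Real.pi - t)))) := by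
  have e := (H.sobolev j s).exp_mul_quasiDeriv_eq (potential A j s) E (x := Real.pi)
    ⟨Real.pi_pos.le, le_rfl⟩
  have e0 := H.sPi_mul_quasiDeriv_zero E j s
  have e2 : f j s 0 = f j true 0 := by
    cases s
    · exact H.coupling.upper_lower j
    · rfl
  have e3 : Complex.exp (potential A j (!s) * Real.pi) * Complex.exp (potential A j s * Real.pi)
      = 1 := by
    rw [← exp_neg_potential_mul, ← Complex.exp_add, neg_add_cancel, Complex.exp_zero]
  have e4 : (cPi E : ℂ) ^ 2 + E * (sPi E : ℂ) ^ 2 = 1 := by exact_mod_cast cPi_sq_add E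
  rw [e2] at e
  simp only [sPi, cPi, quasiDeriv, residual, e2] at e e0 e4 ⊢
  set X := Complex.exp (potential A j (!s) * Real.pi)
  set Y := Complex.exp (potential A j s * Real.pi)
  set p := f (j + 1) true 0
  set c : ℂ := ((cs E Real.pi : ℝ) : ℂ)
  set S : ℂ := ((sn E Real.pi : ℝ) : ℂ)
  set q := f' j s Real.pi + potential A j s * f j s Real.pi
  linear_combination (c * p - S * q) * e3 + X * S * e + X * c * e0 - X * f j true 0 * e4

/-- The recurrence for the vertex values, with an error term controlled by `(T - E)u`. -/
theorem exists_recurrence_bound (E : ℝ) : ∃ K > 0, ∀ (A β : ℤ → ℝ) (u h : ChainL2)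
    (f f' f'' : ℤ → Bool → ℝ → ℂ), Realizes A β u h f f' f'' → ∀ j,
      ‖2 * (Real.cos (A j * Real.pi) : ℂ) * f (j + 1) true 0
        + 2 * (Real.cos (A (j - 1) * Real.pi) : ℂ) * f (j - 1) true 0
        - (4 * cPi E + sPi E * β j : ℝ) * f j true 0‖
      ≤ K * ((‖(h - (E : ℂ) • u) (j, true)‖ + ‖(h - (E : ℂ) • u) (j, false)‖)
        + (‖(h - (E : ℂ) • u) (j - 1, true)‖ + ‖(h - (E : ℂ) • u) (j - 1, false)‖)) := by
  obtain ⟨K, hK, hb⟩ := exists_solution_bound E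
  refine ⟨K * √Real.pi + (K * (K * √Real.pi) + K * (K * √Real.pi)), by positivity,
    fun A β u h f f' f'' H j => ?_⟩
  set I : ℤ → Bool → ℂ := fun j s => ∫ t in (0 : ℝ)..Real.pi, Complex.exp (potential A j s * t) *
          (residual A E f f' f'' j s t * sn E (Real.pi - t)) with hI
  set I' : ℤ → Bool → ℂ := fun j s => ∫ t in (0 : ℝ)..Real.pi, Complex.exp (potential A j s * t) *
          (residual A E f f' f'' j s t * cs E (Real.pi - t)) with hI'
  have hIb : ∀ j s, ‖I j s‖ ≤ K * √Real.pi * ‖(h - (E : ℂ) • u) (j, s)‖ := by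
    intro j s
    refine norm_integral_edge_le hK.le (H.residual_ae E j s) ⟨Real.pi_pos.le, le_rfl⟩
      fun t ht => ?_
    rw [norm_mul, norm_exp_potential_mul, one_mul, norm_mul, mul_comm, Complex.norm_real]
    gcongr
    exact (hb (Real.pi - t) ⟨by linarith [ht.2], by linarith [ht.1]⟩).2.1
  have hIb' : ∀ j s, ‖I' j s‖ ≤ K * √Real.pi * ‖(h - (E : ℂ) • u) (j, s)‖ := by
    intro j s
    refine norm_integral_edge_le hK.le (H.residual_ae E j s) ⟨Real.pi_pos.le, le_rfl⟩
      fun t ht => ?_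
    rw [norm_mul, norm_exp_potential_mul, one_mul, norm_mul, mul_comm, Complex.norm_real]
    gcongr
    exact (hb (Real.pi - t) ⟨by linarith [ht.2], by linarith [ht.1]⟩).1
  have hcb : ‖(cPi E : ℂ)‖ ≤ K := by
    rw [Complex.norm_real]; exact (hb Real.pi ⟨Real.pi_pos.le, le_rfl⟩).1
  have hsb : ‖(sPi E : ℂ)‖ ≤ K := by
    rw [Complex.norm_real]; exact (hb Real.pi ⟨Real.pi_pos.le, le_rfl⟩).2.1
  have e1 := H.sPi_mul_quasiDeriv_zero E j true
  have e2 := H.sPi_mul_quasiDeriv_zero E j false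
  have e3 := H.sPi_mul_quasiDeriv_pi E (j - 1) true
  have e4 := H.sPi_mul_quasiDeriv_pi E (j - 1) false
  have e5 := H.coupling.jump j
  have e6 := exp_potential_add A j Real.pi
  have e7 := exp_potential_add A (j - 1) Real.pi
  rw [sub_add_cancel] at e3 e4
  simp only [Bool.not_true, Bool.not_false] at e3 e4
  set X := Complex.exp (potential A (j - 1) true * Real.pi) with hX
  set Y := Complex.exp (potential A (j - 1) false * Real.pi) with hY
  -- The jump condition times sPi E, with the four end derivatives inserted. Phases combine in pairs
  -- to cosines, and what remains are integrals of the residual.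
  have e : 2 * (Real.cos (A j * Real.pi) : ℂ) * f (j + 1) true 0
        + 2 * (Real.cos (A (j - 1) * Real.pi) : ℂ) * f (j - 1) true 0
        - (4 * cPi E + sPi E * β j : ℝ) * f j true 0
      = -(I j true) - I j false + Y * (cPi E * I (j - 1) true - sPi E * I' (j - 1) true)
        + X * (cPi E * I (j - 1) false - sPi E * I' (j - 1) false) := by
    push_cast
    push_cast at e6 e7
    simp only [hI, hI']
    linear_combination (-f (j + 1) true 0) * e6 - f (j - 1) true 0 * e7 - e1 - e2 + e3 + e4
      + (sPi E : ℂ) * e5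
  rw [e]
  have hX1 : ‖X‖ = 1 := norm_exp_potential_mul A (j - 1) true Real.pi
  have hY1 : ‖Y‖ = 1 := norm_exp_potential_mul A (j - 1) false Real.pi
  have hpart : ∀ (Z : ℂ) (s : Bool), ‖Z‖ = 1 →
      ‖Z * (cPi E * I (j - 1) s - sPi E * I' (j - 1) s)‖
        ≤ (K * (K * √Real.pi) + K * (K * √Real.pi)) * ‖(h - (E : ℂ) • u) (j - 1, s)‖ := by
    intro Z s hZ
    rw [norm_mul, hZ, one_mul, add_mul]
    refine (norm_sub_le _ _).trans (add_le_add ?_ ?_)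
    · rw [norm_mul, mul_assoc]
      exact mul_le_mul hcb (hIb _ _) (norm_nonneg _) hK.le
    · rw [norm_mul, mul_assoc]
      exact mul_le_mul hsb (hIb' _ _) (norm_nonneg _) hK.le
  have n1 := hIb j true
  have n2 := hIb j false
  have n3 := hpart Y true hY1
  have n4 := hpart X false hX1
  have n5 := norm_add_le (-(I j true) - I j false
    + Y * (cPi E * I (j - 1) true - sPi E * I' (j - 1) true))
    (X * (cPi E * I (j - 1) false - sPi E * I' (j - 1) false))
  have n6 := norm_add_le (-(I j true) - I j false)
    (Y * (cPi E * I (j - 1) true - sPi E * I' (j - 1) true))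
  have n7 := norm_sub_le (-(I j true)) (I j false)
  rw [norm_neg] at n7
  have p1 : 0 ≤ (K * (K * √Real.pi) + K * (K * √Real.pi)) *
    (‖(h - (E : ℂ) • u) (j, true)‖ + ‖(h - (E : ℂ) • u) (j, false)‖) := by positivity
  have p2 : 0 ≤ K * √Real.pi *
    (‖(h - (E : ℂ) • u) (j - 1, true)‖ + ‖(h - (E : ℂ) • u) (j - 1, false)‖) := by positivity
  linarith

/-- Away from the flat bands the norm on an edge is controlled by the vertex values. -/
theorem exists_edge_bound {E : ℝ} (hE : sPi E ≠ 0) : ∃ K > 0, ∀ (A β : ℤ → ℝ) (u h : ChainL2)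
    (f f' f'' : ℤ → Bool → ℝ → ℂ), Realizes A β u h f f' f'' → ∀ j s,
      ‖u (j, s)‖ ≤ K * (‖f j true 0‖ + ‖f (j + 1) true 0‖ + ‖(h - (E : ℂ) • u) (j, s)‖) := by
  obtain ⟨K, hK, hb⟩ := exists_solution_bound E
  set D := |sPi E|⁻¹ with hD
  have hD0 : 0 < D := inv_pos.2 (abs_pos.2 hE)
  -- The three summands bound the three terms of variation of constants: initial quasi-derivative
  -- times `sn`, vertex value times `cs`, and the integral of the residual.
  set B := D * (1 + K + K * √Real.pi) * K + K + K * √Real.pi with hB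
  have hB0 : 0 < B := by positivity
  refine ⟨√Real.pi * B, by positivity, fun A β u h f f' f'' H j s => ?_⟩
  set N := ‖f j true 0‖ + ‖f (j + 1) true 0‖ + ‖(h - (E : ℂ) • u) (j, s)‖ with hN
  have hN0 : 0 ≤ N := by positivity
  have l1 : ‖f j true 0‖ ≤ N := by
    have := norm_nonneg (f (j + 1) true 0)
    have := norm_nonneg ((h - (E : ℂ) • u) (j, s))
    linarith
  have l2 : ‖f (j + 1) true 0‖ ≤ N := by
    have := norm_nonneg (f j true 0)
    have := norm_nonneg ((h - (E : ℂ) • u) (j, s))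
    linarith
  have l3 : ‖(h - (E : ℂ) • u) (j, s)‖ ≤ N := by
    have := norm_nonneg (f j true 0)
    have := norm_nonneg (f (j + 1) true 0)
    linarith
  have hI : ∀ x ∈ Icc (0 : ℝ) Real.pi, ‖∫ t in (0 : ℝ)..x, Complex.exp (potential A j s * t) *
          (residual A E f f' f'' j s t * sn E (x - t))‖ ≤ K * √Real.pi * N := by
    intro x hx
    refine (norm_integral_edge_le hK.le (H.residual_ae E j s) hx fun t ht => ?_).trans
      (mul_le_mul_of_nonneg_left l3 (by positivity))
    rw [norm_mul, norm_exp_potential_mul, one_mul, norm_mul, mul_comm, Complex.norm_real]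
    gcongr
    exact (hb (x - t) ⟨by linarith [ht.2], by linarith [ht.1, hx.2]⟩).2.1
  have hq : ‖quasiDeriv A f f' j s 0‖ ≤ D * (1 + K + K * √Real.pi) * N := by
    have e := H.sPi_mul_quasiDeriv_zero E j s
    have e' : ‖(sPi E : ℂ) * quasiDeriv A f f' j s 0‖ ≤ (1 + K + K * √Real.pi) * N := by
      rw [e]
      refine (norm_add_le _ _).trans ?_
      rw [add_mul]
      refine add_le_add ((norm_sub_le _ _).trans ?_) (hI Real.pi ⟨Real.pi_pos.le, le_rfl⟩)
      rw [add_mul, norm_mul, norm_exp_potential_mul, norm_mul, Complex.norm_real]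
      refine add_le_add (by gcongr) ?_
      exact mul_le_mul (hb Real.pi ⟨Real.pi_pos.le, le_rfl⟩).1 l1 (norm_nonneg _) hK.le
    rw [norm_mul, Complex.norm_real, Real.norm_eq_abs] at e'
    rw [hD, mul_assoc, inv_mul_eq_div, le_div_iff₀ (abs_pos.2 hE), mul_comm]
    exact e'
  have e2 : f j s 0 = f j true 0 := by
    cases s
    · exact H.coupling.upper_lower j
    · rfl
  have hpt : ∀ x ∈ Icc (0 : ℝ) Real.pi, ‖f j s x‖ ≤ B * N := by
    intro x hx
    have e := (H.sobolev j s).exp_mul_eq (potential A j s) E hx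
    have e' := congrArg norm e
    rw [norm_mul, norm_exp_potential_mul, one_mul] at e'
    rw [e', show B * N = D * (1 + K + K * √Real.pi) * K * N + K * N + K * √Real.pi * N by
      rw [hB]; ring]
    refine (norm_sub_le _ _).trans (add_le_add ((norm_add_le _ _).trans (add_le_add ?_ ?_))
      (hI x hx))
    · rw [norm_mul, Complex.norm_real]
      calc _ ≤ (D * (1 + K + K * √Real.pi) * N) * K :=
            mul_le_mul hq (hb x hx).2.1 (abs_nonneg _) (by positivity)
        _ = _ := by ring
    · rw [norm_mul, Complex.norm_real, e2, mul_comm]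
      exact mul_le_mul (hb x hx).1 l1 (norm_nonneg _) hK.le
  have := Lp.norm_le_of_ae_bound (f := u (j, s)) (C := B * N) (by positivity) (by
    filter_upwards [H.fst_ae j s, ae_restrict_mem measurableSet_Ioo] with t h1 ht
    rw [h1]; exact hpt t (Ioo_subset_Icc_self ht))
  refine this.trans_eq ?_
  rw [measureUnivNNReal, Measure.restrict_apply_univ, Real.volume_Ioo, sub_zero, Real.sqrt_eq_rpow]
  simp only [ENNReal.coe_toNNReal_eq_toReal,
    ENNReal.toReal_ofReal Real.pi_pos.le]
  norm_num
  ring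

/-! ### Elements of the domain given by smooth functions -/

theorem chain_hasSum_norm_sq (u : ChainL2) : HasSum (fun i => ‖u i‖ ^ 2) (‖u‖ ^ 2) := by
  have h2 : (0 : ℝ) < (2 : ENNReal).toReal := by norm_num
  have h := lp.hasSum_norm h2 u
  simpa using h

theorem norm_edge_le_of_bound {k : EdgeL2} {g : ℝ → ℂ} {C : ℝ} (hC : 0 ≤ C)
    (hk : k =ᵐ[volume.restrict (Ioo (0 : ℝ) Real.pi)] g)
    (hg : ∀ t ∈ Icc (0 : ℝ) Real.pi, ‖g t‖ ≤ C) : ‖k‖ ≤ √Real.pi * C := by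
  have := Lp.norm_le_of_ae_bound (f := k) (C := C) hC (by
    filter_upwards [hk, ae_restrict_mem measurableSet_Ioo] with t h1 ht
    rw [h1]; exact hg t (Ioo_subset_Icc_self ht))
  refine this.trans_eq ?_
  rw [measureUnivNNReal, Measure.restrict_apply_univ, Real.volume_Ioo, sub_zero, Real.sqrt_eq_rpow]
  simp only [ENNReal.coe_toNNReal_eq_toReal,
    ENNReal.toReal_ofReal Real.pi_pos.le]
  norm_num

theorem summable_prod_bool {b : ℤ → ℝ} (hb : Summable b) (h0 : ∀ j, 0 ≤ b j) :
    Summable fun i : ℤ × Bool => b i.1 := by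
  have := hb.mul_of_nonneg (g := fun _ : Bool => (1 : ℝ)) (Summable.of_finite) h0
    (fun _ => zero_le_one)
  simpa using this

theorem exists_chain_of_continuous {F : ℤ → Bool → ℝ → ℂ} (hF : ∀ j s, Continuous (F j s))
    {b : ℤ → ℝ} (hb : ∀ j s, ∀ t ∈ Icc (0 : ℝ) Real.pi, ‖F j s t‖ ≤ b j)
    (hs : Summable fun j => b j ^ 2) :
    ∃ u : ChainL2, ∀ j s, u (j, s) =ᵐ[volume.restrict (Ioo (0 : ℝ) Real.pi)] F j s := by
  have hm : ∀ j s, MemLp (F j s) 2 (volume.restrict (Ioo (0 : ℝ) Real.pi)) := fun j s =>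
    MemLp.of_bound (hF j s).aestronglyMeasurable (b j) (by
      filter_upwards [ae_restrict_mem measurableSet_Ioo] with t ht
      exact hb j s t (Ioo_subset_Icc_self ht))
  have hb0 : ∀ j, 0 ≤ b j := fun j =>
    (norm_nonneg _).trans (hb j true 0 ⟨le_rfl, Real.pi_pos.le⟩)
  set U : ℤ × Bool → EdgeL2 := fun i => (hm i.1 i.2).toLp (F i.1 i.2) with hU
  have hUm : Memℓp U 2 := by
    apply memℓp_gen
    have hsum : Summable fun i : ℤ × Bool => (√Real.pi * b i.1) ^ 2 := by
      have := (summable_prod_bool hs (fun j => sq_nonneg (b j))).mul_left (√Real.pi ^ 2)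
      simpa [mul_pow] using this
    refine Summable.of_nonneg_of_le (fun i => by positivity) (fun i => ?_) hsum
    have h1 := norm_edge_le_of_bound (hb0 i.1) (hm i.1 i.2).coeFn_toLp (hb i.1 i.2)
    have e : ‖U i‖ ^ (2 : ENNReal).toReal = ‖U i‖ ^ 2 := by norm_num
    rw [e]
    gcongr
  exact ⟨⟨U, hUm⟩, fun j s => (hm j s).coeFn_toLp⟩

theorem isSobolevH2_of_hasDerivAt {f f' f'' : ℝ → ℂ} (h1 : ∀ x, HasDerivAt f (f' x) x)
    (h2 : ∀ x, HasDerivAt f' (f'' x) x) (h3 : Continuous f'') : IsSobolevH2 f f' f'' := by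
  have hc : Continuous f' := continuous_iff_continuousAt.2 fun x => (h2 x).continuousAt
  refine ⟨?_, fun x _ => ?_, fun x _ => ?_⟩
  · obtain ⟨M, hM⟩ := (isCompact_Icc (a := (0 : ℝ)) (b := Real.pi)).bddAbove_image
      h3.norm.continuousOn
    refine MemLp.of_bound h3.aestronglyMeasurable M ?_
    filter_upwards [ae_restrict_mem measurableSet_Ioo] with t ht
    exact hM ⟨t, Ioo_subset_Icc_self ht, rfl⟩
  · rw [intervalIntegral.integral_eq_sub_of_hasDerivAt (fun y _ => h1 y)
      (hc.intervalIntegrable _ _)]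
    ring
  · rw [intervalIntegral.integral_eq_sub_of_hasDerivAt (fun y _ => h2 y)
      (h3.intervalIntegrable _ _)]
    ring

/-- Smooth edge functions `e^{∓iAx} y`, where `y` satisfies the gauged vertex conditions, define an
element of the graph of the Laplacian. -/
theorem exists_realizes {A β : ℤ → ℝ} {y y' y'' : ℤ → Bool → ℝ → ℂ}
    (h1 : ∀ j s x, HasDerivAt (y j s) (y' j s x) x)
    (h2 : ∀ j s x, HasDerivAt (y' j s) (y'' j s x) x) (h3 : ∀ j s, Continuous (y'' j s))
    (c1 : ∀ j, y j false 0 = y j true 0)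
    (c2 : ∀ j s, y j s Real.pi = Complex.exp (potential A j s * Real.pi) * y (j + 1) true 0)
    (c3 : ∀ j, y' j true 0 + y' j false 0
      - Complex.exp (potential A (j - 1) false * Real.pi) * y' (j - 1) true Real.pi
      - Complex.exp (potential A (j - 1) true * Real.pi) * y' (j - 1) false Real.pi
      = (β j : ℂ) * y j true 0)
    {b b' : ℤ → ℝ} (hb : ∀ j s, ∀ t ∈ Icc (0 : ℝ) Real.pi, ‖y j s t‖ ≤ b j)
    (hb' : ∀ j s, ∀ t ∈ Icc (0 : ℝ) Real.pi, ‖y'' j s t‖ ≤ b' j)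
    (hs : Summable fun j => b j ^ 2) (hs' : Summable fun j => b' j ^ 2) :
    ∃ (u h : ChainL2) (f f' f'' : ℤ → Bool → ℝ → ℂ), Realizes A β u h f f' f'' ∧
      (∀ j s, f j s 0 = y j s 0) ∧
      (∀ j s, u (j, s) =ᵐ[volume.restrict (Ioo (0 : ℝ) Real.pi)]
        fun t => Complex.exp (potential A j (!s) * t) * y j s t) ∧
      (∀ j s, h (j, s) =ᵐ[volume.restrict (Ioo (0 : ℝ) Real.pi)]
        fun t => -(Complex.exp (potential A j (!s) * t) * y'' j s t)) := by
  have hpot : ∀ j s, potential A j (!s) = -potential A j s := by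
    intro j s; cases s <;> simp [potential]
  have he : ∀ (w : ℂ) (x : ℝ), HasDerivAt (fun x : ℝ => Complex.exp (w * x))
      (Complex.exp (w * x) * w) x := by
    intro w x
    have := ((Complex.ofRealCLM.hasDerivAt (x := x)).const_mul w).cexp
    simpa using this
  -- Passing to the other branch flips the sign of the potential, so the prefactor is the inverse
  -- gauge factor and the quasi-derivative acts on y as the plain derivative.
  set f : ℤ → Bool → ℝ → ℂ := fun j s t => Complex.exp (potential A j (!s) * t) * y j s t with hf
  set f' : ℤ → Bool → ℝ → ℂ := fun j s t => Complex.exp (potential A j (!s) * t) *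
    (y' j s t - potential A j s * y j s t) with hf'
  set f'' : ℤ → Bool → ℝ → ℂ := fun j s t => Complex.exp (potential A j (!s) * t) *
    (y'' j s t - 2 * potential A j s * y' j s t + potential A j s ^ 2 * y j s t) with hf''
  have hcy : ∀ j s, Continuous (y j s) := fun j s =>
    continuous_iff_continuousAt.2 fun x => (h1 j s x).continuousAt
  have hcy' : ∀ j s, Continuous (y' j s) := fun j s =>
    continuous_iff_continuousAt.2 fun x => (h2 j s x).continuousAt
  have d1 : ∀ j s x, HasDerivAt (f j s) (f' j s x) x := fun j s x =>
    ((he _ x).mul (h1 j s x)).congr_deriv (by simp only [hf', hpot]; ring)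
  have d2 : ∀ j s x, HasDerivAt (f' j s) (f'' j s x) x := fun j s x =>
    ((he _ x).mul ((h2 j s x).sub ((h1 j s x).const_mul _))).congr_deriv (by
      simp only [hf'', hpot, Pi.sub_apply]; ring)
  have hq : ∀ j s x, quasiDeriv A f f' j s x
      = Complex.exp (potential A j (!s) * x) * y' j s x := by
    intro j s x; simp only [quasiDeriv, hf, hf']; ring
  have hn : ∀ j s x, negQuasiDerivSq A f f' f'' j s x
      = -(Complex.exp (potential A j (!s) * x) * y'' j s x) := by
    intro j s x; simp only [negQuasiDerivSq, hf, hf', hf'']; ring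
  have hexp : ∀ j s, Complex.exp (potential A j (!s) * Real.pi) *
      Complex.exp (potential A j s * Real.pi) = 1 := by
    intro j s
    rw [← exp_neg_potential_mul, ← Complex.exp_add, neg_add_cancel, Complex.exp_zero]
  obtain ⟨u, hu⟩ := exists_chain_of_continuous (F := f)
    (fun j s => by have := hcy j s; simp only [hf]; fun_prop) (b := b)
    (fun j s t ht => by
      simp only [hf]; rw [norm_mul, norm_exp_potential_mul, one_mul]; exact hb j s t ht) hs
  obtain ⟨h, hh⟩ := exists_chain_of_continuous
    (F := fun j s t => -(Complex.exp (potential A j (!s) * t) * y'' j s t))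
    (fun j s => by have := h3 j s; fun_prop) (b := b')
    (fun j s t ht => by
      rw [norm_neg, norm_mul, norm_exp_potential_mul, one_mul]; exact hb' j s t ht) hs'
  refine ⟨u, h, f, f', f'', ⟨fun j s => isSobolevH2_of_hasDerivAt (d1 j s) (d2 j s) ?_,
    ⟨fun j => ?_, fun j s => ?_, fun j => ?_⟩, hu, fun j s => ?_⟩, fun j s => ?_, hu, hh⟩
  · have := hcy j s
    have := hcy' j s
    have := h3 j s
    simp only [hf'']
    fun_prop
  · simp only [hf, Complex.ofReal_zero, mul_zero, Complex.exp_zero, one_mul, c1 j]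
  · simp only [hf, Complex.ofReal_zero, mul_zero, Complex.exp_zero, one_mul, c2 (j - 1) s]
    rw [← mul_assoc, hexp, sub_add_cancel, one_mul]
  · simp only [hq, Complex.ofReal_zero, mul_zero, Complex.exp_zero, one_mul, Bool.not_true,
      Bool.not_false]
    simp only [hf, Complex.ofReal_zero, mul_zero, Complex.exp_zero, one_mul]
    exact c3 j
  · exact (hh j s).trans (Eventually.of_forall fun t => (hn j s t).symm)
  · simp [hf]

/-! ### Singular sequences -/

theorem mem_laplacian_graph_iff {A β : ℤ → ℝ} {u h : ChainL2} :
    (u, h) ∈ laplacianGraph A β ↔ ∃ v : (laplacian A β).domain, (v : ChainL2) = u ∧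
      laplacian A β v = h := by
  rw [← laplacian_graph, LinearPMap.mem_graph_iff]

theorem chain_inner_eq_zero {u v : ChainL2} (h : ∀ i, u i = 0 ∨ v i = 0) : inner ℂ u v = 0 := by
  rw [lp.inner_eq_tsum]
  convert tsum_zero with i
  rcases h i with h | h <;> simp [h]

/-- Approximate eigenvectors in blocks of rings far out yield a singular sequence. -/
theorem mem_essentialSpectrum_of_blocks {A β : ℤ → ℝ} {E : ℝ} (B₀ : ℤ) (D c : ℝ) (hc : 0 < c)
    (H : ∀ B ≥ B₀, ∀ N : ℕ, 0 < N → ∃ u h : ChainL2, (u, h) ∈ laplacianGraph A β ∧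
      (∀ j s, j < B ∨ B + N + 2 ≤ j → u (j, s) = 0) ∧ ‖h - (E : ℂ) • u‖ ≤ D ∧
      c * N ≤ ‖u‖ ^ 2) :
    E ∈ essentialSpectrum (laplacian A β) := by
  -- Block m starts at B₀ + (m+2)² and ends before m + 3 further rings; consecutive starts are 2m +
  -- 5 apart, so the supports are disjoint. Its norm grows with m while the residual stays below D,
  -- so normalization gives a singular sequence.
  have H' : ∀ m : ℕ, ∃ u h : ChainL2, (u, h) ∈ laplacianGraph A β ∧
      (∀ j s, j < B₀ + ((m : ℤ) + 2) ^ 2 ∨ B₀ + ((m : ℤ) + 2) ^ 2 + ((m + 1 : ℕ) : ℤ) + 2 ≤ j →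
        u (j, s) = 0) ∧ ‖h - (E : ℂ) • u‖ ≤ D ∧ c * ((m + 1 : ℕ) : ℝ) ≤ ‖u‖ ^ 2 := fun m =>
    H _ (by nlinarith) (m + 1) (by omega)
  choose u h hg hsupp hD hn using H'
  have hpos : ∀ m, 0 < ‖u m‖ := by
    intro m
    by_contra hcon
    have h0 : ‖u m‖ = 0 := le_antisymm (not_lt.1 hcon) (norm_nonneg _)
    have h1 := hn m
    rw [h0] at h1
    have : (0 : ℝ) < c * ((m + 1 : ℕ) : ℝ) := by positivity
    norm_num at h1
    push_cast at this
    linarith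
  have hg' : ∀ m, ((‖u m‖⁻¹ : ℂ) • u m, (‖u m‖⁻¹ : ℂ) • h m) ∈ laplacianGraph A β := fun m =>
    (laplacianGraph A β).smul_mem (‖u m‖⁻¹ : ℂ) (hg m)
  choose v hv hTv using fun m => mem_laplacian_graph_iff.1 (hg' m)
  refine ⟨v, ⟨fun m => ?_, ?_⟩, ?_⟩
  · simp only [hv]
    rw [norm_smul, norm_inv, Complex.norm_real, norm_norm, inv_mul_cancel₀ (hpos m).ne']
  · have key : ∀ m m' : ℕ, m < m' → inner ℂ (u m) (u m') = 0 := by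
      intro m m' hmm
      refine chain_inner_eq_zero fun ⟨j, s⟩ => ?_
      by_cases hj : j < B₀ + ((m' : ℤ) + 2) ^ 2
      · exact Or.inr (hsupp m' j s (Or.inl hj))
      · refine Or.inl (hsupp m j s (Or.inr ?_))
        push_cast
        have : (m : ℤ) + 1 ≤ m' := by exact_mod_cast hmm
        nlinarith
    have key' : ∀ m m' : ℕ, m ≠ m' → inner ℂ (u m) (u m') = 0 := by
      intro m m' hmm
      rcases hmm.lt_or_gt with h | h
      · exact key m m' h
      · rw [← inner_conj_symm, key m' m h, map_zero]
    intro m m' hmm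
    simp only [hv, inner_smul_left, inner_smul_right, key' m m' hmm, mul_zero]
  · rw [tendsto_zero_iff_norm_tendsto_zero]
    have e : ∀ m, ‖laplacian A β (v m) - (E : ℂ) • (v m : ChainL2)‖
        = ‖u m‖⁻¹ * ‖h m - (E : ℂ) • u m‖ := by
      intro m
      rw [hTv, hv, smul_comm (E : ℂ), ← smul_sub, norm_smul, norm_inv, Complex.norm_real,
        norm_norm]
    have hlim : Tendsto (fun m => (‖u m‖ ^ 2)⁻¹) atTop (𝓝 0) := by
      apply Tendsto.inv_tendsto_atTop
      refine tendsto_atTop_mono hn ?_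
      exact Tendsto.const_mul_atTop hc
        (tendsto_natCast_atTop_atTop.comp (tendsto_add_atTop_nat 1))
    have hlim2 : Tendsto (fun m => ‖u m‖⁻¹) atTop (𝓝 0) := by
      have := (Real.continuous_sqrt.tendsto 0).comp hlim
      rw [Real.sqrt_zero] at this
      refine this.congr fun m => ?_
      simp only [Function.comp_apply]
      rw [Real.sqrt_inv, Real.sqrt_sq (norm_nonneg _)]
    simp only [e]
    refine squeeze_zero (fun m => by positivity) (fun m => mul_le_mul_of_nonneg_left (hD m)
      (by positivity)) ?_
    simpa using hlim2.mul_const D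

/-! ### Points outside the essential spectrum -/

/-- Averaging over the two neighbours is a contraction of ℓ², so (1 - t)‖x‖ ≤ ‖e‖. -/
theorem tsum_sq_le_of_le_average {x e : ℤ → ℝ} {t : ℝ} (ht0 : 0 ≤ t) (ht1 : t < 1)
    (hx0 : ∀ j, 0 ≤ x j) (hx : Summable fun j => x j ^ 2) (he : Summable fun j => e j ^ 2)
    (h : ∀ j, x j ≤ t * ((x (j + 1) + x (j - 1)) / 2) + e j) :
    (1 - t) ^ 2 * ∑' j, x j ^ 2 ≤ ∑' j, e j ^ 2 := by
  set X := ∑' j, x j ^ 2 with hX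
  have hx' : HasSum (fun j => x j ^ 2) X := hx.hasSum
  have hp : HasSum (fun j => x (j + 1) ^ 2) X := by
    have := (Equiv.addRight (1 : ℤ)).hasSum_iff (f := fun j => x j ^ 2) (a := X)
    simpa only [Function.comp_def, Equiv.coe_addRight] using this.2 hx'
  have hm : HasSum (fun j => x (j - 1) ^ 2) X := by
    have := (Equiv.subRight (1 : ℤ)).hasSum_iff (f := fun j => x j ^ 2) (a := X)
    simpa only [Function.comp_def, Equiv.subRight_apply] using this.2 hx'
  -- The hypothesis multiplied by 2(1 - t)x_j, with mixed products replaced by squares; the shifts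
  -- drop out on summation.
  have hpt : ∀ j, 2 * (1 - t) * x j ^ 2
      ≤ (1 - t) * t / 2 * (x (j + 1) ^ 2 + x (j - 1) ^ 2 + 2 * x j ^ 2)
        + (1 - t) ^ 2 * x j ^ 2 + e j ^ 2 := by
    intro j
    have h1 : 0 ≤ 1 - t := by linarith
    have a1 := mul_le_mul_of_nonneg_left (mul_le_mul_of_nonneg_right (h j) (hx0 j)) h1
    have a2 := sq_nonneg ((1 - t) * x j - e j)
    have a3 := mul_nonneg (mul_nonneg h1 ht0) (sq_nonneg (x (j + 1) - x j))
    have a4 := mul_nonneg (mul_nonneg h1 ht0) (sq_nonneg (x (j - 1) - x j))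
    linarith
  have hsum := hasSum_le hpt (hx'.mul_left _)
    (((((hp.add hm).add (hx'.mul_left 2)).mul_left _).add (hx'.mul_left _)).add he.hasSum)
  linarith

theorem summable_edge_norm_sq (k : ChainL2) (s : Bool) :
    Summable (fun j : ℤ => ‖k (j, s)‖ ^ 2) ∧ ∑' j : ℤ, ‖k (j, s)‖ ^ 2 ≤ ‖k‖ ^ 2 := by
  have h := chain_hasSum_norm_sq k
  have hi : Function.Injective fun j : ℤ => (j, s) := fun a b hab => (Prod.mk.inj hab).1
  refine ⟨h.summable.comp_injective hi, ?_⟩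
  rw [← h.tsum_eq]
  exact tsum_comp_le_tsum_of_inj h.summable (fun i => sq_nonneg _) hi

theorem hasSum_shift {x : ℤ → ℝ} {X : ℝ} (hx : HasSum x X) (c : ℤ) :
    HasSum (fun j => x (j + c)) X := by
  have := (Equiv.addRight c).hasSum_iff (f := x) (a := X)
  simpa only [Function.comp_def, Equiv.coe_addRight] using this.2 hx

theorem Realizes.summable_vertex_sq {A β : ℤ → ℝ} {u h : ChainL2} {f f' f'' : ℤ → Bool → ℝ → ℂ}
    (H : Realizes A β u h f f' f'') : Summable fun j => ‖f j true 0‖ ^ 2 := by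
  obtain ⟨K, hK, hb⟩ := exists_vertex_bound 0
  have s1 := (summable_edge_norm_sq u true).1
  have s2 := (summable_edge_norm_sq (h - ((0 : ℝ) : ℂ) • u) true).1
  refine Summable.of_nonneg_of_le (fun j => sq_nonneg _) (fun j => ?_)
    ((s1.add s2).mul_left (2 * K ^ 2))
  have := hb A β u h f f' f'' H j true
  calc ‖f j true 0‖ ^ 2 ≤ (K * (‖u (j, true)‖ + ‖(h - ((0 : ℝ) : ℂ) • u) (j, true)‖)) ^ 2 := by
        gcongr
    _ ≤ _ := by
        rw [mul_pow]
        nlinarith [mul_nonneg (sq_nonneg K)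
          (sq_nonneg (‖u (j, true)‖ - ‖(h - ((0 : ℝ) : ℂ) • u) (j, true)‖))]

/-- The recurrence for the vertex values as a perturbation of the recurrence of the homogeneous
chain. -/
theorem exists_perturbed_recurrence_bound {A β : ℤ → ℝ} {A₀ α : ℝ} (E : ℝ) {n : ℕ}
    (hA : ∀ j ∉ Finset.Icc (1 : ℤ) n, A j = A₀) (hβ : ∀ j ∉ Finset.Icc (1 : ℤ) n, β j = α) :
    ∃ K > 0, ∃ D > 0, ∀ (u h : ChainL2) (f f' f'' : ℤ → Bool → ℝ → ℂ),
      Realizes A β u h f f' f'' → ∀ P : ℝ,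
      (∀ j ∈ Finset.Icc (-1 : ℤ) (n + 2), ‖f j true 0‖ ≤ √P) → ∀ j,
      4 * |eta α E| * ‖f j true 0‖
        ≤ 2 * |Real.cos (A₀ * Real.pi)| * (‖f (j + 1) true 0‖ + ‖f (j - 1) true 0‖)
          + (K * ((‖(h - (E : ℂ) • u) (j, true)‖ + ‖(h - (E : ℂ) • u) (j, false)‖)
            + (‖(h - (E : ℂ) • u) (j - 1, true)‖ + ‖(h - (E : ℂ) • u) (j - 1, false)‖))
            + D * (if j ∈ Finset.Icc (0 : ℤ) (n + 1) then 3 * √P else 0)) := by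
  obtain ⟨K, hK, hrec⟩ := exists_recurrence_bound E
  set a := Real.cos (A₀ * Real.pi) with ha
  -- One constant for all three deviations from the homogeneous recurrence: 4 bounds twice a
  -- difference of cosines, the sum bounds sPi(β_j - α). Deviations occur only where A_j, A_{j-1} or
  -- β_j is perturbed, hence within 0 ≤ j ≤ n + 1.
  set D : ℝ := 4 + |sPi E| * ∑ j ∈ Finset.Icc (0 : ℤ) (n + 1), |β j - α| with hD
  have hD0 : 0 < D := by positivity
  refine ⟨K, hK, D, hD0, fun u h f f' f'' H P hpP j => ?_⟩
  set k : ChainL2 := h - (E : ℂ) • u with hk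
  set d : ℤ → ℝ := fun j => if j ∈ Finset.Icc (0 : ℤ) (n + 1) then 3 * √P else 0 with hd
  have hd0 : ∀ j, 0 ≤ d j := fun j => by simp only [hd]; split_ifs <;> positivity
  have r := hrec A β u h f f' f'' H j
  rw [show (if j ∈ Finset.Icc (0 : ℤ) (n + 1) then 3 * √P else 0) = d j from rfl]
  set R : ℂ := 2 * (Real.cos (A j * Real.pi) : ℂ) * f (j + 1) true 0
    + 2 * (Real.cos (A (j - 1) * Real.pi) : ℂ) * f (j - 1) true 0
    - (4 * cPi E + sPi E * β j : ℝ) * f j true 0 with hR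
  have e : ((4 * eta α E : ℝ) : ℂ) * f j true 0
      = ((2 * a : ℝ) : ℂ) * f (j + 1) true 0 + ((2 * a : ℝ) : ℂ) * f (j - 1) true 0 - R
        + (((2 * (Real.cos (A j * Real.pi) - a) : ℝ) : ℂ) * f (j + 1) true 0
          + ((2 * (Real.cos (A (j - 1) * Real.pi) - a) : ℝ) : ℂ) * f (j - 1) true 0
          - ((sPi E * (β j - α) : ℝ) : ℂ) * f j true 0) := by
    simp only [hR, eta]
    push_cast
    ring
  have hpert : ‖((2 * (Real.cos (A j * Real.pi) - a) : ℝ) : ℂ) * f (j + 1) true 0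
          + ((2 * (Real.cos (A (j - 1) * Real.pi) - a) : ℝ) : ℂ) * f (j - 1) true 0
          - ((sPi E * (β j - α) : ℝ) : ℂ) * f j true 0‖ ≤ D * d j := by
    by_cases hj : j ∈ Finset.Icc (0 : ℤ) (n + 1)
    · have hj' := Finset.mem_Icc.1 hj
      have hcos : ∀ x y : ℝ, ‖((2 * (Real.cos x - Real.cos y) : ℝ) : ℂ)‖ ≤ 4 := by
        intro x y
        rw [Complex.norm_real, Real.norm_eq_abs, abs_le]
        constructor <;> linarith [Real.cos_le_one x, Real.cos_le_one y,
          Real.neg_one_le_cos x, Real.neg_one_le_cos y]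
      have hβb : ‖((sPi E * (β j - α) : ℝ) : ℂ)‖ ≤ D := by
        rw [Complex.norm_real, Real.norm_eq_abs, abs_mul, hD]
        have := Finset.single_le_sum (f := fun j => |β j - α|) (fun j _ => abs_nonneg _) hj
        have := mul_le_mul_of_nonneg_left this (abs_nonneg (sPi E))
        linarith
      have h4D : (4 : ℝ) ≤ D := by
        rw [hD]
        have : 0 ≤ |sPi E| * ∑ j ∈ Finset.Icc (0 : ℤ) (n + 1), |β j - α| := by positivity
        linarith
      have b1 : ‖((2 * (Real.cos (A j * Real.pi) - a) : ℝ) : ℂ) * f (j + 1) true 0‖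
          ≤ D * √P := by
        rw [norm_mul]
        exact mul_le_mul ((hcos _ _).trans h4D) (hpP _ (Finset.mem_Icc.2 (by omega)))
          (norm_nonneg _) hD0.le
      have b2 : ‖((2 * (Real.cos (A (j - 1) * Real.pi) - a) : ℝ) : ℂ) * f (j - 1) true 0‖
          ≤ D * √P := by
        rw [norm_mul]
        exact mul_le_mul ((hcos _ _).trans h4D) (hpP _ (Finset.mem_Icc.2 (by omega)))
          (norm_nonneg _) hD0.le
      have b3 : ‖((sPi E * (β j - α) : ℝ) : ℂ) * f j true 0‖ ≤ D * √P := by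
        rw [norm_mul]
        exact mul_le_mul hβb (hpP _ (Finset.mem_Icc.2 (by omega))) (norm_nonneg _) hD0.le
      have e1 : d j = 3 * √P := by simp only [hd]; rw [if_pos hj]
      rw [e1]
      refine (norm_sub_le _ _).trans ?_
      have := norm_add_le (((2 * (Real.cos (A j * Real.pi) - a) : ℝ) : ℂ) * f (j + 1) true 0)
        (((2 * (Real.cos (A (j - 1) * Real.pi) - a) : ℝ) : ℂ) * f (j - 1) true 0)
      linarith
    · have hj' : ¬ (0 ≤ j ∧ j ≤ n + 1) := fun hh => hj (Finset.mem_Icc.2 hh)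
      have e1 : A j = A₀ := hA j fun hh => hj' (by have := Finset.mem_Icc.1 hh; omega)
      have e2 : A (j - 1) = A₀ := hA _ fun hh => hj' (by have := Finset.mem_Icc.1 hh; omega)
      have e3 : β j = α := hβ j fun hh => hj' (by have := Finset.mem_Icc.1 hh; omega)
      rw [e1, e2, e3]
      simp only [ha, sub_self, mul_zero, Complex.ofReal_zero, zero_mul, add_zero, norm_zero]
      exact mul_nonneg hD0.le (hd0 j)
  have e' := congrArg norm e
  rw [norm_mul, Complex.norm_real, Real.norm_eq_abs, abs_mul, abs_of_pos (four_pos)] at e'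
  rw [e']
  have m1 : ‖((2 * a : ℝ) : ℂ) * f (j + 1) true 0‖ = 2 * |a| * ‖f (j + 1) true 0‖ := by
    rw [norm_mul, Complex.norm_real, Real.norm_eq_abs, abs_mul, abs_of_pos (two_pos)]
  have m2 : ‖((2 * a : ℝ) : ℂ) * f (j - 1) true 0‖ = 2 * |a| * ‖f (j - 1) true 0‖ := by
    rw [norm_mul, Complex.norm_real, Real.norm_eq_abs, abs_mul, abs_of_pos (two_pos)]
  refine (norm_add_le _ _).trans ?_
  have n1 := norm_sub_le (((2 * a : ℝ) : ℂ) * f (j + 1) true 0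
    + ((2 * a : ℝ) : ℂ) * f (j - 1) true 0) R
  have n2 := norm_add_le (((2 * a : ℝ) : ℂ) * f (j + 1) true 0)
    (((2 * a : ℝ) : ℂ) * f (j - 1) true 0)
  linarith

/-- In a gap of the background the norm is controlled by `(T - E)u` and finitely many vertex
values. -/
theorem exists_gap_estimate {A β : ℤ → ℝ} {A₀ α E : ℝ} {n : ℕ}
    (hA : ∀ j ∉ Finset.Icc (1 : ℤ) n, A j = A₀) (hβ : ∀ j ∉ Finset.Icc (1 : ℤ) n, β j = α)
    (hE : sPi E ≠ 0) (hη : |Real.cos (A₀ * Real.pi)| < |eta α E|) :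
    ∃ C > 0, ∀ (u h : ChainL2) (f f' f'' : ℤ → Bool → ℝ → ℂ), Realizes A β u h f f' f'' →
      ‖u‖ ^ 2 ≤ C * (‖h - (E : ℂ) • u‖ ^ 2
        + ∑ j ∈ Finset.Icc (-1 : ℤ) (n + 2), ‖f j true 0‖ ^ 2) := by
  obtain ⟨K, hK, D, hD0, hrec⟩ := exists_perturbed_recurrence_bound E hA hβ
  obtain ⟨K₂, hK₂, hedge⟩ := exists_edge_bound hE
  set a := Real.cos (A₀ * Real.pi) with ha
  have hη0 : 0 < |eta α E| := (abs_nonneg a).trans_lt hη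
  -- The contraction factor of the recurrence; t < 1 is precisely the condition that E lies off the
  -- bands.
  set t := |a| / |eta α E| with ht
  have ht0 : 0 ≤ t := by positivity
  have ht1 : t < 1 := (div_lt_one hη0).2 hη
  set q : ℝ := 4 * |eta α E| with hq
  have hq0 : 0 < q := by positivity
  set M : ℝ := ((Finset.Icc (0 : ℤ) (n + 1)).card : ℝ) with hM
  set C₁ : ℝ := 2 / q ^ 2 * (16 * K ^ 2 + 9 * D ^ 2 * M) with hC₁
  have hC₁0 : 0 < C₁ := by positivity
  refine ⟨3 * K₂ ^ 2 * (4 * (C₁ / (1 - t) ^ 2) + 1), by positivity,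
    fun u h f f' f'' H => ?_⟩
  set k : ChainL2 := h - (E : ℂ) • u with hk
  set P := ∑ j ∈ Finset.Icc (-1 : ℤ) (n + 2), ‖f j true 0‖ ^ 2 with hP
  have hP0 : 0 ≤ P := Finset.sum_nonneg fun j _ => sq_nonneg _
  have hpP : ∀ j ∈ Finset.Icc (-1 : ℤ) (n + 2), ‖f j true 0‖ ≤ √P := by
    intro j hj
    apply Real.le_sqrt_of_sq_le
    exact Finset.single_le_sum (f := fun j => ‖f j true 0‖ ^ 2) (fun j _ => sq_nonneg _) hj
  set κ : ℤ → ℝ := fun j => (‖k (j, true)‖ + ‖k (j, false)‖)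
    + (‖k (j - 1, true)‖ + ‖k (j - 1, false)‖) with hκ
  set d : ℤ → ℝ := fun j => if j ∈ Finset.Icc (0 : ℤ) (n + 1) then 3 * √P else 0 with hd
  have hineq : ∀ j, ‖f j true 0‖ ≤ t * ((‖f (j + 1) true 0‖ + ‖f (j - 1) true 0‖) / 2)
      + (K * κ j + D * d j) / q := by
    intro j
    have hz := hrec u h f f' f'' H P hpP j
    have : ‖f j true 0‖ ≤ (2 * |a| * (‖f (j + 1) true 0‖ + ‖f (j - 1) true 0‖)
        + (K * κ j + D * d j)) / q := by
      rw [le_div_iff₀ hq0, mul_comm]; exact hz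
    refine this.trans_eq ?_
    rw [add_div, ht, hq]
    congr 1
    field_simp
    ring
  have hpsum := H.summable_vertex_sq
  have hT := summable_edge_norm_sq k true
  have hF := summable_edge_norm_sq k false
  have hTs := hasSum_shift hT.1.hasSum (-1)
  have hFs := hasSum_shift hF.1.hasSum (-1)
  have hdsum : HasSum (fun j : ℤ => if j ∈ Finset.Icc (0 : ℤ) (n + 1) then (1 : ℝ) else 0) M := by
    have := hasSum_sum_of_ne_finset_zero (L := SummationFilter.unconditional ℤ)
      (s := Finset.Icc (0 : ℤ) (n + 1))
      (f := fun j : ℤ => if j ∈ Finset.Icc (0 : ℤ) (n + 1) then (1 : ℝ) else 0)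
      (fun j hj => by simp only [if_neg hj])
    convert this using 1
    rw [Finset.sum_congr rfl fun j hj => if_pos hj]
    simp [hM]
  have hdom := (((((hT.1.hasSum.add hF.1.hasSum).add hTs).add hFs).mul_left (4 * K ^ 2)).add
    (hdsum.mul_left (9 * D ^ 2 * P))).mul_left (2 / q ^ 2)
  have hle : ∀ j, ((K * κ j + D * d j) / q) ^ 2 ≤ 2 / q ^ 2 * (4 * K ^ 2 *
      (‖k (j, true)‖ ^ 2 + ‖k (j, false)‖ ^ 2 + ‖k (j + -1, true)‖ ^ 2 + ‖k (j + -1, false)‖ ^ 2)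
      + 9 * D ^ 2 * P * (if j ∈ Finset.Icc (0 : ℤ) (n + 1) then (1 : ℝ) else 0)) := by
    intro j
    have hd2 : d j ^ 2 = 9 * P * (if j ∈ Finset.Icc (0 : ℤ) (n + 1) then (1 : ℝ) else 0) := by
      simp only [hd]
      split_ifs
      · rw [mul_pow, Real.sq_sqrt hP0]; ring
      · ring
    have hκ2 : κ j ^ 2 ≤ 4 * (‖k (j, true)‖ ^ 2 + ‖k (j, false)‖ ^ 2 + ‖k (j + -1, true)‖ ^ 2
        + ‖k (j + -1, false)‖ ^ 2) := by
      simp only [hκ, sub_eq_add_neg]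
      nlinarith [sq_nonneg (‖k (j, true)‖ - ‖k (j, false)‖),
        sq_nonneg (‖k (j + -1, true)‖ - ‖k (j + -1, false)‖),
        sq_nonneg ((‖k (j, true)‖ + ‖k (j, false)‖) - (‖k (j + -1, true)‖ + ‖k (j + -1, false)‖))]
    rw [div_pow, div_mul_eq_mul_div]
    apply div_le_div_of_nonneg_right _ (sq_nonneg q)
    have s1 := sq_nonneg (K * κ j - D * d j)
    have s2 := mul_le_mul_of_nonneg_left hκ2 (sq_nonneg K)
    have s3 : D ^ 2 * d j ^ 2 = D ^ 2 * (9 * P *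
      (if j ∈ Finset.Icc (0 : ℤ) (n + 1) then (1 : ℝ) else 0)) := by rw [hd2]
    linarith
  have hes : Summable fun j => ((K * κ j + D * d j) / q) ^ 2 :=
    Summable.of_nonneg_of_le (fun j => sq_nonneg _) hle hdom.summable
  have hesum : ∑' j, ((K * κ j + D * d j) / q) ^ 2 ≤ C₁ * (‖k‖ ^ 2 + P) := by
    have hcmp := hasSum_le (L := SummationFilter.unconditional ℤ) hle hes.hasSum hdom
    refine hcmp.trans ?_
    rw [hC₁, mul_assoc (2 / q ^ 2)]
    refine mul_le_mul_of_nonneg_left ?_ (by positivity)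
    have s1 := mul_le_mul_of_nonneg_left hT.2 (show 0 ≤ 4 * K ^ 2 by positivity)
    have s2 := mul_le_mul_of_nonneg_left hF.2 (show 0 ≤ 4 * K ^ 2 by positivity)
    have s3 : 0 ≤ 16 * K ^ 2 * P := by positivity
    have s4 : 0 ≤ 9 * D ^ 2 * M * ‖k‖ ^ 2 := by positivity
    linarith
  have hmain := tsum_sq_le_of_le_average (x := fun j => ‖f j true 0‖) ht0 ht1
    (fun j => norm_nonneg _) hpsum hes hineq
  have hX : ∑' j, ‖f j true 0‖ ^ 2 ≤ C₁ / (1 - t) ^ 2 * (‖k‖ ^ 2 + P) := by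
    have h1t : 0 < (1 - t) ^ 2 := by
      have : 0 < 1 - t := by linarith
      positivity
    rw [div_mul_eq_mul_div, le_div_iff₀ h1t, mul_comm]
    exact hmain.trans hesum
  have hu := chain_hasSum_norm_sq u
  have hkk := chain_hasSum_norm_sq k
  set X := ∑' j, ‖f j true 0‖ ^ 2 with hXdef
  -- Every vertex is an end of four edges, whence the factor 4.
  have hx2 : HasSum (fun i : ℤ × Bool => ‖f i.1 true 0‖ ^ 2 + ‖f (i.1 + 1) true 0‖ ^ 2)
      (4 * X) := by
    have hz := hpsum.hasSum.add (hasSum_shift hpsum.hasSum 1)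
    have hsm := summable_prod_bool hz.summable (fun j => by positivity)
    have e : ∑' i : ℤ × Bool, (‖f i.1 true 0‖ ^ 2 + ‖f (i.1 + 1) true 0‖ ^ 2) = 4 * X := by
      rw [hsm.tsum_prod]
      have := (hz.add hz).tsum_eq
      simp only [tsum_fintype, Fintype.sum_bool]
      rw [this]; ring
    rw [← e]
    exact hsm.hasSum
  have hs := (hx2.add hkk).mul_left (3 * K₂ ^ 2)
  have hfin : ‖u‖ ^ 2 ≤ 3 * K₂ ^ 2 * (4 * X + ‖k‖ ^ 2) := by
    refine hasSum_le (fun i => ?_) hu hs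
    have := hedge A β u h f f' f'' H i.1 i.2
    calc ‖u i‖ ^ 2 ≤ (K₂ * (‖f i.1 true 0‖ + ‖f (i.1 + 1) true 0‖ + ‖k i‖)) ^ 2 := by
          gcongr
      _ = K₂ ^ 2 * (‖f i.1 true 0‖ + ‖f (i.1 + 1) true 0‖ + ‖k i‖) ^ 2 := by ring
      _ ≤ K₂ ^ 2 * (3 * (‖f i.1 true 0‖ ^ 2 + ‖f (i.1 + 1) true 0‖ ^ 2 + ‖k i‖ ^ 2)) := by
          gcongr
          nlinarith [sq_nonneg (‖f i.1 true 0‖ - ‖f (i.1 + 1) true 0‖),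
            sq_nonneg (‖f i.1 true 0‖ - ‖k i‖), sq_nonneg (‖f (i.1 + 1) true 0‖ - ‖k i‖)]
      _ = _ := by ring
  refine hfin.trans ?_
  rw [mul_assoc (3 * K₂ ^ 2)]
  apply mul_le_mul_of_nonneg_left _ (by positivity)
  linarith

/-- Along an orthonormal sequence the inner products with a fixed vector tend to 0 by Bessel's
inequality, so vertex values of a singular sequence tend to 0. The gap estimate would then bound 1
by a null sequence. -/
theorem notMem_essentialSpectrum {A β : ℤ → ℝ} {A₀ α E : ℝ} {n : ℕ}
    (hA : ∀ j ∉ Finset.Icc (1 : ℤ) n, A j = A₀) (hβ : ∀ j ∉ Finset.Icc (1 : ℤ) n, β j = α)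
    (hE : sPi E ≠ 0) (hη : |Real.cos (A₀ * Real.pi)| < |eta α E|) :
    E ∉ essentialSpectrum (laplacian A β) := by
  rintro ⟨v, hv, hlim⟩
  obtain ⟨C, hC, hest⟩ := exists_gap_estimate hA hβ hE hη
  choose f f' f'' H using fun m =>
    mem_laplacianGraph_iff.1 (mem_laplacian_graph_iff.2 ⟨v m, rfl, rfl⟩)
  have hk : Tendsto (fun m => ‖laplacian A β (v m) - (E : ℂ) • (v m : ChainL2)‖) atTop (𝓝 0) :=
    tendsto_zero_iff_norm_tendsto_zero.1 hlim
  have hp : ∀ j, Tendsto (fun m => ‖f m j true 0‖) atTop (𝓝 0) := by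
    intro j
    obtain ⟨Φ, K, hΦ⟩ := exists_vertex_functional A E j true
    have hin : Tendsto (fun m => ‖inner ℂ Φ (v m : ChainL2)‖) atTop (𝓝 0) := by
      have h1 := (hv.inner_products_summable Φ).tendsto_atTop_zero
      have h2 := (Real.continuous_sqrt.tendsto 0).comp h1
      rw [Real.sqrt_zero] at h2
      refine h2.congr fun m => ?_
      simp only [Function.comp_apply]
      rw [Real.sqrt_sq (norm_nonneg _), norm_inner_symm]
    refine squeeze_zero (fun m => norm_nonneg _) (fun m => (hΦ β _ _ _ _ _ (H m)).trans
      (add_le_add_right (mul_le_mul (le_abs_self K) (lp.norm_apply_le_norm two_ne_zero _ _)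
        (norm_nonneg _) (abs_nonneg K)) _)) ?_
    simpa using hin.add (hk.const_mul |K|)
  have hsum : Tendsto (fun m => ∑ j ∈ Finset.Icc (-1 : ℤ) (n + 2), ‖f m j true 0‖ ^ 2) atTop
      (𝓝 0) := by
    have := tendsto_finsetSum (Finset.Icc (-1 : ℤ) (n + 2)) fun j _ => (hp j).pow 2
    simpa using this
  have hall := ((hk.pow 2).add hsum).const_mul C
  have h1 : ∀ m, (1 : ℝ) ≤ C * (‖laplacian A β (v m) - (E : ℂ) • (v m : ChainL2)‖ ^ 2
      + ∑ j ∈ Finset.Icc (-1 : ℤ) (n + 2), ‖f m j true 0‖ ^ 2) := by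
    intro m
    have := hest _ _ _ _ _ (H m)
    have h2 : ‖(v m : ChainL2)‖ = 1 := hv.1 m
    rwa [h2, one_pow] at this
  have := ge_of_tendsto' hall h1
  norm_num at this

/-! ### The essential spectrum of the locally perturbed chain -/

theorem integral_norm_le_edge_norm {k : EdgeL2} {g : ℝ → ℂ}
    (hk : k =ᵐ[volume.restrict (Ioo (0 : ℝ) Real.pi)] g) :
    ∫ t in (0 : ℝ)..Real.pi, ‖g t‖ ≤ √Real.pi * ‖k‖ := by
  refine le_trans (le_of_eq ?_) (integral_norm_edge_le k)
  rw [intervalIntegral.integral_of_le Real.pi_pos.le, integral_Ioc_eq_integral_Ioo]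
  exact integral_congr_ae (hk.symm.mono fun t ht => by simp only [ht])

theorem edge_eq_zero {k : EdgeL2} {g : ℝ → ℂ}
    (hk : k =ᵐ[volume.restrict (Ioo (0 : ℝ) Real.pi)] g) (hg : ∀ t, g t = 0) : k = 0 := by
  apply Lp.ext
  refine hk.trans (EventuallyEq.trans ?_ (Lp.coeFn_zero _ _ _).symm)
  exact Eventually.of_forall hg

theorem sub_smul_ae {u h : ChainL2} {E : ℝ} {g g₁ : ℤ → Bool → ℝ → ℂ} {j : ℤ} {s : Bool}
    (hu : u (j, s) =ᵐ[volume.restrict (Ioo (0 : ℝ) Real.pi)] g j s)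
    (hh : h (j, s) =ᵐ[volume.restrict (Ioo (0 : ℝ) Real.pi)] g₁ j s) :
    (h - (E : ℂ) • u) (j, s) =ᵐ[volume.restrict (Ioo (0 : ℝ) Real.pi)]
      fun t => g₁ j s t - E * g j s t := by
  have e : (h - (E : ℂ) • u) (j, s) = h (j, s) - (E : ℂ) • u (j, s) := rfl
  rw [e]
  filter_upwards [Lp.coeFn_sub (h (j, s)) ((E : ℂ) • u (j, s)),
    Lp.coeFn_smul (E : ℂ) (u (j, s)), hu, hh] with t h1 h2 h3 h4
  rw [h1, Pi.sub_apply, h2, Pi.smul_apply, h3, h4]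
  rfl

theorem summable_sq_ite {p : ℤ → Prop} [DecidablePred p] (F : Finset ℤ) (hF : ∀ j, p j → j ∈ F)
    (M : ℝ) : Summable fun j => (if p j then M else 0) ^ 2 :=
  summable_of_ne_finset_zero (s := F) fun j hj => by
    rw [if_neg fun h => hj (hF j h)]; ring

theorem hasDerivAt_ofReal_sn (E x : ℝ) :
    HasDerivAt (fun t => ((sn E t : ℝ) : ℂ)) ((cs E x : ℝ) : ℂ) x :=
  (hasDerivAt_sn E x).ofReal_comp

theorem hasDerivAt_ofReal_cs (E x : ℝ) :
    HasDerivAt (fun t => ((cs E t : ℝ) : ℂ)) (-(E : ℂ) * ((sn E x : ℝ) : ℂ)) x := by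
  have := (hasDerivAt_cs E x).ofReal_comp
  push_cast at this
  exact this

/-- The flat bands: `m²` is an eigenvalue of infinite multiplicity. -/
theorem flat_mem_essentialSpectrum {A β : ℤ → ℝ} {A₀ : ℝ} {n : ℕ}
    (hA : ∀ j ∉ Finset.Icc (1 : ℤ) n, A j = A₀) (m : ℕ) :
    ((m : ℝ) + 1) ^ 2 ∈ essentialSpectrum (laplacian A β) := by
  set E : ℝ := ((m : ℝ) + 1) ^ 2 with hE
  have hE0 : 0 < E := by positivity
  have hS : sn E Real.pi = 0 := sPi_natCast_sq m
  set I : ℝ := ∫ t in (0 : ℝ)..Real.pi, |sn E t| with hI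
  have hI0 : 0 < I := by
    refine intervalIntegral.integral_pos Real.pi_pos (continuous_sn E).abs.continuousOn
      (fun t _ => abs_nonneg _) ⟨Real.pi / (2 * ((m : ℝ) + 1)), ⟨by positivity, ?_⟩, ?_⟩
    · apply div_le_self Real.pi_pos.le
      have : (0 : ℝ) ≤ m := Nat.cast_nonneg m
      linarith
    · rw [abs_pos, sn_of_pos hE0, hE, Real.sqrt_sq (by positivity)]
      have : ((m : ℝ) + 1) * (Real.pi / (2 * ((m : ℝ) + 1))) = Real.pi / 2 := by
        field_simp
      rw [this, Real.sin_pi_div_two]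
      positivity
  refine mem_essentialSpectrum_of_blocks (n + 1) 0 (I ^ 2 / Real.pi) (by positivity)
    fun B hB N hN => ?_
  have hAB : ∀ j ≥ B, A j = A₀ := fun j hj => hA j fun hh => by
    have := Finset.mem_Icc.1 hh; omega
  set c : ℂ := ((cs E Real.pi : ℝ) : ℂ) with hc
  set X := Complex.exp (potential (fun _ => A₀) 0 false * Real.pi) with hX
  set Y := Complex.exp (potential (fun _ => A₀) 0 true * Real.pi) with hY
  have hXj : ∀ j ≥ B, Complex.exp (potential A j false * Real.pi) = X := fun j hj => by
    rw [hX]; simp [potential, hAB j hj]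
  have hYj : ∀ j ≥ B, Complex.exp (potential A j true * Real.pi) = Y := fun j hj => by
    rw [hY]; simp [potential, hAB j hj]
  -- An exact eigenfunction on the two rings B and B + 1, a multiple of `sn` on each edge and so
  -- zero at all vertices. On ring B the outgoing derivatives cancel; the amplitudes on ring B + 1
  -- absorb those arriving at its left end and cancel at its right end. The factor N only scales it
  -- to the size demanded of a block.
  set κ : ℤ → Bool → ℂ := fun j s => if j = B then (if s then (N : ℂ) else -N) else
    if j = B + 1 then (if s then -c * Y * N else c * X * N) else 0 with hκ
  have hκ0 : ∀ j s, j ≠ B → j ≠ B + 1 → κ j s = 0 := by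
    intro j s h1 h2; simp only [hκ, if_neg h1, if_neg h2]
  have hκB : ∀ s, κ B s = if s then (N : ℂ) else -N := by
    intro s; simp only [hκ, if_true]
  have hκB1 : ∀ s, κ (B + 1) s = if s then -c * Y * N else c * X * N := by
    intro s
    have : B + 1 ≠ B := by omega
    simp only [hκ, if_neg this, if_true]
  obtain ⟨M, hM⟩ : ∃ M : ℝ, ∀ j s, ‖κ j s‖ ≤ M := by
    refine ⟨‖κ B true‖ + ‖κ B false‖ + ‖κ (B + 1) true‖ + ‖κ (B + 1) false‖, fun j s => ?_⟩
    have := norm_nonneg (κ B true)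
    have := norm_nonneg (κ B false)
    have := norm_nonneg (κ (B + 1) true)
    have := norm_nonneg (κ (B + 1) false)
    by_cases h1 : j = B
    · subst h1; cases s <;> linarith
    by_cases h2 : j = B + 1
    · subst h2; cases s <;> linarith
    rw [hκ0 j s h1 h2, norm_zero]; linarith
  obtain ⟨K, hK, hKb⟩ := exists_solution_bound E
  have hsum : ∀ R : ℝ, Summable fun j : ℤ => (if j = B ∨ j = B + 1 then R else 0) ^ 2 := fun R =>
    summable_sq_ite {B, B + 1} (fun j hj => by simpa using hj) R
  have hbd : ∀ j s, ∀ t ∈ Icc (0 : ℝ) Real.pi, ‖κ j s * (sn E t : ℝ)‖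
      ≤ if j = B ∨ j = B + 1 then M * K else 0 := by
    intro j s t ht
    split_ifs with hj
    · rw [norm_mul, Complex.norm_real]
      exact mul_le_mul (hM j s) (hKb t ht).2.1 (abs_nonneg _) ((norm_nonneg _).trans (hM j s))
    · rw [hκ0 j s (fun h => hj (Or.inl h)) (fun h => hj (Or.inr h)), zero_mul, norm_zero]
  obtain ⟨u, h, f, f', f'', H, -, hu, hh⟩ := exists_realizes (A := A) (β := β)
    (y := fun j s t => κ j s * (sn E t : ℝ)) (y' := fun j s t => κ j s * (cs E t : ℝ))
    (y'' := fun j s t => κ j s * (-(E : ℂ) * (sn E t : ℝ)))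
    (fun j s x => (hasDerivAt_ofReal_sn E x).const_mul _)
    (fun j s x => (hasDerivAt_ofReal_cs E x).const_mul _)
    (fun j s => by have := continuous_sn E; fun_prop)
    (fun j => by simp) (fun j s => by simp [hS])
    (fun j => by
      simp only [cs_zero, sn_zero, Complex.ofReal_one, Complex.ofReal_zero, mul_one, mul_zero]
      by_cases h1 : j = B
      · subst h1
        rw [hκ0 (j - 1) _ (by omega) (by omega), hκ0 (j - 1) _ (by omega) (by omega), hκB, hκB]
        simp
      by_cases h2 : j = B + 1
      · subst h2
        rw [add_sub_cancel_right, hκB, hκB, hκB1, hκB1, hXj B le_rfl, hYj B le_rfl]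
        simp only [if_true, Bool.false_eq_true, if_false, ← hc]
        ring
      by_cases h3 : j = B + 2
      · subst h3
        rw [hκ0 (B + 2) _ (by omega) (by omega), hκ0 (B + 2) _ (by omega) (by omega),
          show B + 2 - 1 = B + 1 by ring, hκB1, hκB1, hXj (B + 1) (by omega),
          hYj (B + 1) (by omega)]
        simp only [if_true, Bool.false_eq_true, if_false, ← hc]
        ring
      · rw [hκ0 j _ h1 h2, hκ0 j _ h1 h2, hκ0 (j - 1) _ (by omega) (by omega),
          hκ0 (j - 1) _ (by omega) (by omega)]
        simp)
    (b := fun j => if j = B ∨ j = B + 1 then M * K else 0)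
    (b' := fun j => if j = B ∨ j = B + 1 then E * (M * K) else 0)
    hbd (fun j s t ht => by
      have := hbd j s t ht
      rw [show κ j s * (-(E : ℂ) * (sn E t : ℝ)) = -(E : ℂ) * (κ j s * (sn E t : ℝ)) by ring,
        norm_mul, norm_neg, Complex.norm_real, Real.norm_eq_abs, abs_of_pos hE0]
      split_ifs at this ⊢ with hj
      · gcongr
      · rw [le_antisymm this (norm_nonneg _), mul_zero])
    (hsum _) (hsum _)
  refine ⟨u, h, mem_laplacianGraph_iff.2 ⟨f, f', f'', H⟩, fun j s hj => ?_, ?_, ?_⟩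
  · refine edge_eq_zero (hu j s) fun t => ?_
    rw [hκ0 j s (by omega) (by omega)]
    simp
  · apply le_of_eq
    rw [norm_eq_zero]
    apply lp.ext
    funext ⟨j, s⟩
    refine edge_eq_zero (sub_smul_ae (E := E) (g := fun j s t =>
      Complex.exp (potential A j (!s) * t) * (κ j s * (sn E t : ℝ))) (g₁ := fun j s t =>
      -(Complex.exp (potential A j (!s) * t) * (κ j s * (-(E : ℂ) * (sn E t : ℝ)))))
      (hu j s) (hh j s)) fun t => ?_
    ring
  · have h1 := integral_norm_le_edge_norm (hu B true)
    have e1 : ∀ t : ℝ, ‖Complex.exp (potential A B (!true) * t) * (κ B true * (sn E t : ℝ))‖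
        = N * |sn E t| := by
      intro t
      rw [norm_mul, norm_exp_potential_mul, one_mul, norm_mul, hκB, Complex.norm_real]
      simp
    simp only [e1] at h1
    rw [intervalIntegral.integral_const_mul] at h1
    have h2 := lp.norm_apply_le_norm two_ne_zero u (B, true)
    have h3 : N * I ≤ √Real.pi * ‖u‖ := h1.trans (by gcongr)
    have h4 : (N * I) ^ 2 ≤ (√Real.pi * ‖u‖) ^ 2 := by gcongr
    rw [mul_pow, mul_pow, Real.sq_sqrt Real.pi_pos.le] at h4
    rw [div_mul_eq_mul_div, div_le_iff₀ Real.pi_pos]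
    have hN1 : (1 : ℝ) ≤ N := by exact_mod_cast hN
    have h5 : (N : ℝ) * I ^ 2 ≤ (N : ℝ) ^ 2 * I ^ 2 := by
      apply mul_le_mul_of_nonneg_right _ (sq_nonneg I)
      nlinarith
    linarith

/-- The function `(1 - cos x)/2` interpolates between `0` and `1` with vanishing derivative at the
ends of the edge. -/
theorem exists_cutoff (c₀ c₁ : ℝ) (h0 : c₀ ∈ Icc (0 : ℝ) 1) (h1 : c₁ ∈ Icc (0 : ℝ) 1) :
    ∃ χ χ' χ'' : ℝ → ℂ, (∀ x, HasDerivAt χ (χ' x) x) ∧ (∀ x, HasDerivAt χ' (χ'' x) x) ∧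
      Continuous χ'' ∧ χ 0 = c₀ ∧ χ Real.pi = c₁ ∧ χ' 0 = 0 ∧ χ' Real.pi = 0 ∧
      (∀ x, ‖χ x‖ ≤ 1) ∧ (∀ x, ‖χ' x‖ ≤ 1) ∧ (∀ x, ‖χ'' x‖ ≤ 1) ∧
      (c₀ = c₁ → ∀ x, χ x = c₀ ∧ χ' x = 0 ∧ χ'' x = 0) := by
  have hd : |c₁ - c₀| ≤ 1 := by
    rw [abs_le]; constructor <;> linarith [h0.1, h0.2, h1.1, h1.2]
  refine ⟨fun x => ((c₀ + (c₁ - c₀) * ((1 - Real.cos x) / 2) : ℝ) : ℂ),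
    fun x => (((c₁ - c₀) * (Real.sin x / 2) : ℝ) : ℂ),
    fun x => (((c₁ - c₀) * (Real.cos x / 2) : ℝ) : ℂ), fun x => ?_, fun x => ?_, by fun_prop,
    by simp, by simp, by simp, by simp, fun x => ?_, fun x => ?_, fun x => ?_, ?_⟩
  · have := ((((Real.hasDerivAt_cos x).const_sub 1).div_const 2).const_mul (c₁ - c₀)).const_add c₀
    refine this.ofReal_comp.congr_deriv ?_
    rw [neg_neg]
  · exact (((Real.hasDerivAt_sin x).div_const 2).const_mul (c₁ - c₀)).ofReal_comp
  · rw [Complex.norm_real, Real.norm_eq_abs, abs_le]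
    have hc1 := Real.cos_le_one x
    have hc2 := Real.neg_one_le_cos x
    have e : c₀ + (c₁ - c₀) * ((1 - Real.cos x) / 2)
        = c₀ * ((1 + Real.cos x) / 2) + c₁ * ((1 - Real.cos x) / 2) := by ring
    have p1 : 0 ≤ (1 + Real.cos x) / 2 := by linarith
    have p2 : 0 ≤ (1 - Real.cos x) / 2 := by linarith
    have q1 := mul_le_mul_of_nonneg_right h0.2 p1
    have q2 := mul_le_mul_of_nonneg_right h1.2 p2
    have q3 := mul_nonneg h0.1 p1
    have q4 := mul_nonneg h1.1 p2
    rw [e]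
    constructor <;> linarith
  · rw [Complex.norm_real, Real.norm_eq_abs, abs_mul, abs_div, abs_two]
    have := Real.abs_sin_le_one x
    calc |c₁ - c₀| * (|Real.sin x| / 2) ≤ 1 * (1 / 2) := by gcongr
      _ ≤ 1 := by norm_num
  · rw [Complex.norm_real, Real.norm_eq_abs, abs_mul, abs_div, abs_two]
    have := Real.abs_cos_le_one x
    calc |c₁ - c₀| * (|Real.cos x| / 2) ≤ 1 * (1 / 2) := by gcongr
      _ ≤ 1 := by norm_num
  · rintro rfl x
    simp

/-- The bands of the homogeneous chain belong to the essential spectrum. -/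
theorem band_mem_essentialSpectrum {A β : ℤ → ℝ} {A₀ α E : ℝ} {n : ℕ}
    (hA : ∀ j ∉ Finset.Icc (1 : ℤ) n, A j = A₀) (hβ : ∀ j ∉ Finset.Icc (1 : ℤ) n, β j = α)
    (hE : sPi E ≠ 0) (ha : Real.cos (A₀ * Real.pi) ≠ 0)
    (hη : |eta α E| ≤ |Real.cos (A₀ * Real.pi)|) :
    E ∈ essentialSpectrum (laplacian A β) := by
  set a := Real.cos (A₀ * Real.pi) with ha'
  -- A Bloch phase: with z = e^{iφ} the sequence z^j solves the recurrence of the homogeneous chain,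
  -- because a(z + 1/z) = 2η.
  set φ := Real.arccos (eta α E / a) with hφ
  have hratio : |eta α E / a| ≤ 1 := by rw [abs_div]; exact div_le_one_of_le₀ hη (abs_nonneg a)
  have hcosφ : a * Real.cos φ = eta α E := by
    rw [hφ, Real.cos_arccos (abs_le.1 hratio).1 (abs_le.1 hratio).2]; field_simp
  set z := Complex.exp (φ * Complex.I) with hz
  have hz0 : z ≠ 0 := Complex.exp_ne_zero _
  have hz1 : ‖z‖ = 1 := Complex.norm_exp_ofReal_mul_I φ
  have hzz : (a : ℂ) * (z + z⁻¹) = 2 * eta α E := by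
    rw [← hcosφ, hz, ← Complex.exp_neg, ← neg_mul]
    push_cast
    have := Complex.two_cos (φ : ℂ)
    rw [← this]
    ring
  have hsE : (sPi E : ℂ) ≠ 0 := by exact_mod_cast hE
  set w : Bool → ℂ := potential (fun _ => A₀) 0 with hw
  set X : Bool → ℂ := fun s => Complex.exp (w s * Real.pi) with hX
  have hXX : X true * X false = 1 := by
    rw [hX]
    simp only [hw, potential]
    rw [← Complex.exp_add]
    simp
  have hXs : X true + X false = 2 * a := exp_potential_add (fun _ => A₀) 0 Real.pi
  set q : Bool → ℂ := fun s => (X s * z - cPi E) / sPi E with hq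
  set Y : Bool → ℝ → ℂ := fun s x => cs E x + q s * sn E x with hY
  set Y' : Bool → ℝ → ℂ := fun s x => -(E : ℂ) * sn E x + q s * cs E x with hY'
  have hYd : ∀ s x, HasDerivAt (Y s) (Y' s x) x := fun s x =>
    (hasDerivAt_ofReal_cs E x).add ((hasDerivAt_ofReal_sn E x).const_mul (q s))
  have hYd' : ∀ s x, HasDerivAt (Y' s) (-(E : ℂ) * Y s x) x := fun s x =>
    (((hasDerivAt_ofReal_sn E x).const_mul (-(E : ℂ))).add
      ((hasDerivAt_ofReal_cs E x).const_mul (q s))).congr_deriv (by simp only [hY]; ring)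
  have hYc : ∀ s, Continuous (Y s) := fun s =>
    continuous_iff_continuousAt.2 fun x => (hYd s x).continuousAt
  have hYc' : ∀ s, Continuous (Y' s) := fun s =>
    continuous_iff_continuousAt.2 fun x => (hYd' s x).continuousAt
  have hY0 : ∀ s, Y s 0 = 1 := fun s => by simp [hY]
  have hY'0 : ∀ s, Y' s 0 = q s := fun s => by simp [hY']
  have hYpi : ∀ s, Y s Real.pi = X s * z := fun s => by
    have e : Y s Real.pi = cPi E + q s * sPi E := rfl
    rw [e, hq]
    field_simp
    ring
  have hY'pi : ∀ s, Y' s Real.pi = (cPi E * X s * z - 1) / sPi E := fun s => by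
    have e : Y' s Real.pi = -(E : ℂ) * sPi E + q s * cPi E := rfl
    have e4 : (cPi E : ℂ) ^ 2 + E * (sPi E : ℂ) ^ 2 = 1 := by exact_mod_cast cPi_sq_add E
    rw [e, hq, eq_div_iff hsE]
    field_simp
    linear_combination -e4
  obtain ⟨M, hM⟩ := (isCompact_Icc (a := (0 : ℝ)) (b := Real.pi)).bddAbove_image
    (f := fun t => ‖Y true t‖ + ‖Y false t‖ + ‖Y' true t‖ + ‖Y' false t‖) (by
      have := hYc true
      have := hYc false
      have := hYc' true
      have := hYc' false
      fun_prop)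
  have hMY : ∀ s, ∀ t ∈ Icc (0 : ℝ) Real.pi, ‖Y s t‖ ≤ M ∧ ‖Y' s t‖ ≤ M := by
    intro s t ht
    have h := hM ⟨t, ht, rfl⟩
    simp only at h
    have := norm_nonneg (Y true t)
    have := norm_nonneg (Y false t)
    have := norm_nonneg (Y' true t)
    have := norm_nonneg (Y' false t)
    cases s <;> constructor <;> linarith
  have hM0 : 0 ≤ M := (norm_nonneg _).trans (hMY true 0 ⟨le_rfl, Real.pi_pos.le⟩).1
  set I : ℝ := ∫ t in (0 : ℝ)..Real.pi, ‖Y true t‖ with hI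
  have hI0 : 0 < I := by
    refine intervalIntegral.integral_pos Real.pi_pos (hYc true).norm.continuousOn
      (fun t _ => norm_nonneg _) ⟨0, ⟨le_rfl, Real.pi_pos.le⟩, ?_⟩
    rw [hY0, norm_one]
    exact one_pos
  refine mem_essentialSpectrum_of_blocks (n + 1) (2 * (√Real.pi * (3 * M))) (I ^ 2 / Real.pi)
    (by positivity) fun B hB N hN => ?_
  have hAB : ∀ j ≥ B, A j = A₀ := fun j hj => hA j fun hh => by
    have := Finset.mem_Icc.1 hh; omega
  have hβB : ∀ j ≥ B, β j = α := fun j hj => hβ j fun hh => by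
    have := Finset.mem_Icc.1 hh; omega
  have hXj : ∀ j ≥ B, ∀ s, Complex.exp (potential A j s * Real.pi) = X s := fun j hj s => by
    simp only [hX, hw]; simp [potential, hAB j hj]
  -- Vertex values of the cutoff. It varies only on the rings B and B + N + 1, so the residual is
  -- bounded independently of N, while about N rings carry the full Bloch wave; the cutoff has zero
  -- derivative at the vertices, which preserves the coupling.
  set c : ℤ → ℝ := fun j => if B < j ∧ j ≤ B + N + 1 then 1 else 0 with hc
  have hc01 : ∀ j, c j ∈ Icc (0 : ℝ) 1 := fun j => by
    simp only [hc]; split_ifs <;> simp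
  have hc1 : ∀ j, B < j → j ≤ B + N + 1 → c j = 1 := fun j h1 h2 => if_pos ⟨h1, h2⟩
  have hc0 : ∀ j, ¬ (B < j ∧ j ≤ B + N + 1) → c j = 0 := fun j h1 => if_neg h1
  choose χ χ' χ'' d1 d2 d3 χ0 χpi χ'0 χ'pi b1 b2 b3 hconst using
    fun j => exists_cutoff (c j) (c (j + 1)) (hc01 j) (hc01 (j + 1))
  have hzn : ∀ j : ℤ, ‖z ^ j‖ = 1 := fun j => by rw [norm_zpow, hz1, one_zpow]
  have hout : ∀ j, ¬ (B ≤ j ∧ j ≤ B + N + 1) → ∀ x, χ j x = 0 ∧ χ' j x = 0 ∧ χ'' j x = 0 := by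
    intro j hj x
    have e0 : c j = 0 := hc0 j (by omega)
    have e1 : c (j + 1) = 0 := hc0 (j + 1) (by omega)
    have := hconst j (by rw [e0, e1]) x
    rwa [e0, Complex.ofReal_zero] at this
  set y : ℤ → Bool → ℝ → ℂ := fun j s t => z ^ j * (χ j t * Y s t) with hy
  set y' : ℤ → Bool → ℝ → ℂ := fun j s t => z ^ j * (χ' j t * Y s t + χ j t * Y' s t) with hy'
  set y'' : ℤ → Bool → ℝ → ℂ := fun j s t =>
    z ^ j * (χ'' j t * Y s t + 2 * (χ' j t * Y' s t) - E * (χ j t * Y s t)) with hy''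
  have hcχ : ∀ j, Continuous (χ j) := fun j =>
    continuous_iff_continuousAt.2 fun x => (d1 j x).continuousAt
  have hcχ' : ∀ j, Continuous (χ' j) := fun j =>
    continuous_iff_continuousAt.2 fun x => (d2 j x).continuousAt
  have hsum : ∀ R : ℝ, Summable fun j : ℤ => (if B ≤ j ∧ j ≤ B + N + 1 then R else 0) ^ 2 :=
    fun R => summable_sq_ite (Finset.Icc B (B + N + 1)) (fun j hj => Finset.mem_Icc.2 hj) R
  have hχY : ∀ j s, ∀ t ∈ Icc (0 : ℝ) Real.pi, ‖χ j t * Y s t‖ ≤ M := by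
    intro j s t ht
    rw [norm_mul, ← one_mul M]
    exact mul_le_mul (b1 j t) (hMY s t ht).1 (norm_nonneg _) zero_le_one
  have hres : ∀ j s, ∀ t ∈ Icc (0 : ℝ) Real.pi,
      ‖χ'' j t * Y s t + 2 * (χ' j t * Y' s t)‖ ≤ 3 * M := by
    intro j s t ht
    have r1 : ‖χ'' j t * Y s t‖ ≤ M := by
      rw [norm_mul, ← one_mul M]
      exact mul_le_mul (b3 j t) (hMY s t ht).1 (norm_nonneg _) zero_le_one
    have r2 : ‖χ' j t * Y' s t‖ ≤ M := by
      rw [norm_mul, ← one_mul M]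
      exact mul_le_mul (b2 j t) (hMY s t ht).2 (norm_nonneg _) zero_le_one
    have r3 : ‖2 * (χ' j t * Y' s t)‖ ≤ 2 * M := by
      rw [norm_mul, Complex.norm_two]; linarith
    have := norm_add_le (χ'' j t * Y s t) (2 * (χ' j t * Y' s t))
    linarith
  obtain ⟨u, h, f, f', f'', H, -, hu, hh⟩ := exists_realizes (A := A) (β := β)
    (y := y) (y' := y') (y'' := y'')
    (fun j s x => (((d1 j x).mul (hYd s x)).const_mul (z ^ j)).congr_deriv (by
      simp only [hy']))
    (fun j s x => ((((d2 j x).mul (hYd s x)).add ((d1 j x).mul (hYd' s x))).const_mul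
      (z ^ j)).congr_deriv (by simp only [hy'']; ring))
    (fun j s => by
      have := hYc s; have := hYc' s; have := d3 j; have := hcχ j; have := hcχ' j
      simp only [hy'']
      fun_prop)
    (fun j => by simp only [hy, hY0]) (fun j s => by
      simp only [hy, hY0, hYpi, χpi, χ0]
      by_cases hj : B ≤ j
      · rw [hXj j hj, zpow_add_one₀ hz0]; ring
      · rw [hc0 (j + 1) (by omega)]; simp)
    (fun j => by
      simp only [hy, hy', hY0, hY'0, hYpi, hY'pi, χpi, χ0, χ'0, χ'pi, zero_mul, zero_add,
        sub_add_cancel]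
      by_cases hj : B < j ∧ j ≤ B + N + 1
      · have hβj := hβB j hj.1.le
        rw [hXj (j - 1) (by omega), hXj (j - 1) (by omega), hβj]
        have e5 : z ^ (j - 1) = z ^ j * z⁻¹ := zpow_sub_one₀ hz0 j
        rw [e5]
        simp only [hq]
        have e6 : (eta α E : ℂ) = cPi E + α / 4 * sPi E := by
          simp only [eta]; push_cast; ring
        rw [e6] at hzz
        have e7 : z * z⁻¹ = 1 := mul_inv_cancel₀ hz0
        rw [← sub_eq_zero]
        have e8 : z ^ j * (c j * ((X true * z - cPi E) / sPi E))
            + z ^ j * (c j * ((X false * z - cPi E) / sPi E))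
            - X false * (z ^ j * z⁻¹ * (c j * ((cPi E * X true * z - 1) / sPi E)))
            - X true * (z ^ j * z⁻¹ * (c j * ((cPi E * X false * z - 1) / sPi E)))
            - α * (z ^ j * (c j * 1))
            = z ^ j * c j / sPi E * ((X true + X false) * (z + z⁻¹) - 2 * cPi E
              - 2 * cPi E * (X true * X false) * (z * z⁻¹) - α * sPi E) := by
          field_simp
          ring
        rw [e8, hXX, hXs, e7]
        have e9 : 2 * (a : ℂ) * (z + z⁻¹) - 2 * cPi E - 2 * cPi E * 1 * 1 - α * sPi E = 0 := by
          linear_combination 2 * hzz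
        rw [e9, mul_zero]
      · rw [hc0 j hj]; simp)
    (b := fun j => if B ≤ j ∧ j ≤ B + N + 1 then M else 0)
    (b' := fun j => if B ≤ j ∧ j ≤ B + N + 1 then 3 * M + |E| * M else 0)
    (fun j s t ht => by
      simp only [hy]
      rw [norm_mul, hzn, one_mul]
      split_ifs with hj
      · exact hχY j s t ht
      · rw [(hout j hj t).1]; simp)
    (fun j s t ht => by
      simp only [hy'']
      rw [norm_mul, hzn, one_mul]
      split_ifs with hj
      · refine (norm_sub_le _ _).trans (add_le_add (hres j s t ht) ?_)
        rw [norm_mul, Complex.norm_real, Real.norm_eq_abs]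
        exact mul_le_mul_of_nonneg_left (hχY j s t ht) (abs_nonneg E)
      · obtain ⟨o1, o2, o3⟩ := hout j hj t
        rw [o1, o2, o3]; simp)
    (hsum _) (hsum _)
  refine ⟨u, h, mem_laplacianGraph_iff.2 ⟨f, f', f'', H⟩, fun j s hj => ?_, ?_, ?_⟩
  · refine edge_eq_zero (hu j s) fun t => ?_
    simp only [hy]
    rw [(hout j (by omega) t).1]
    simp
  · have hr : ∀ j s, (h - (E : ℂ) • u) (j, s) =ᵐ[volume.restrict (Ioo (0 : ℝ) Real.pi)]
        fun t => -(Complex.exp (potential A j (!s) * t) *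
          (z ^ j * (χ'' j t * Y s t + 2 * (χ' j t * Y' s t)))) := by
      intro j s
      have := sub_smul_ae (E := E) (g := fun j s t =>
        Complex.exp (potential A j (!s) * t) * y j s t) (g₁ := fun j s t =>
        -(Complex.exp (potential A j (!s) * t) * y'' j s t)) (hu j s) (hh j s)
      refine this.trans (Eventually.of_forall fun t => ?_)
      simp only [hy, hy'']
      ring
    have hr1 : ∀ j s, ‖(h - (E : ℂ) • u) (j, s)‖ ≤ √Real.pi * (3 * M) := by
      intro j s
      refine norm_edge_le_of_bound (by positivity) (hr j s) fun t ht => ?_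
      rw [norm_neg, norm_mul, norm_exp_potential_mul, one_mul, norm_mul, hzn, one_mul]
      exact hres j s t ht
    have hr0 : ∀ j s, j ≠ B → j ≠ B + N + 1 → (h - (E : ℂ) • u) (j, s) = 0 := by
      intro j s h1 h2
      refine edge_eq_zero (hr j s) fun t => ?_
      have hcc : c j = c (j + 1) := by
        by_cases hj : B < j ∧ j ≤ B + N + 1
        · rw [hc1 j hj.1 hj.2, hc1 (j + 1) (by omega) (by omega)]
        · rw [hc0 j hj, hc0 (j + 1) (by omega)]
      obtain ⟨-, o2, o3⟩ := hconst j hcc t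
      rw [o2, o3]
      simp
    have hs1 := chain_hasSum_norm_sq (h - (E : ℂ) • u)
    have hs2 := hasSum_sum_of_ne_finset_zero (L := SummationFilter.unconditional (ℤ × Bool))
      (f := fun i => ‖(h - (E : ℂ) • u) i‖ ^ 2)
      (s := ({B, B + N + 1} : Finset ℤ) ×ˢ (Finset.univ : Finset Bool)) (by
        rintro ⟨j, s⟩ hj
        simp only [Finset.mem_product, Finset.mem_insert, Finset.mem_singleton, Finset.mem_univ,
          and_true, not_or] at hj
        rw [hr0 j s hj.1 hj.2, norm_zero]
        ring)
    have hs3 := hs1.unique hs2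
    have hne : B ∉ ({B + N + 1} : Finset ℤ) := by
      simp only [Finset.mem_singleton]; omega
    rw [Finset.sum_product, Finset.sum_insert hne, Finset.sum_singleton] at hs3
    simp only [Fintype.sum_bool] at hs3
    have hR : 0 ≤ √Real.pi * (3 * M) := by positivity
    have k1 := pow_le_pow_left₀ (norm_nonneg _) (hr1 B true) 2
    have k2 := pow_le_pow_left₀ (norm_nonneg _) (hr1 B false) 2
    have k3 := pow_le_pow_left₀ (norm_nonneg _) (hr1 (B + N + 1) true) 2
    have k4 := pow_le_pow_left₀ (norm_nonneg _) (hr1 (B + N + 1) false) 2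
    refine le_of_sq_le_sq ?_ (by positivity)
    rw [hs3, mul_pow]
    linarith
  · have hu1 := summable_edge_norm_sq u true
    have h1 : ∀ j ∈ Finset.Ioc B (B + N), I ^ 2 / Real.pi ≤ ‖u (j, true)‖ ^ 2 := by
      intro j hj
      have hj' := Finset.mem_Ioc.1 hj
      have hk := integral_norm_le_edge_norm (hu j true)
      have e1 : ∀ t : ℝ, ‖Complex.exp (potential A j (!true) * t) * y j true t‖ = ‖Y true t‖ := by
        intro t
        have hcc : c j = c (j + 1) := by
          rw [hc1 j hj'.1 (by omega), hc1 (j + 1) (by omega) (by omega)]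
        obtain ⟨o1, -, -⟩ := hconst j hcc t
        rw [norm_mul, norm_exp_potential_mul, one_mul]
        simp only [hy]
        rw [o1, hc1 j hj'.1 (by omega), norm_mul, hzn, Complex.ofReal_one, one_mul, one_mul]
      simp only [e1] at hk
      have hk2 := pow_le_pow_left₀ hI0.le hk 2
      rw [mul_pow, Real.sq_sqrt Real.pi_pos.le] at hk2
      rw [div_le_iff₀ Real.pi_pos]
      linarith
    have h2 := Finset.sum_le_sum h1
    rw [Finset.sum_const, Int.card_Ioc, nsmul_eq_mul] at h2
    have h3 := hu1.1.sum_le_tsum (Finset.Ioc B (B + N)) (fun j _ => sq_nonneg _)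
    have e : ((B + N - B).toNat : ℝ) = N := by
      rw [add_sub_cancel_left, Int.toNat_natCast]
    rw [e] at h2
    linarith [hu1.2]

/-- The essential spectrum of the locally perturbed chain. -/
theorem essentialSpectrum_laplacian {A β : ℤ → ℝ} {A₀ α : ℝ} {n : ℕ}
    (hA : ∀ j ∉ Finset.Icc (1 : ℤ) n, A j = A₀) (hβ : ∀ j ∉ Finset.Icc (1 : ℤ) n, β j = α)
    (ha : Real.cos (A₀ * Real.pi) ≠ 0) (E : ℝ) :
    E ∈ essentialSpectrum (laplacian A β) ↔
      sPi E = 0 ∨ |eta α E| ≤ |Real.cos (A₀ * Real.pi)| := by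
  by_cases hE : sPi E = 0
  · rcases exists_energyInterval E with ⟨m, rfl⟩ | ⟨m, hm⟩
    · exact iff_of_true (flat_mem_essentialSpectrum hA m) (Or.inl hE)
    · exact absurd hE (sPi_ne_zero hm)
  · constructor
    · intro h
      by_contra! hcon
      exact notMem_essentialSpectrum hA hβ hE hcon.2 h
    · rintro (h | h)
      · exact absurd h hE
      · exact band_mem_essentialSpectrum hA hβ hE ha h

/-! ### The difference equation for the vertex values -/

/-- The ratios `b_j p_{j+1} / p_j` for the solution of
`b_j p_{j+1} + b_{j-1} p_{j-1} = (λ + 1/λ + v_j) p_j` decaying at `-∞`. -/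
def ratio (lam : ℝ) (b v : ℤ → ℝ) : ℕ → ℝ
  | 0 => lam
  | j + 1 => lam + lam⁻¹ + v (j + 1 : ℤ) - b (j : ℤ) ^ 2 / ratio lam b v j

/-- A solution of the difference equation of Jacobi type. -/
def SolvesRec {R : Type*} [Field R] [Algebra ℝ R] (lam : ℝ) (b v : ℤ → ℝ) (p : ℤ → R) : Prop :=
  ∀ j, algebraMap ℝ R (b j) * p (j + 1) + algebraMap ℝ R (b (j - 1)) * p (j - 1)
    = algebraMap ℝ R (lam + lam⁻¹ + v j) * p j

/-- The combination w_{i+1} - λ^{-1} w_i is multiplied by λ in each step, so boundedness forces it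
to vanish. -/
theorem eq_mul_pow_of_bounded {lam : ℝ} (hl : 1 < lam) {w : ℕ → ℂ} {M : ℝ} (hM : ∀ i, ‖w i‖ ≤ M)
    (h : ∀ i, w (i + 2) + w i = ((lam + lam⁻¹ : ℝ) : ℂ) * w (i + 1)) (i : ℕ) :
    w i = w 0 * ((lam⁻¹ ^ i : ℝ) : ℂ) := by
  have hl0 : (lam : ℂ) ≠ 0 := by exact_mod_cast (by linarith : lam ≠ 0)
  have hd : ∀ i, w (i + 1) - ((lam⁻¹ : ℝ) : ℂ) * w i
      = ((lam ^ i : ℝ) : ℂ) * (w 1 - ((lam⁻¹ : ℝ) : ℂ) * w 0) := by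
    intro i
    induction i with
    | zero => simp
    | succ i ih =>
      have h1 := h i
      have e : w (i + 1 + 1) - ((lam⁻¹ : ℝ) : ℂ) * w (i + 1)
          = (lam : ℂ) * (w (i + 1) - ((lam⁻¹ : ℝ) : ℂ) * w i) := by
        push_cast at h1 ⊢
        have : (lam : ℂ) * ((lam : ℂ)⁻¹) = 1 := mul_inv_cancel₀ hl0
        linear_combination h1 + w i * this
      rw [e, ih]
      push_cast
      ring
  have hz : w 1 - ((lam⁻¹ : ℝ) : ℂ) * w 0 = 0 := by
    by_contra hne
    have hpos : 0 < ‖w 1 - ((lam⁻¹ : ℝ) : ℂ) * w 0‖ := norm_pos_iff.2 hne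
    have hM0 : 0 ≤ M := (norm_nonneg _).trans (hM 0)
    obtain ⟨i, hi⟩ := pow_unbounded_of_one_lt (2 * M / ‖w 1 - ((lam⁻¹ : ℝ) : ℂ) * w 0‖) hl
    rw [div_lt_iff₀ hpos] at hi
    have h1 := congrArg norm (hd i)
    rw [norm_mul, Complex.norm_real, Real.norm_eq_abs, abs_of_pos (by positivity)] at h1
    have h2 := norm_sub_le (w (i + 1)) (((lam⁻¹ : ℝ) : ℂ) * w i)
    rw [norm_mul, Complex.norm_real, Real.norm_eq_abs, abs_of_pos (by positivity)] at h2
    have h3 : lam⁻¹ * ‖w i‖ ≤ 1 * M :=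
      mul_le_mul (inv_le_one_of_one_le₀ hl.le) (hM i) (norm_nonneg _) zero_le_one
    have h4 := hM (i + 1)
    linarith
  induction i with
  | zero => simp
  | succ i ih =>
    have := hd i
    rw [hz, mul_zero, sub_eq_zero, ih] at this
    rw [this]
    push_cast
    ring

section

variable {n : ℕ} {lam : ℝ} {b v : ℤ → ℝ}

/-- A bounded solution decays exponentially at `-∞`. -/
theorem SolvesRec.left {p : ℤ → ℂ} (hl : 1 < lam) (hb1 : ∀ j ∉ Finset.Icc (1 : ℤ) n, b j = 1)
    (hv : ∀ j ∉ Finset.Icc (1 : ℤ) n, v j = 0) (hp : SolvesRec lam b v p) {M : ℝ}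
    (hM : ∀ j, ‖p j‖ ≤ M) (i : ℕ) : p (1 - i) = p 1 * ((lam⁻¹ ^ i : ℝ) : ℂ) := by
  have h := eq_mul_pow_of_bounded (w := fun i => p (1 - i)) hl (fun i => hM _) (fun i => by
    have h1 := hp (-i)
    rw [hb1 _ (fun hh => by have := Finset.mem_Icc.1 hh; omega),
      hb1 _ (fun hh => by have := Finset.mem_Icc.1 hh; omega),
      hv _ (fun hh => by have := Finset.mem_Icc.1 hh; omega)] at h1
    simp only [map_one, one_mul, add_zero, Complex.coe_algebraMap] at h1
    push_cast at h1 ⊢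
    rw [show (1 : ℤ) - (i + 2) = -i - 1 by ring, show (1 : ℤ) - (i + 1) = -i by ring,
      show (1 : ℤ) - i = -i + 1 by ring, ← h1]
    ring) i
  simpa using h

/-- A bounded solution decays exponentially at `∞`. -/
theorem SolvesRec.right {p : ℤ → ℂ} (hl : 1 < lam) (hb1 : ∀ j ∉ Finset.Icc (1 : ℤ) n, b j = 1)
    (hv : ∀ j ∉ Finset.Icc (1 : ℤ) n, v j = 0) (hp : SolvesRec lam b v p) {M : ℝ}
    (hM : ∀ j, ‖p j‖ ≤ M) (i : ℕ) : p (n + 1 + i) = p (n + 1) * ((lam⁻¹ ^ i : ℝ) : ℂ) := by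
  have h := eq_mul_pow_of_bounded (w := fun i => p (n + 1 + i)) hl (fun i => hM _) (fun i => by
    have h1 := hp (n + 1 + (i + 1))
    rw [hb1 _ (fun hh => by have := Finset.mem_Icc.1 hh; omega),
      hb1 _ (fun hh => by have := Finset.mem_Icc.1 hh; omega),
      hv _ (fun hh => by have := Finset.mem_Icc.1 hh; omega)] at h1
    simp only [map_one, one_mul, add_zero, Complex.coe_algebraMap] at h1
    push_cast at h1 ⊢
    rw [show (n : ℤ) + 1 + (i + 2) = n + 1 + (i + 1) + 1 by ring,
      show (n : ℤ) + 1 + i = n + 1 + (i + 1) - 1 by ring, ← h1]) i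
  simpa using h

/-- A bounded solution is determined by its value at `0`. -/
theorem SolvesRec.eq_zero {p : ℤ → ℂ} (hl : 1 < lam) (hb : ∀ j, 0 < b j)
    (hb1 : ∀ j ∉ Finset.Icc (1 : ℤ) n, b j = 1)
    (hv : ∀ j ∉ Finset.Icc (1 : ℤ) n, v j = 0) (hp : SolvesRec lam b v p) {M : ℝ}
    (hM : ∀ j, ‖p j‖ ≤ M) (h0 : p 0 = 0) (j : ℤ) : p j = 0 := by
  have hl0 : (lam : ℂ) ≠ 0 := by exact_mod_cast (by linarith : lam ≠ 0)
  have hleft := hp.left hl hb1 hv hM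
  have h1 : p 1 = 0 := by
    have := hleft 1
    rw [Nat.cast_one, sub_self, h0] at this
    simpa [hl0] using this.symm
  have hpos : ∀ k : ℕ, p k = 0 ∧ p (k + 1) = 0 := by
    intro k
    induction k with
    | zero => exact ⟨by simpa using h0, by simpa using h1⟩
    | succ k ih =>
      refine ⟨by push_cast; exact ih.2, ?_⟩
      have h2 := hp (k + 1)
      rw [add_sub_cancel_right, ih.1, ih.2, mul_zero, mul_zero, add_zero] at h2
      have hbc : algebraMap ℝ ℂ (b (k + 1)) ≠ 0 := by
        rw [Complex.coe_algebraMap]; exact_mod_cast (hb _).ne'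
      push_cast
      exact (mul_eq_zero.1 h2).resolve_left hbc
  rcases le_total 0 j with hj | hj
  · obtain ⟨k, rfl⟩ := Int.eq_ofNat_of_zero_le hj
    exact (hpos k).1
  · obtain ⟨k, hk⟩ := Int.eq_ofNat_of_zero_le (show 0 ≤ 1 - j by omega)
    have := hleft k
    rw [h1, zero_mul, ← hk, sub_sub_cancel] at this
    exact this

/-- If the difference equation has a nonzero bounded solution, then the ratios match. -/
theorem SolvesRec.ratio_eq {p : ℤ → ℂ} (hl : 1 < lam) (hb : ∀ j, 0 < b j)
    (hb1 : ∀ j ∉ Finset.Icc (1 : ℤ) n, b j = 1)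
    (hv : ∀ j ∉ Finset.Icc (1 : ℤ) n, v j = 0) (hp : SolvesRec lam b v p) {M : ℝ}
    (hM : ∀ j, ‖p j‖ ≤ M) (h0 : p 0 ≠ 0) (hr : ∀ j ≤ n, 0 < ratio lam b v j) :
    ratio lam b v (n + 1) = lam⁻¹ := by
  have hl0 : (lam : ℂ) ≠ 0 := by exact_mod_cast (by linarith : lam ≠ 0)
  have key : ∀ k : ℕ, k ≤ n + 1 → p k ≠ 0 ∧
      (b k : ℂ) * p (k + 1) = (ratio lam b v k : ℂ) * p k := by
    intro k
    induction k with
    | zero =>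
      intro _
      refine ⟨by simpa using h0, ?_⟩
      have h1 := hp.left hl hb1 hv hM 1
      rw [Nat.cast_one, sub_self] at h1
      rw [Nat.cast_zero, hb1 0 (by simp), zero_add, h1, ratio]
      push_cast
      field_simp
    | succ k ih =>
      intro hk
      obtain ⟨i1, i2⟩ := ih (by omega)
      have hrk : (ratio lam b v k : ℂ) ≠ 0 := by exact_mod_cast (hr k (by omega)).ne'
      have hbk : (b k : ℂ) ≠ 0 := by exact_mod_cast (hb k).ne'
      have hne : p (k + 1) ≠ 0 := by
        intro h
        rw [h, mul_zero] at i2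
        exact (mul_ne_zero hrk i1) i2.symm
      refine ⟨by push_cast; exact hne, ?_⟩
      have h2 := hp (k + 1)
      rw [add_sub_cancel_right] at h2
      simp only [Complex.coe_algebraMap] at h2
      have e : p k = (b k : ℂ) * p (k + 1) / ratio lam b v k := by
        rw [eq_div_iff hrk, i2]; ring
      rw [e] at h2
      rw [ratio]
      push_cast at h2 ⊢
      linear_combination h2
  -- As b_{n+1} = 1, the ratio at n + 1 is p_{n+2}/p_{n+1}, which decay at +∞ fixes as λ^{-1}.
  obtain ⟨k1, k2⟩ := key (n + 1) le_rfl
  have h3 := hp.right hl hb1 hv hM 1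
  rw [hb1 _ (fun hh => by have := Finset.mem_Icc.1 hh; push_cast at this; omega)] at k2
  push_cast at k1 k2 h3
  rw [h3, one_mul, mul_comm, pow_one] at k2
  have := mul_right_cancel₀ k1 k2
  exact_mod_cast this.symm

/-! ### The positive square-summable solution -/

/-- The solution decaying at `-∞`, on the nonnegative half-line. -/
def profileNat (lam : ℝ) (b v : ℤ → ℝ) : ℕ → ℝ
  | 0 => 1
  | j + 1 => profileNat lam b v j * ratio lam b v j / b j

/-- The solution decaying at `-∞`. -/
def profile (lam : ℝ) (b v : ℤ → ℝ) (j : ℤ) : ℝ :=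
  if 0 ≤ j then profileNat lam b v j.toNat else lam ^ j

theorem profile_natCast (k : ℕ) : profile lam b v k = profileNat lam b v k := by
  simp [profile]

theorem profile_of_le_one (hb0 : b 0 = 1) {j : ℤ} (hj : j ≤ 1) : profile lam b v j = lam ^ j := by
  rcases lt_or_ge j 0 with h | h
  · simp [profile, h]
  · obtain rfl | rfl : j = 0 ∨ j = 1 := by omega
    · simp [profile, profileNat]
    · simp [profile, profileNat, ratio, hb0]

/-- λ^{-1} is a fixed point of the unperturbed Riccati map r ↦ λ + λ^{-1} - 1/r. -/
theorem ratio_tail (hb1 : ∀ j ∉ Finset.Icc (1 : ℤ) n, b j = 1)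
    (hv : ∀ j ∉ Finset.Icc (1 : ℤ) n, v j = 0) (hr : ratio lam b v (n + 1) = lam⁻¹) (i : ℕ) :
    ratio lam b v (n + 1 + i) = lam⁻¹ := by
  induction i with
  | zero => exact hr
  | succ i ih =>
    rw [← add_assoc, ratio, ih, hb1 _ (fun hh => by
      have := Finset.mem_Icc.1 hh; push_cast at this; omega), hv _ (fun hh => by
      have := Finset.mem_Icc.1 hh; push_cast at this; omega)]
    simp

theorem ratio_pos (hl : 1 < lam) (hb1 : ∀ j ∉ Finset.Icc (1 : ℤ) n, b j = 1)
    (hv : ∀ j ∉ Finset.Icc (1 : ℤ) n, v j = 0) (hr : ratio lam b v (n + 1) = lam⁻¹)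
    (hr0 : ∀ j ≤ n, 0 < ratio lam b v j) (j : ℕ) : 0 < ratio lam b v j := by
  rcases le_or_gt j n with h | h
  · exact hr0 j h
  · obtain ⟨i, rfl⟩ := Nat.exists_eq_add_of_le (show n + 1 ≤ j by omega)
    rw [ratio_tail hb1 hv hr]
    positivity

theorem profile_pos (hl : 1 < lam) (hb : ∀ j, 0 < b j) (hr : ∀ j, 0 < ratio lam b v j) (j : ℤ) :
    0 < profile lam b v j := by
  have hn : ∀ k, 0 < profileNat lam b v k := by
    intro k
    induction k with
    | zero => exact one_pos
    | succ k ih => exact div_pos (mul_pos ih (hr k)) (hb _)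
  unfold profile
  split_ifs
  · exact hn _
  · positivity

theorem profile_solvesRec (hl : 1 < lam) (hb : ∀ j, 0 < b j)
    (hb1 : ∀ j ∉ Finset.Icc (1 : ℤ) n, b j = 1)
    (hv : ∀ j ∉ Finset.Icc (1 : ℤ) n, v j = 0) (hr : ∀ j, 0 < ratio lam b v j) :
    SolvesRec lam b v (profile lam b v) := by
  have hl0 : lam ≠ 0 := by linarith
  have hb0 : b 0 = 1 := hb1 0 (by simp)
  intro j
  simp only [Algebra.algebraMap_self, RingHom.id_apply]
  rcases le_or_gt j 0 with hj | hj
  · rw [profile_of_le_one hb0 (by omega), profile_of_le_one hb0 (by omega),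
      profile_of_le_one hb0 (by omega), hv j (fun hh => by have := Finset.mem_Icc.1 hh; omega),
      hb1 j (fun hh => by have := Finset.mem_Icc.1 hh; omega),
      hb1 (j - 1) (fun hh => by have := Finset.mem_Icc.1 hh; omega), zpow_add_one₀ hl0,
      zpow_sub_one₀ hl0]
    ring
  · obtain ⟨k, rfl⟩ : ∃ k : ℕ, j = k + 1 := ⟨(j - 1).toNat, by omega⟩
    have e1 : profile lam b v ((k : ℤ) + 1 + 1) = profileNat lam b v (k + 2) := by
      rw [← profile_natCast]; push_cast; congr 1
    have e2 : profile lam b v ((k : ℤ) + 1) = profileNat lam b v (k + 1) := by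
      rw [← profile_natCast]; push_cast; congr 1
    have hrk := (hr k).ne'
    have hrk1 := (hr (k + 1)).ne'
    have hbk := (hb k).ne'
    have hbk1 := (hb (k + 1)).ne'
    rw [add_sub_cancel_right, e1, e2, profile_natCast]
    simp only [profileNat]
    rw [ratio]
    push_cast
    field_simp
    ring

/-- The quotient b_j P_{j+1}/P_j is λ for j < 0 and the ratio r_j for j ≥ 0. A bound κ close to 1 is
what keeps the level t of `exists_quot_eq` inside (-1, 1). -/
theorem profile_succ_le (hl : 1 < lam) (hb : ∀ j, 0 < b j)
    (hb1 : ∀ j ∉ Finset.Icc (1 : ℤ) n, b j = 1)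
    (hr : ∀ j, 0 < ratio lam b v j) {κ : ℝ} (hκ : lam ≤ κ)
    (hrκ : ∀ j, ratio lam b v j ≤ κ) (j : ℤ) :
    b j * profile lam b v (j + 1) ≤ κ * profile lam b v j := by
  have hl0 : lam ≠ 0 := by linarith
  have hb0 : b 0 = 1 := hb1 0 (by simp)
  have hpos := profile_pos hl hb hr j
  rcases lt_or_ge j 0 with hj | hj
  · rw [profile_of_le_one hb0 (show j + 1 ≤ 1 by omega), zpow_add_one₀ hl0,
      hb1 j (fun hh => by have := Finset.mem_Icc.1 hh; omega), one_mul,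
      ← profile_of_le_one (v := v) hb0 (show j ≤ 1 by omega), mul_comm]
    gcongr
  · obtain ⟨k, rfl⟩ := Int.eq_ofNat_of_zero_le hj
    have e1 : profile lam b v ((k : ℤ) + 1) = profileNat lam b v (k + 1) := by
      rw [← profile_natCast]; push_cast; rfl
    rw [e1, profileNat, mul_div_cancel₀ _ (hb k).ne', ← profile_natCast, mul_comm]
    exact mul_le_mul_of_nonneg_right (hrκ k) hpos.le

theorem profile_summable (hl : 1 < lam) (hb1 : ∀ j ∉ Finset.Icc (1 : ℤ) n, b j = 1)
    (hv : ∀ j ∉ Finset.Icc (1 : ℤ) n, v j = 0) (hr : ratio lam b v (n + 1) = lam⁻¹) :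
    Summable fun j => profile lam b v j ^ 2 := by
  have hb0 : b 0 = 1 := hb1 0 (by simp)
  have hgeo : Summable fun i : ℕ => ((lam⁻¹) ^ 2) ^ i := by
    apply summable_geometric_of_lt_one (by positivity)
    rw [sq_lt_one_iff₀ (by positivity)]
    exact inv_lt_one_of_one_lt₀ hl
  refine Summable.of_nat_of_neg ?_ ?_
  · rw [← summable_nat_add_iff (n + 1)]
    have e : ∀ i : ℕ, profileNat lam b v (n + 1 + i) = profileNat lam b v (n + 1) * lam⁻¹ ^ i := by
      intro i
      induction i with
      | zero => simp
      | succ i ih =>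
        rw [← add_assoc, profileNat, ih, ratio_tail hb1 hv hr, hb1 _ (fun hh => by
          have := Finset.mem_Icc.1 hh; push_cast at this; omega)]
        ring
    refine (hgeo.mul_left (profileNat lam b v (n + 1) ^ 2)).congr fun i => ?_
    rw [profile_natCast, add_comm i, e, mul_pow]
    ring
  · refine hgeo.congr fun i => ?_
    rw [profile_of_le_one hb0 (by omega), zpow_neg, zpow_natCast, ← inv_pow]
    ring

end

/-! ### Elimination of the coupling constants -/

/-- Two positive square-summable solutions belonging to different energies yield an equation for
the energies from which the coupling constants have disappeared. -/
theorem exists_quot_eq {b β P P' D D' : ℤ → ℝ} {a ω c c' s s' κ : ℝ} (hb : ∀ j, 0 < b j)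
    (hP : ∀ j, 0 < P j) (hP' : ∀ j, 0 < P' j) (sP : Summable fun j => P j ^ 2)
    (sP' : Summable fun j => P' j ^ 2)
    (hκ : ∀ j, b j * P (j + 1) ≤ κ * P j) (hκ' : ∀ j, b j * P' (j + 1) ≤ κ * P' j)
    (hrec : ∀ j, b j * P (j + 1) + b (j - 1) * P (j - 1) = D j * P j)
    (hrec' : ∀ j, b j * P' (j + 1) + b (j - 1) * P' (j - 1) = D' j * P' j)
    (hD : ∀ j, ω * a * D j = 2 * c + s * β j / 2) (hD' : ∀ j, ω * a * D' j = 2 * c' + s' * β j / 2)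
    (hω : |ω| = 1) (haκ : |a| * κ < 1) (hs : s ≠ 0) (hs' : s' ≠ 0) :
    ∃ t, |t| < 1 ∧ (c - t) / s = (c' - t) / s' := by
  have sQ : Summable fun j => P j * P' j :=
    Summable.of_nonneg_of_le (fun j => (mul_pos (hP j) (hP' j)).le)
      (fun j => by nlinarith [sq_nonneg (P j - P' j)]) (sP.add sP')
  set Q := ∑' j, P j * P' j with hQ
  have hQ0 : 0 < Q := sQ.tsum_pos (fun j => (mul_pos (hP j) (hP' j)).le) 0
    (mul_pos (hP 0) (hP' 0))
  have sM1 : Summable fun j => b j * P (j + 1) * P' j :=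
    Summable.of_nonneg_of_le (fun j => mul_nonneg (mul_pos (hb j) (hP _)).le (hP' j).le)
      (fun j => mul_le_mul_of_nonneg_right (hκ j) (hP' j).le)
      ((sQ.mul_left κ).congr fun j => by ring)
  have sM2 : Summable fun j => b j * P' (j + 1) * P j :=
    Summable.of_nonneg_of_le (fun j => mul_nonneg (mul_pos (hb j) (hP' _)).le (hP j).le)
      (fun j => mul_le_mul_of_nonneg_right (hκ' j) (hP j).le)
      ((sQ.mul_left κ).congr fun j => by ring)
  set M₁ := ∑' j, b j * P (j + 1) * P' j with hM₁
  set M₂ := ∑' j, b j * P' (j + 1) * P j with hM₂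
  -- The recurrence of P summed against P', with one term shifted by one site. By symmetry of the
  -- Jacobi operator the recurrence of P' summed against P gives the same value M₁ + M₂.
  have h1 : HasSum (fun j => D j * (P j * P' j)) (M₁ + M₂) := by
    have hh := sM1.hasSum.add (hasSum_shift sM2.hasSum (-1))
    refine hh.congr_fun fun j => ?_
    have := hrec j
    rw [← sub_eq_add_neg, sub_add_cancel]
    linear_combination (-P' j) * this
  have h2 : HasSum (fun j => D' j * (P j * P' j)) (M₁ + M₂) := by
    have hh := (hasSum_shift sM1.hasSum (-1)).add sM2.hasSum
    refine hh.congr_fun fun j => ?_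
    have := hrec' j
    rw [← sub_eq_add_neg, sub_add_cancel]
    linear_combination (-P j) * this
  have hM0 : 0 ≤ M₁ + M₂ := add_nonneg
    (tsum_nonneg fun j => mul_nonneg (mul_pos (hb j) (hP _)).le (hP' j).le)
    (tsum_nonneg fun j => mul_nonneg (mul_pos (hb j) (hP' _)).le (hP j).le)
  have hMle : M₁ + M₂ ≤ 2 * κ * Q := by
    have k1 := hasSum_le (L := SummationFilter.unconditional ℤ)
      (fun j => mul_le_mul_of_nonneg_right (hκ j) (hP' j).le) sM1.hasSum
      ((sQ.hasSum.mul_left κ).congr_fun fun j => by ring)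
    have k2 := hasSum_le (L := SummationFilter.unconditional ℤ)
      (fun j => mul_le_mul_of_nonneg_right (hκ' j) (hP j).le) sM2.hasSum
      ((sQ.hasSum.mul_left κ).congr_fun fun j => by ring)
    linarith
  -- Either energy determines ∑ β_j P_j P'_j; equating the two results removes β.
  have key : ∀ {D : ℤ → ℝ} {c s : ℝ}, HasSum (fun j => D j * (P j * P' j)) (M₁ + M₂) →
      (∀ j, ω * a * D j = 2 * c + s * β j / 2) → s ≠ 0 →
      HasSum (fun j => β j * (P j * P' j)) (2 / s * (ω * a * (M₁ + M₂) - 2 * c * Q)) := by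
    intro D c s h hD hs
    refine (((h.mul_left (ω * a)).sub (sQ.hasSum.mul_left (2 * c))).mul_left
      (2 / s)).congr_fun fun j => ?_
    have := hD j
    field_simp
    linear_combination (-2 * (P j * P' j)) * this
  have hB := (key h1 hD hs).unique (key h2 hD' hs')
  refine ⟨ω * a * (M₁ + M₂) / (2 * Q), ?_, ?_⟩
  · rw [abs_div, abs_mul (ω * a), abs_mul ω a, hω, one_mul, abs_of_nonneg hM0,
      abs_of_pos (show 0 < 2 * Q by positivity),
      div_lt_one (by positivity)]
    have := mul_le_mul_of_nonneg_left hMle (abs_nonneg a)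
    have h3 := mul_lt_mul_of_pos_right haκ (show 0 < 2 * Q by positivity)
    linarith
  · have e : ∀ {c s : ℝ}, s ≠ 0 → (c - ω * a * (M₁ + M₂) / (2 * Q)) / s
        = -(2 / s * (ω * a * (M₁ + M₂) - 2 * c * Q)) / (4 * Q) := by
      intro c s hs
      field_simp
      ring
    rw [e hs, e hs', hB]

/-! ### Eigenvalues in the gaps -/

theorem isEigenvalue_iff {A β : ℤ → ℝ} {E : ℝ} :
    IsEigenvalue (laplacian A β) E ↔ ∃ u : ChainL2, u ≠ 0 ∧ (u, (E : ℂ) • u) ∈ laplacianGraph A β := by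
  rw [IsEigenvalue, Submodule.ne_bot_iff]
  constructor
  · rintro ⟨y, hy, hne⟩
    refine ⟨y, fun h => hne (Subtype.ext h), mem_laplacian_graph_iff.2 ⟨y, rfl, ?_⟩⟩
    rw [eigenspace, LinearMap.mem_ker] at hy
    exact sub_eq_zero.1 hy
  · rintro ⟨u, hne, hu⟩
    obtain ⟨y, rfl, hy⟩ := mem_laplacian_graph_iff.1 hu
    refine ⟨y, ?_, fun h => hne (by rw [h]; rfl)⟩
    rw [eigenspace, LinearMap.mem_ker]
    exact sub_eq_zero.2 hy

/-- The off-diagonal coefficients of the difference equation. -/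
def offDiag (A : ℤ → ℝ) (A₀ : ℝ) (j : ℤ) : ℝ :=
  Real.cos (A j * Real.pi) / Real.cos (A₀ * Real.pi)

/-- The diagonal perturbation in the difference equation. -/
def diagPert (β : ℤ → ℝ) (A₀ α ω E : ℝ) (j : ℤ) : ℝ :=
  ω * sPi E * (β j - α) / (2 * Real.cos (A₀ * Real.pi))

section

variable {A β : ℤ → ℝ} {A₀ α E ω lam : ℝ} {n : ℕ}

/-- The vertex values of an eigenfunction, up to alternating signs, solve the difference
equation. -/
theorem Realizes.solvesRec {u : ChainL2} {f f' f'' : ℤ → Bool → ℝ → ℂ}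
    (H : Realizes A β u ((E : ℂ) • u) f f' f'') (ha : Real.cos (A₀ * Real.pi) ≠ 0)
    (hω : ω ^ 2 = 1) (hlam : lam + lam⁻¹ = 2 * ω * eta α E / Real.cos (A₀ * Real.pi)) :
    SolvesRec lam (offDiag A A₀) (diagPert β A₀ α ω E) (fun j => (ω : ℂ) ^ j * f j true 0) := by
  obtain ⟨K, -, hrec⟩ := exists_recurrence_bound E
  intro j
  have h := hrec A β u _ f f' f'' H j
  simp only [sub_self, lp.coeFn_zero, Pi.zero_apply, norm_zero, add_zero, mul_zero] at h
  have h0 := norm_le_zero_iff.1 h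
  have hω0 : (ω : ℂ) ≠ 0 := by
    intro h; have : ω = 0 := by exact_mod_cast h
    rw [this] at hω; norm_num at hω
  have hω2 : (ω : ℂ) ^ 2 = 1 := by exact_mod_cast hω
  have hωinv : (ω : ℂ)⁻¹ = ω := by
    field_simp; exact hω2.symm
  set a := Real.cos (A₀ * Real.pi) with hadef
  have ha' : (a : ℂ) ≠ 0 := by exact_mod_cast ha
  rw [hlam]
  simp only [Complex.coe_algebraMap, offDiag, diagPert, ← hadef, eta]
  rw [zpow_add_one₀ hω0, zpow_sub_one₀ hω0, hωinv]
  push_cast at h0 ⊢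
  linear_combination (ω : ℂ) ^ j * ω * (a : ℂ)⁻¹ / 2 * h0

theorem Realizes.exists_vertex_le {u h : ChainL2} {f f' f'' : ℤ → Bool → ℝ → ℂ}
    (H : Realizes A β u h f f' f'') : ∃ M, ∀ j, ‖f j true 0‖ ≤ M := by
  refine ⟨√(∑' j, ‖f j true 0‖ ^ 2), fun j => Real.le_sqrt_of_sq_le ?_⟩
  exact H.summable_vertex_sq.le_tsum j fun i _ => sq_nonneg _

theorem offDiag_eq_one (hA : ∀ j ∉ Finset.Icc (1 : ℤ) n, A j = A₀)
    (ha : Real.cos (A₀ * Real.pi) ≠ 0) : ∀ j ∉ Finset.Icc (1 : ℤ) n, offDiag A A₀ j = 1 :=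
  fun j hj => by rw [offDiag, hA j hj, div_self ha]

theorem diagPert_eq_zero (hβ : ∀ j ∉ Finset.Icc (1 : ℤ) n, β j = α) :
    ∀ j ∉ Finset.Icc (1 : ℤ) n, diagPert β A₀ α ω E j = 0 :=
  fun j hj => by rw [diagPert, hβ j hj, sub_self, mul_zero, zero_div]

theorem norm_zpow_sign (hω : ω ^ 2 = 1) (j : ℤ) : ‖(ω : ℂ) ^ j‖ = 1 := by
  have : ‖(ω : ℂ)‖ = 1 := by
    rw [Complex.norm_real, Real.norm_eq_abs, ← sq_eq_sq₀ (abs_nonneg _) zero_le_one, sq_abs, hω,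
      one_pow]
  rw [norm_zpow, this, one_zpow]

/-- An eigenfunction in a gap is determined by its value at one vertex. -/
theorem Realizes.eq_zero_of_vertex {u : ChainL2} {f f' f'' : ℤ → Bool → ℝ → ℂ}
    (H : Realizes A β u ((E : ℂ) • u) f f' f'') (ha : Real.cos (A₀ * Real.pi) ≠ 0)
    (hA : ∀ j ∉ Finset.Icc (1 : ℤ) n, A j = A₀) (hβ : ∀ j ∉ Finset.Icc (1 : ℤ) n, β j = α)
    (hE : sPi E ≠ 0) (hω : ω ^ 2 = 1) (hl : 1 < lam)
    (hlam : lam + lam⁻¹ = 2 * ω * eta α E / Real.cos (A₀ * Real.pi))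
    (hb : ∀ j, 0 < offDiag A A₀ j) (h0 : f 0 true 0 = 0) : u = 0 := by
  obtain ⟨M, hM⟩ := H.exists_vertex_le
  have hs := H.solvesRec ha hω hlam
  have hz : ∀ j, (ω : ℂ) ^ j * f j true 0 = 0 :=
    hs.eq_zero hl hb (offDiag_eq_one hA ha) (diagPert_eq_zero hβ) (M := M)
      (fun j => by rw [norm_mul, norm_zpow_sign hω, one_mul]; exact hM j) (by simp [h0])
  have hz' : ∀ j, f j true 0 = 0 := fun j => by
    refine (mul_eq_zero.1 (hz j)).resolve_left fun h => ?_
    have := norm_zpow_sign hω j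
    rw [h, norm_zero] at this
    exact zero_ne_one this
  obtain ⟨K, -, hedge⟩ := exists_edge_bound hE
  apply lp.ext
  funext ⟨j, s⟩
  have := hedge A β u _ f f' f'' H j s
  simp only [sub_self, lp.coeFn_zero, Pi.zero_apply, norm_zero, add_zero, mul_zero, hz'] at this
  exact norm_le_zero_iff.1 this

/-- For an eigenfunction the residual is zero, so ⟨Φ, w⟩ = 0 makes the vertex value at 0 vanish and
hence w itself. The eigenspace thus embeds into ℂ. -/
theorem IsEigenvalue.isSimpleEigenvalue (h : IsEigenvalue (laplacian A β) E)
    (ha : Real.cos (A₀ * Real.pi) ≠ 0)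
    (hA : ∀ j ∉ Finset.Icc (1 : ℤ) n, A j = A₀) (hβ : ∀ j ∉ Finset.Icc (1 : ℤ) n, β j = α)
    (hE : sPi E ≠ 0) (hω : ω ^ 2 = 1) (hl : 1 < lam)
    (hlam : lam + lam⁻¹ = 2 * ω * eta α E / Real.cos (A₀ * Real.pi))
    (hb : ∀ j, 0 < offDiag A A₀ j) : IsSimpleEigenvalue (laplacian A β) E := by
  obtain ⟨Φ, K, hΦ⟩ := exists_vertex_functional A E 0 true
  have hinj : ∀ w ∈ eigenspace (laplacian A β) E,
      inner ℂ Φ (w : ChainL2) = 0 → w = 0 := by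
    intro w hw hz
    have hT : laplacian A β w = (E : ℂ) • (w : ChainL2) := by
      rw [eigenspace, LinearMap.mem_ker] at hw
      exact sub_eq_zero.1 hw
    obtain ⟨f, f', f'', H⟩ := mem_laplacianGraph_iff.1 (mem_laplacian_graph_iff.2 ⟨w, rfl, hT⟩)
    have := hΦ β _ _ f f' f'' H
    rw [hz, sub_self] at this
    simp only [lp.coeFn_zero, Pi.zero_apply, norm_zero, add_zero, mul_zero] at this
    exact Subtype.ext (H.eq_zero_of_vertex ha hA hβ hE hω hl hlam hb (norm_le_zero_iff.1 this))
  obtain ⟨y, hy, hne⟩ := (Submodule.ne_bot_iff _).1 h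
  have hy0 : inner ℂ Φ (y : ChainL2) ≠ 0 := fun hz => hne (hinj y hy hz)
  rw [IsSimpleEigenvalue, finrank_eq_one_iff_of_nonzero' (⟨y, hy⟩ : eigenspace (laplacian A β) E)
    (fun h => hne (congrArg Subtype.val h))]
  rintro ⟨w, hw⟩
  refine ⟨inner ℂ Φ (w : ChainL2) / inner ℂ Φ (y : ChainL2), ?_⟩
  apply Subtype.ext
  have hmem := Submodule.sub_mem _ (Submodule.smul_mem _
    (inner ℂ Φ (w : ChainL2) / inner ℂ Φ (y : ChainL2)) hy) hw
  have := hinj _ hmem (by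
    push_cast
    rw [inner_sub_right, inner_smul_right, div_mul_cancel₀ _ hy0, sub_self])
  exact sub_eq_zero.1 this

theorem IsEigenvalue.ratio_eq (h : IsEigenvalue (laplacian A β) E)
    (ha : Real.cos (A₀ * Real.pi) ≠ 0)
    (hA : ∀ j ∉ Finset.Icc (1 : ℤ) n, A j = A₀) (hβ : ∀ j ∉ Finset.Icc (1 : ℤ) n, β j = α)
    (hE : sPi E ≠ 0) (hω : ω ^ 2 = 1) (hl : 1 < lam)
    (hlam : lam + lam⁻¹ = 2 * ω * eta α E / Real.cos (A₀ * Real.pi))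
    (hb : ∀ j, 0 < offDiag A A₀ j)
    (hr : ∀ j ≤ n, 0 < ratio lam (offDiag A A₀) (diagPert β A₀ α ω E) j) :
    ratio lam (offDiag A A₀) (diagPert β A₀ α ω E) (n + 1) = lam⁻¹ := by
  obtain ⟨u, hne, hu⟩ := isEigenvalue_iff.1 h
  obtain ⟨f, f', f'', H⟩ := mem_laplacianGraph_iff.1 hu
  obtain ⟨M, hM⟩ := H.exists_vertex_le
  refine (H.solvesRec ha hω hlam).ratio_eq hl hb (offDiag_eq_one hA ha) (diagPert_eq_zero hβ)
    (M := M) (fun j => by rw [norm_mul, norm_zpow_sign hω, one_mul]; exact hM j) ?_ hr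
  rw [zpow_zero, one_mul]
  exact fun h0 => hne (H.eq_zero_of_vertex ha hA hβ hE hω hl hlam hb h0)

/-- The converse of `IsEigenvalue.ratio_eq`: the positive profile, with the signs ω^j restored,
serves as vertex values and is interpolated on each edge by the solution of y'' = -Ey. The result is
nonzero as its value at vertex 0 is. -/
theorem isEigenvalue_of_ratio_eq
    (ha : Real.cos (A₀ * Real.pi) ≠ 0)
    (hA : ∀ j ∉ Finset.Icc (1 : ℤ) n, A j = A₀) (hβ : ∀ j ∉ Finset.Icc (1 : ℤ) n, β j = α)
    (hE : sPi E ≠ 0) (hω : ω ^ 2 = 1) (hl : 1 < lam)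
    (hlam : lam + lam⁻¹ = 2 * ω * eta α E / Real.cos (A₀ * Real.pi))
    (hb : ∀ j, 0 < offDiag A A₀ j)
    (hr : ∀ j ≤ n, 0 < ratio lam (offDiag A A₀) (diagPert β A₀ α ω E) j)
    (heq : ratio lam (offDiag A A₀) (diagPert β A₀ α ω E) (n + 1) = lam⁻¹) :
    IsEigenvalue (laplacian A β) E := by
  set b := offDiag A A₀ with hbdef
  set v := diagPert β A₀ α ω E with hvdef
  have hb1 := offDiag_eq_one hA ha
  have hv0 : ∀ j ∉ Finset.Icc (1 : ℤ) n, v j = 0 := diagPert_eq_zero hβ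
  have hrpos := ratio_pos hl hb1 hv0 heq hr
  set P := profile lam b v with hP
  have hPpos := profile_pos hl hb hrpos
  have hPs := profile_summable hl hb1 hv0 heq
  have hPrec := profile_solvesRec hl hb hb1 hv0 hrpos
  set a := Real.cos (A₀ * Real.pi) with hadef
  have ha' : (a : ℂ) ≠ 0 := by exact_mod_cast ha
  have hsE : (sPi E : ℂ) ≠ 0 := by exact_mod_cast hE
  have hω0 : ω ≠ 0 := by
    intro h; rw [h] at hω; norm_num at hω
  have hω0' : (ω : ℂ) ≠ 0 := by exact_mod_cast hω0
  have hω2 : (ω : ℂ) ^ 2 = 1 := by exact_mod_cast hω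
  have hωinv : (ω : ℂ)⁻¹ = ω := by field_simp; exact hω2.symm
  set p : ℤ → ℂ := fun j => (ω : ℂ) ^ j * (P j : ℂ) with hp
  have hpn : ∀ j, ‖p j‖ = P j := fun j => by
    simp only [hp]
    rw [norm_mul, norm_zpow_sign hω, one_mul, Complex.norm_real, Real.norm_eq_abs,
      abs_of_pos (hPpos j)]
  have hprec : ∀ j, 2 * (Real.cos (A j * Real.pi) : ℂ) * p (j + 1)
      + 2 * (Real.cos (A (j - 1) * Real.pi) : ℂ) * p (j - 1)
      = (4 * cPi E + sPi E * β j) * p j := by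
    intro j
    have h := hPrec j
    simp only [Algebra.algebraMap_self, RingHom.id_apply] at h
    rw [hlam] at h
    have hc : ((b j * P (j + 1) + b (j - 1) * P (j - 1) : ℝ) : ℂ)
      = ((2 * ω * eta α E / a + v j) * P j : ℝ) := by rw [h]
    simp only [hbdef, hvdef, offDiag, diagPert, ← hadef, eta] at hc
    simp only [hp]
    rw [zpow_add_one₀ hω0', zpow_sub_one₀ hω0', hωinv]
    push_cast at hc ⊢
    have ha2 : (a : ℂ) * (a : ℂ)⁻¹ = 1 := mul_inv_cancel₀ ha'
    set C := Complex.cos (A j * Real.pi)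
    set C' := Complex.cos ((A (j - 1) : ℂ) * Real.pi)
    have hc' : C * P (j + 1) + C' * P (j - 1)
        = (2 * ω * (cPi E + α / 4 * sPi E) + ω * sPi E * (β j - α) / 2) * P j := by
      linear_combination (a : ℂ) * hc - (C * P (j + 1) + C' * P (j - 1)
        - (2 * ω * (cPi E + α / 4 * sPi E) + ω * sPi E * (β j - α) / 2) * P j) * ha2
    linear_combination 2 * (ω : ℂ) ^ j * ω * hc'
      + (4 * cPi E + sPi E * β j) * P j * (ω : ℂ) ^ j * hω2
  set X : ℤ → Bool → ℂ := fun j s => Complex.exp (potential A j s * Real.pi) with hX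
  have hXX : ∀ j, X j true * X j false = 1 := fun j => by
    simp only [hX]
    rw [← Complex.exp_add]
    simp [potential]
  have hXs : ∀ j, X j true + X j false = 2 * (Real.cos (A j * Real.pi) : ℂ) :=
    fun j => exp_potential_add A j Real.pi
  have hXn : ∀ j s, ‖X j s‖ = 1 := fun j s => norm_exp_potential_mul A j s Real.pi
  -- The initial slope that the prescribed values at both ends of the edge force; it exists because
  -- sPi E ≠ 0.
  set q : ℤ → Bool → ℂ := fun j s => (X j s * p (j + 1) - cPi E * p j) / sPi E with hq
  obtain ⟨K, hK, hKb⟩ := exists_solution_bound E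
  set R : ℝ := K + (1 + K) / |sPi E| * K with hR
  have hsabs : 0 < |sPi E| := abs_pos.2 hE
  have hbd : ∀ j s, ∀ t ∈ Icc (0 : ℝ) Real.pi,
      ‖p j * (cs E t : ℝ) + q j s * (sn E t : ℝ)‖ ≤ R * (P j + P (j + 1)) := by
    intro j s t ht
    have hq1 : ‖q j s‖ ≤ (1 + K) / |sPi E| * (P j + P (j + 1)) := by
      simp only [hq]
      rw [norm_div, Complex.norm_real, Real.norm_eq_abs, div_mul_eq_mul_div]
      apply div_le_div_of_nonneg_right _ hsabs.le
      refine (norm_sub_le _ _).trans ?_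
      rw [norm_mul (X j s), norm_mul (cPi E : ℂ), hXn, one_mul, hpn, hpn, Complex.norm_real]
      have h1 : ‖cPi E‖ * P j ≤ K * P j :=
        mul_le_mul_of_nonneg_right (hKb Real.pi ⟨Real.pi_pos.le, le_rfl⟩).1 (hPpos j).le
      have h2 := mul_pos hK (hPpos (j + 1))
      have h3 := hPpos j
      linarith
    refine (norm_add_le _ _).trans ?_
    rw [norm_mul (p j), norm_mul (q j s), hpn, Complex.norm_real, Complex.norm_real]
    have h1 : P j * ‖cs E t‖ ≤ P j * K :=
      mul_le_mul_of_nonneg_left (hKb t ht).1 (hPpos j).le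
    have h2 : ‖q j s‖ * ‖sn E t‖ ≤ (1 + K) / |sPi E| * (P j + P (j + 1)) * K :=
      mul_le_mul hq1 (hKb t ht).2.1 (norm_nonneg _)
        (mul_nonneg (by positivity) (add_pos (hPpos _) (hPpos _)).le)
    have h3 := mul_pos hK (hPpos (j + 1))
    rw [hR]
    linarith
  have hsumP : ∀ C : ℝ, Summable fun j => (C * (R * (P j + P (j + 1)))) ^ 2 := by
    intro C
    have s1 := hPs.add (hasSum_shift hPs.hasSum 1).summable
    refine Summable.of_nonneg_of_le (fun j => sq_nonneg _) (fun j => ?_)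
      (s1.mul_left (2 * (C * R) ^ 2))
    nlinarith [mul_nonneg (sq_nonneg (C * R)) (sq_nonneg (P j - P (j + 1)))]
  have e4 : (cPi E : ℂ) ^ 2 + E * (sPi E : ℂ) ^ 2 = 1 := by exact_mod_cast cPi_sq_add E
  have hyd' : ∀ j s, -(E : ℂ) * p j * sPi E + q j s * cPi E
      = (cPi E * X j s * p (j + 1) - p j) / sPi E := fun j s => by
    simp only [hq]
    rw [eq_div_iff hsE]
    field_simp
    linear_combination (-p j) * e4
  obtain ⟨u, h, f, f', f'', H, hf0, hu, hh⟩ := exists_realizes (A := A) (β := β)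
    (y := fun j s t => p j * (cs E t : ℝ) + q j s * (sn E t : ℝ))
    (y' := fun j s t => -(E : ℂ) * p j * (sn E t : ℝ) + q j s * (cs E t : ℝ))
    (y'' := fun j s t => -(E : ℂ) * (p j * (cs E t : ℝ) + q j s * (sn E t : ℝ)))
    (fun j s x => (((hasDerivAt_ofReal_cs E x).const_mul (p j)).add
      ((hasDerivAt_ofReal_sn E x).const_mul (q j s))).congr_deriv (by ring))
    (fun j s x => (((hasDerivAt_ofReal_sn E x).const_mul (-(E : ℂ) * p j)).add
      ((hasDerivAt_ofReal_cs E x).const_mul (q j s))).congr_deriv (by ring))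
    (fun j s => by have := continuous_sn E; have := continuous_cs E; fun_prop)
    (fun j => by simp)
    (fun j s => by
      have e : p j * (cs E Real.pi : ℝ) + q j s * (sn E Real.pi : ℝ)
        = p j * cPi E + q j s * sPi E := rfl
      simp only [e, cs_zero, sn_zero, Complex.ofReal_one, Complex.ofReal_zero, mul_one, mul_zero,
        add_zero]
      simp only [hq]
      rw [div_mul_cancel₀ _ hsE]
      ring)
    (fun j => by
      have e : ∀ i s, -(E : ℂ) * p i * (sn E Real.pi : ℝ) + q i s * (cs E Real.pi : ℝ)
        = (cPi E * X i s * p (i + 1) - p i) / sPi E := hyd'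
      simp only [e, cs_zero, sn_zero, Complex.ofReal_one, Complex.ofReal_zero, mul_one, mul_zero,
        add_zero, zero_add, sub_add_cancel]
      rw [show Complex.exp (potential A (j - 1) false * Real.pi) = X (j - 1) false from rfl,
        show Complex.exp (potential A (j - 1) true * Real.pi) = X (j - 1) true from rfl]
      have g1 := hprec j
      rw [← hXs, ← hXs] at g1
      have g2 := hXX (j - 1)
      simp only [hq]
      field_simp
      linear_combination g1 - 2 * cPi E * p j * g2)
    (b := fun j => 1 * (R * (P j + P (j + 1)))) (b' := fun j => |E| * (R * (P j + P (j + 1))))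
    (fun j s t ht => by rw [one_mul]; exact hbd j s t ht)
    (fun j s t ht => by
      rw [norm_mul, norm_neg, Complex.norm_real, Real.norm_eq_abs]
      exact mul_le_mul_of_nonneg_left (hbd j s t ht) (abs_nonneg E))
    (hsumP 1) (hsumP |E|)
  have hhu : h = (E : ℂ) • u := by
    rw [← sub_eq_zero]
    apply lp.ext
    funext ⟨j, s⟩
    refine edge_eq_zero (sub_smul_ae (E := E) (g := fun j s t =>
      Complex.exp (potential A j (!s) * t) * (p j * (cs E t : ℝ) + q j s * (sn E t : ℝ)))
      (g₁ := fun j s t => -(Complex.exp (potential A j (!s) * t) *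
        (-(E : ℂ) * (p j * (cs E t : ℝ) + q j s * (sn E t : ℝ))))) (hu j s) (hh j s)) fun t => ?_
    ring
  refine isEigenvalue_iff.2 ⟨u, ?_, mem_laplacianGraph_iff.2 ⟨f, f', f'', hhu ▸ H⟩⟩
  rintro rfl
  obtain ⟨K', hK', hv⟩ := exists_vertex_bound E
  have := hv A β 0 h f f' f'' H 0 true
  rw [hhu, smul_zero, sub_zero, hf0] at this
  simp only [lp.coeFn_zero, Pi.zero_apply, norm_zero, add_zero, mul_zero, cs_zero, sn_zero,
    Complex.ofReal_one, Complex.ofReal_zero, mul_one, hpn] at this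
  exact absurd this (not_le.2 (hPpos 0))

end

/-! ### Asymptotics of the ratios for a weak perturbation -/

/-- One Riccati step for ρ = r/λ - 1, where x = λ^{-2} and d = b². To first order the new value is
εx(S - t) + εy; replacing x by 1 costs a multiple of ε(1 - x). This is why the error is ε² + ε(1 -
x), an expression that stays useful both at band edges, where x = 1, and for large λ. -/
theorem ratio_step {x ρ d y t ε K T Y S : ℝ} (hx0 : 0 ≤ x) (hx1 : x ≤ 1) (hε : 0 < ε) (hε1 : ε ≤ 1)
    (hT : 0 ≤ T) (hKε : K * ε ≤ 1 / 2) (hρ : |ρ| ≤ K * ε)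
    (hρS : |ρ - ε * S| ≤ K * (ε ^ 2 + ε * (1 - x))) (hd : |d - 1 - ε * t| ≤ T * ε ^ 2)
    (ht : |t| ≤ T) (hy : |y| ≤ Y) :
    |x * (1 - d / (1 + ρ)) + ε * y| ≤ (2 * K + 4 * T + Y) * ε ∧
      |x * (1 - d / (1 + ρ)) + ε * y - ε * (S - t + y)|
        ≤ (3 * K + 5 * T + 2 * K * (K + 2 * T)) * (ε ^ 2 + ε * (1 - x)) := by
  have hK : 0 ≤ K := by
    by_contra! h
    have := mul_neg_of_neg_of_pos h hε
    linarith [abs_nonneg ρ]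
  set δ := d - 1 with hδ
  set q := (ρ - δ) / (1 + ρ) with hq
  have hρ1 : 1 / 2 ≤ 1 + ρ := by linarith [neg_abs_le ρ]
  have e : 1 - d / (1 + ρ) = q := by
    rw [hq, eq_div_iff (by linarith : 1 + ρ ≠ 0), hδ, sub_mul,
      div_mul_cancel₀ _ (by linarith : 1 + ρ ≠ 0)]
    ring
  have hδa : |δ| ≤ 2 * T * ε := by
    have h1 : |δ| ≤ |δ - ε * t| + |ε * t| := by
      have := abs_add_le (δ - ε * t) (ε * t)
      rwa [sub_add_cancel] at this
    rw [abs_mul, abs_of_pos hε] at h1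
    have h2 : T * ε ^ 2 ≤ T * ε := by nlinarith [mul_nonneg hT hε.le]
    nlinarith
  have hnum : |ρ - δ| ≤ (K + 2 * T) * ε := by
    have := abs_sub ρ δ
    linarith
  have hqa : |q| ≤ 2 * (K + 2 * T) * ε := by
    rw [hq, abs_div, abs_of_pos (by linarith : 0 < 1 + ρ), div_le_iff₀ (by linarith)]
    have : 0 ≤ (K + 2 * T) * ε := (abs_nonneg _).trans hnum
    nlinarith
  have hq2 : |q - (ρ - δ)| ≤ 2 * K * (K + 2 * T) * ε ^ 2 := by
    have e2 : q - (ρ - δ) = -(ρ * q) := by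
      rw [hq]; field_simp; ring
    rw [e2, abs_neg, abs_mul]
    calc |ρ| * |q| ≤ (K * ε) * (2 * (K + 2 * T) * ε) :=
          mul_le_mul hρ hqa (abs_nonneg _) (by positivity)
      _ = _ := by ring
  have hεy : |ε * y| ≤ Y * ε := by
    rw [abs_mul, abs_of_pos hε, mul_comm]; gcongr
  have hxq : |x * q| ≤ |q| := by
    rw [abs_mul, abs_of_nonneg hx0]
    exact mul_le_of_le_one_left (abs_nonneg _) hx1
  rw [e]
  constructor
  · have := abs_add_le (x * q) (ε * y)
    nlinarith
  · have e3 : x * q + ε * y - ε * (S - t + y)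
        = (q - (ρ - δ)) + (-(1 - x) * q) + (ρ - ε * S) + (-(δ - ε * t)) := by ring
    have a1 := abs_add_le ((q - (ρ - δ)) + (-(1 - x) * q) + (ρ - ε * S)) (-(δ - ε * t))
    have a2 := abs_add_le ((q - (ρ - δ)) + (-(1 - x) * q)) (ρ - ε * S)
    have a3 := abs_add_le (q - (ρ - δ)) (-(1 - x) * q)
    have a4 : |-(1 - x) * q| ≤ 2 * (K + 2 * T) * (ε * (1 - x)) := by
      rw [abs_mul, abs_neg, abs_of_nonneg (by linarith : 0 ≤ 1 - x)]
      nlinarith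
    rw [abs_neg] at a1
    have h1 : 0 ≤ ε * (1 - x) := mul_nonneg hε.le (by linarith)
    have h2 := mul_nonneg hK h1
    have h3 := mul_nonneg hT h1
    have h4 := mul_nonneg (mul_nonneg hK (by positivity : 0 ≤ K + 2 * T)) h1
    have h5 := mul_nonneg hK (sq_nonneg ε)
    have h6 := mul_nonneg hT (sq_nonneg ε)
    rw [e3]
    linarith

/-- First order expansion of the ratios, uniformly in `λ`. -/
theorem exists_ratio_bound (N : ℕ) {T Y : ℝ} (hT : 0 ≤ T) (hY : 0 ≤ Y) :
    ∃ K ≥ 0, ∀ (ε lam : ℝ) (b v t y : ℤ → ℝ), 0 < ε → ε ≤ 1 → K * ε ≤ 1 / 2 → 1 ≤ lam →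
      (∀ j, |b j ^ 2 - 1 - ε * t j| ≤ T * ε ^ 2) → (∀ j, |t j| ≤ T) →
      (∀ j, v j = ε * lam * y j) → (∀ j, |y j| ≤ Y) → ∀ j ≤ N,
        |ratio lam b v j / lam - 1| ≤ K * ε ∧
        |ratio lam b v j / lam - 1
            - ε * ∑ i ∈ Finset.range j, (y (i + 1 : ℤ) - t (i : ℤ))|
          ≤ K * (ε ^ 2 + ε * (1 - (lam ^ 2)⁻¹)) := by
  induction N with
  | zero =>
    refine ⟨0, le_rfl, fun ε lam b v t y _ _ _ hl _ _ _ _ j hj => ?_⟩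
    obtain rfl : j = 0 := by omega
    have : lam ≠ 0 := by linarith
    simp [ratio, this]
  | succ N ih =>
    obtain ⟨K, hK, h⟩ := ih
    set K' := (3 * K + 5 * T + 2 * K * (K + 2 * T)) + Y with hK'
    have hKK : K ≤ K' := by
      have : 0 ≤ K * (K + 2 * T) := by positivity
      linarith
    refine ⟨K', hK.trans hKK, fun ε lam b v t y hε hε1 hKε hl hb ht hv hy j hj => ?_⟩
    have hKε' : K * ε ≤ 1 / 2 := (mul_le_mul_of_nonneg_right hKK hε.le).trans hKε
    have hl0 : 0 < lam := by linarith
    have hx0 : 0 ≤ (lam ^ 2)⁻¹ := by positivity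
    have hx1 : (lam ^ 2)⁻¹ ≤ 1 := inv_le_one_of_one_le₀ (one_le_pow₀ hl)
    have hE0 : 0 ≤ ε ^ 2 + ε * (1 - (lam ^ 2)⁻¹) :=
      add_nonneg (sq_nonneg _) (mul_nonneg hε.le (by linarith))
    have hprev := h ε lam b v t y hε hε1 hKε' hl hb ht hv hy
    rcases Nat.lt_or_ge N j with hlt | hle
    · obtain rfl : j = N + 1 := by omega
      obtain ⟨p1, p2⟩ := hprev N le_rfl
      obtain ⟨s1, s2⟩ := ratio_step hx0 hx1 hε hε1 hT hKε' p1 p2 (hb N) (ht N) (hy (N + 1))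
      have hpos : 0 < 1 + (ratio lam b v N / lam - 1) := by
        linarith [neg_abs_le (ratio lam b v N / lam - 1)]
      have hrN : ratio lam b v N ≠ 0 := by
        intro h0; rw [h0] at hpos; norm_num at hpos
      -- The recursion divided by λ, which has the form treated in `ratio_step`.
      have e : ratio lam b v (N + 1) / lam - 1
          = (lam ^ 2)⁻¹ * (1 - b N ^ 2 / (1 + (ratio lam b v N / lam - 1))) + ε * y (N + 1) := by
        rw [ratio, hv, add_sub_cancel]
        field_simp
        ring
      rw [e]
      refine ⟨s1.trans (mul_le_mul_of_nonneg_right ?_ hε.le), ?_⟩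
      · have : 0 ≤ K * (K + 2 * T) := by positivity
        linarith
      · rw [Finset.sum_range_succ]
        have e2 : ∑ i ∈ Finset.range N, (y (i + 1 : ℤ) - t (i : ℤ)) + (y (N + 1 : ℤ) - t (N : ℤ))
          = ∑ i ∈ Finset.range N, (y (i + 1 : ℤ) - t (i : ℤ)) - t (N : ℤ) + y (N + 1 : ℤ) := by ring
        rw [e2]
        exact s2.trans (mul_le_mul_of_nonneg_right (by linarith) hE0)
    · obtain ⟨p1, p2⟩ := hprev j hle
      exact ⟨p1.trans (mul_le_mul_of_nonneg_right hKK hε.le),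
        p2.trans (mul_le_mul_of_nonneg_right hKK hE0)⟩

/-- The larger solution `λ` of `λ + 1/λ = 2z`. -/
def growth (z : ℝ) : ℝ := z + √(z ^ 2 - 1)

theorem continuous_growth : Continuous growth := by unfold growth; fun_prop

theorem le_growth (z : ℝ) : z ≤ growth z := le_add_of_nonneg_right (Real.sqrt_nonneg _)

@[simp] theorem growth_one : growth 1 = 1 := by simp [growth]

theorem growth_add_inv {z : ℝ} (hz : 1 ≤ z) : growth z + (growth z)⁻¹ = 2 * z := by
  have h0 : 0 < growth z := by linarith [le_growth z]
  have hs : √(z ^ 2 - 1) ^ 2 = z ^ 2 - 1 := Real.sq_sqrt (by nlinarith)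
  rw [← mul_left_inj' h0.ne', add_mul, inv_mul_cancel₀ h0.ne', growth]
  linear_combination hs

theorem abs_sin_sub_le {u : ℝ} (hu : |u| ≤ 1) : |Real.sin u - u| ≤ u ^ 2 := by
  have h := Real.sin_bound hu
  have h1 : |u ^ 3| ≤ u ^ 2 := by
    rw [abs_pow, pow_succ, sq_abs]
    exact mul_le_of_le_one_right (sq_nonneg _) hu
  have h2 : |u| ^ 5 ≤ u ^ 2 := by
    rw [← sq_abs u]
    exact pow_le_pow_of_le_one (abs_nonneg _) hu (by norm_num)
  have h3 := abs_add_le (Real.sin u - (u - u ^ 3 / 6)) (-(u ^ 3 / 6))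
  rw [abs_neg, abs_div, abs_of_pos (by norm_num : (0 : ℝ) < 6)] at h3
  have e : Real.sin u - (u - u ^ 3 / 6) + -(u ^ 3 / 6) = Real.sin u - u := by ring
  rw [e] at h3
  linarith [sq_nonneg u]

/-- Expansion of the off-diagonal coefficient under a small change of the vector potential. -/
theorem cos_ratio_bound {θ h : ℝ} (hc : Real.cos θ ≠ 0) (hh : |h| ≤ 1 / 2) :
    |(Real.cos (θ + h) / Real.cos θ) ^ 2 - 1 + 2 * Real.tan θ * h|
      ≤ (1 + 4 * |Real.tan θ| + Real.tan θ ^ 2) * h ^ 2 ∧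
    1 - (1 + |Real.tan θ|) * |h| ≤ Real.cos (θ + h) / Real.cos θ := by
  set τ := Real.tan θ with hτ
  have e : Real.cos (θ + h) / Real.cos θ = Real.cos h - τ * Real.sin h := by
    rw [Real.cos_add, hτ, Real.tan_eq_sin_div_cos]
    field_simp
  have hs : |Real.sin h| ≤ |h| := Real.abs_sin_le_abs
  rw [e]
  constructor
  · have h2 := abs_sin_sub_le (u := 2 * h) (by rw [abs_mul]; norm_num; linarith)
    rw [Real.sin_two_mul] at h2
    have hs2 : Real.sin h ^ 2 ≤ h ^ 2 := sq_le_sq.2 hs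
    have e2 : (Real.cos h - τ * Real.sin h) ^ 2 - 1 + 2 * τ * h
        = (τ ^ 2 - 1) * Real.sin h ^ 2 + -(τ * (2 * Real.sin h * Real.cos h - 2 * h)) := by
      linear_combination Real.sin_sq_add_cos_sq h
    rw [e2]
    refine (abs_add_le _ _).trans ?_
    rw [abs_mul, abs_neg, abs_mul, abs_of_nonneg (sq_nonneg (Real.sin h))]
    have h3 : |τ ^ 2 - 1| ≤ τ ^ 2 + 1 := by
      rw [abs_le]; constructor <;> nlinarith [sq_nonneg τ]
    have h4 := mul_le_mul h3 hs2 (sq_nonneg _) (by positivity)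
    have h5 := mul_le_mul_of_nonneg_left h2 (abs_nonneg τ)
    nlinarith
  · have h1 : τ * Real.sin h ≤ |τ| * |h| := by
      refine (le_abs_self _).trans ?_
      rw [abs_mul]
      gcongr
    have h2 := Real.one_sub_sq_div_two_le_cos (x := h)
    have h3 : h ^ 2 ≤ |h| := by
      rw [← sq_abs]; nlinarith [abs_nonneg h]
    nlinarith [abs_nonneg h]

/-! ### The matching function of a gap -/

theorem sum_range_eq_sum_Icc (n : ℕ) (f : ℤ → ℝ) :
    ∑ i ∈ Finset.range n, f (i + 1 : ℤ) = ∑ j ∈ Finset.Icc (1 : ℤ) n, f j := by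
  refine Finset.sum_nbij (fun i : ℕ => (i + 1 : ℤ)) ?_ ?_ ?_ fun i _ => rfl
  · intro i hi
    have := Finset.mem_range.1 hi
    exact Finset.mem_Icc.2 ⟨by omega, by omega⟩
  · intro i _ j _ h
    simpa using h
  · intro j hj
    have := Finset.mem_Icc.1 (Finset.mem_coe.1 hj)
    exact ⟨(j - 1).toNat, by simp only [Finset.coe_range, mem_Iio]; omega, by
      show (((j - 1).toNat : ℕ) : ℤ) + 1 = j; omega⟩

theorem eventually_mul_lt (k : ℝ) {δ : ℝ} (hδ : 0 < δ) : ∀ᶠ ε in 𝓝[>] (0 : ℝ), k * ε < δ := by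
  have h : Tendsto (fun ε : ℝ => k * ε) (𝓝 0) (𝓝 (k * 0)) := (continuous_const_mul k).tendsto 0
  rw [mul_zero] at h
  exact (h.mono_left nhdsWithin_le_nhds).eventually (gt_mem_nhds hδ)

theorem perturb_of_notMem {c ε : ℝ} {n : ℕ} {d : ℤ → ℝ} :
    ∀ j ∉ Finset.Icc (1 : ℤ) n, perturb c n d ε j = c := fun _ hj => if_neg hj

/-- The restriction of a sequence to the perturbed sites. -/
def cutoff (n : ℕ) (d : ℤ → ℝ) (j : ℤ) : ℝ := if j ∈ Finset.Icc (1 : ℤ) n then d j else 0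

theorem perturb_eq (c ε : ℝ) (n : ℕ) (d : ℤ → ℝ) (j : ℤ) :
    perturb c n d ε j = c + ε * cutoff n d j := by
  unfold perturb cutoff
  split_ifs <;> simp

theorem sum_cutoff (n : ℕ) (d : ℤ → ℝ) :
    ∑ j ∈ Finset.Icc (1 : ℤ) n, cutoff n d j = ∑ j ∈ Finset.Icc (1 : ℤ) n, d j :=
  Finset.sum_congr rfl fun _ hj => if_pos hj

theorem abs_cutoff_le (n : ℕ) (d : ℤ → ℝ) (j : ℤ) :
    |cutoff n d j| ≤ ∑ j ∈ Finset.Icc (1 : ℤ) n, |d j| := by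
  unfold cutoff
  split_ifs with h
  · exact Finset.single_le_sum (f := fun j => |d j|) (fun i _ => abs_nonneg _) h
  · rw [abs_zero]; exact Finset.sum_nonneg fun i _ => abs_nonneg _

theorem sum_range_cutoff (n : ℕ) (d : ℤ → ℝ) :
    ∑ i ∈ Finset.range (n + 1), cutoff n d (i : ℤ) = ∑ j ∈ Finset.Icc (1 : ℤ) n, d j := by
  rw [Finset.sum_range_succ', Nat.cast_zero, show cutoff n d 0 = 0 from if_neg (by simp), add_zero,
    ← sum_cutoff, ← sum_range_eq_sum_Icc]
  push_cast
  rfl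

theorem sum_range_cutoff_succ (n : ℕ) (d : ℤ → ℝ) :
    ∑ i ∈ Finset.range (n + 1), cutoff n d (i + 1 : ℤ) = ∑ j ∈ Finset.Icc (1 : ℤ) n, d j := by
  rw [Finset.sum_range_succ, sum_range_eq_sum_Icc, sum_cutoff,
    show cutoff n d ((n : ℤ) + 1) = 0 from if_neg (by simp), add_zero]

section

variable (A α : ℝ) (n : ℕ) (a b : ℤ → ℝ) (ε σ E : ℝ)

/-- The growth rate of the solutions outside the perturbed part of the chain. -/
def rate : ℝ := growth (|eta α E| / |Real.cos (A * Real.pi)|)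

/-- The sign in front of the growth rate. -/
def gapSign : ℝ := σ * |Real.cos (A * Real.pi)| / Real.cos (A * Real.pi)

/-- The ratios for the perturbed chain. -/
def gapRatio (j : ℕ) : ℝ :=
  ratio (rate A α E) (offDiag (perturb A n a ε) A)
    (diagPert (perturb α n b ε) A α (gapSign A σ) E) j

/-- The function whose zeros in a gap are the eigenvalues. -/
def matching : ℝ :=
  gapRatio A α n a b ε σ E (n + 1) / rate A α E - (rate A α E ^ 2)⁻¹

/-- The first order coefficient in the expansion of the matching function; here `s` and `t` are the
sums of the perturbations of the coupling constants and of the potential. -/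
def slope (s t : ℝ) : ℝ :=
  σ * sPi E * s / (2 * |Real.cos (A * Real.pi)| * rate A α E)
    + 2 * Real.pi * Real.tan (A * Real.pi) * t

/-- The quantitative form of the smallness of the perturbation. -/
structure IsWeak (K : ℝ) : Prop where
  pos : 0 < ε
  small : K * ε ≤ 1 / 2
  offDiag_pos : ∀ j, 0 < offDiag (perturb A n a ε) A j
  ratio_bound : ∀ σ E, σ ^ 2 = 1 → |Real.cos (A * Real.pi)| ≤ |eta α E| → ∀ j ≤ n + 1,
    |gapRatio A α n a b ε σ E j / rate A α E - 1| ≤ K * ε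
  matching_bound : ∀ σ E, σ ^ 2 = 1 → |Real.cos (A * Real.pi)| ≤ |eta α E| →
    |matching A α n a b ε σ E - (1 - (rate A α E ^ 2)⁻¹)
      - ε * slope A α σ E (∑ j ∈ Finset.Icc (1 : ℤ) n, b j) (∑ j ∈ Finset.Icc (1 : ℤ) n, a j)|
      ≤ K * (ε ^ 2 + ε * (1 - (rate A α E ^ 2)⁻¹))

end

section

variable {A α : ℝ} {n : ℕ} {a b : ℤ → ℝ} {ε σ E : ℝ}

theorem continuous_rate (A α : ℝ) : Continuous (rate A α) :=
  continuous_growth.comp ((continuous_eta α).abs.div_const _)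

theorem one_le_quot (hc : Real.cos (A * Real.pi) ≠ 0)
    (hE : |Real.cos (A * Real.pi)| ≤ |eta α E|) : 1 ≤ |eta α E| / |Real.cos (A * Real.pi)| := by
  rwa [le_div_iff₀ (abs_pos.2 hc), one_mul]

theorem one_le_rate (hc : Real.cos (A * Real.pi) ≠ 0)
    (hE : |Real.cos (A * Real.pi)| ≤ |eta α E|) : 1 ≤ rate A α E :=
  (one_le_quot hc hE).trans (le_growth _)

/-- λ dominates both 1 and |η|/|cos Aπ| ≥ |η|. -/
theorem abs_sPi_le_rate {S : ℝ} (hS0 : 0 < S) (hS : ∀ E, |sPi E| ≤ S * max 1 |eta α E|)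
    (hc : Real.cos (A * Real.pi) ≠ 0) (hE : |Real.cos (A * Real.pi)| ≤ |eta α E|) :
    |sPi E| ≤ S * rate A α E := by
  refine (hS E).trans (mul_le_mul_of_nonneg_left (max_le (one_le_rate hc hE) ?_) hS0.le)
  refine le_trans ?_ (le_growth _)
  rw [le_div_iff₀ (abs_pos.2 hc)]
  exact mul_le_of_le_one_right (abs_nonneg _) (Real.abs_cos_le_one _)

theorem abs_sign (hσ : σ ^ 2 = 1) : |σ| = 1 := by
  rw [← sq_eq_sq₀ (abs_nonneg _) zero_le_one, sq_abs, hσ, one_pow]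

theorem gapSign_sq (hσ : σ ^ 2 = 1) (hc : Real.cos (A * Real.pi) ≠ 0) : gapSign A σ ^ 2 = 1 := by
  rw [gapSign, div_pow, mul_pow, hσ, sq_abs, one_mul, div_self (pow_ne_zero 2 hc)]

theorem gapSign_div (hc : Real.cos (A * Real.pi) ≠ 0) :
    gapSign A σ / Real.cos (A * Real.pi) = σ / |Real.cos (A * Real.pi)| := by
  have h := abs_pos.2 hc
  rw [gapSign, div_div, div_eq_div_iff (mul_ne_zero hc hc) h.ne', ← pow_two,
    ← sq_abs (Real.cos _)]
  ring

theorem abs_slope_term_le {S s : ℝ} (hS0 : 0 < S) (hS : ∀ E, |sPi E| ≤ S * max 1 |eta α E|)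
    (hc : Real.cos (A * Real.pi) ≠ 0) (hE : |Real.cos (A * Real.pi)| ≤ |eta α E|)
    (hσ : σ ^ 2 = 1) :
    |σ * sPi E * s / (2 * |Real.cos (A * Real.pi)| * rate A α E)|
      ≤ S * |s| / (2 * |Real.cos (A * Real.pi)|) := by
  have hl : 0 < rate A α E := by linarith [one_le_rate hc hE]
  have hc' := abs_pos.2 hc
  rw [abs_div, abs_mul, abs_mul, abs_sign hσ, one_mul,
    abs_of_pos (by positivity : 0 < 2 * |Real.cos (A * Real.pi)| * rate A α E),
    div_le_div_iff₀ (by positivity) (by positivity)]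
  have := mul_le_mul_of_nonneg_right (abs_sPi_le_rate hS0 hS hc hE)
    (by positivity : 0 ≤ |s| * (2 * |Real.cos (A * Real.pi)|))
  linarith

/-- One K serves all energies and both signs σ. This uniformity is what makes the threshold for ε
common to all gaps. -/
theorem exists_isWeak (hc : Real.cos (A * Real.pi) ≠ 0) (α : ℝ) (n : ℕ) (a b : ℤ → ℝ) :
    ∃ K ≥ 0, ∀ᶠ ε in 𝓝[>] (0 : ℝ), IsWeak A α n a b ε K := by
  obtain ⟨S, hS0, hS⟩ := exists_sPi_bound α
  have hc' := abs_pos.2 hc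
  set τ := Real.tan (A * Real.pi) with hτ
  set M := ∑ j ∈ Finset.Icc (1 : ℤ) n, |a j| with hM
  set B := ∑ j ∈ Finset.Icc (1 : ℤ) n, |b j| with hB
  have hM0 : 0 ≤ M := Finset.sum_nonneg fun i _ => abs_nonneg _
  have hB0 : 0 ≤ B := Finset.sum_nonneg fun i _ => abs_nonneg _
  have hpi := Real.pi_pos
  set T := (1 + 4 * |τ| + τ ^ 2) * (Real.pi * M) ^ 2 + 2 * Real.pi * |τ| * M with hT
  have hT0 : 0 ≤ T := by positivity
  obtain ⟨K, hK, h⟩ := exists_ratio_bound (n + 1) hT0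
    (by positivity : 0 ≤ S * B / (2 * |Real.cos (A * Real.pi)|))
  refine ⟨K, hK, ?_⟩
  filter_upwards [self_mem_nhdsWithin, eventually_mul_lt 1 one_pos,
    eventually_mul_lt K (by norm_num : (0 : ℝ) < 1 / 2),
    eventually_mul_lt (Real.pi * M) (by norm_num : (0 : ℝ) < 1 / 2),
    eventually_mul_lt ((1 + |τ|) * (Real.pi * M)) one_pos] with ε h0 h1 h2 h3 h4
  have h0 : 0 < ε := h0
  rw [one_mul] at h1
  have hh : ∀ j, |ε * cutoff n a j * Real.pi| ≤ Real.pi * M * ε := fun j => by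
    rw [abs_mul, abs_mul, abs_of_pos h0, abs_of_pos hpi]
    have := mul_le_mul_of_nonneg_left (abs_cutoff_le n a j) (mul_pos h0 hpi).le
    linarith
  have hoff : ∀ j, offDiag (perturb A n a ε) A j
      = Real.cos (A * Real.pi + ε * cutoff n a j * Real.pi) / Real.cos (A * Real.pi) := fun j => by
    rw [offDiag, perturb_eq, add_mul]
  have hcr := fun j => cos_ratio_bound hc ((hh j).trans h3.le)
  have hpos : ∀ j, 0 < offDiag (perturb A n a ε) A j := fun j => by
    rw [hoff]
    refine lt_of_lt_of_le ?_ (hcr j).2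
    have := mul_le_mul_of_nonneg_left (hh j) (by positivity : 0 ≤ 1 + |τ|)
    rw [hτ] at *
    linarith
  -- The first order data: b_j² = 1 - 2π tan(Aπ) ε a_j + O(ε²) for the squared off-diagonal
  -- coefficients, and for the diagonal the perturbation divided by ελ, bounded uniformly by
  -- `abs_slope_term_le`.
  have main : ∀ σ E : ℝ, σ ^ 2 = 1 → |Real.cos (A * Real.pi)| ≤ |eta α E| → ∀ j ≤ n + 1, _ :=
    fun σ E hσ hE => h ε (rate A α E) (offDiag (perturb A n a ε) A)
      (diagPert (perturb α n b ε) A α (gapSign A σ) E)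
      (fun j => -2 * Real.pi * τ * cutoff n a j)
      (fun j => σ * sPi E / (2 * |Real.cos (A * Real.pi)| * rate A α E) * cutoff n b j)
      h0 h1.le h2.le (one_le_rate hc hE)
      (fun j => by
        rw [hoff]
        have h5 := (hcr j).1
        rw [← hτ] at h5
        rw [show ε * (-2 * Real.pi * τ * cutoff n a j) = -(2 * τ * (ε * cutoff n a j * Real.pi)) by
          ring, sub_neg_eq_add]
        refine h5.trans ?_
        have h6 : (ε * cutoff n a j * Real.pi) ^ 2 ≤ (Real.pi * M * ε) ^ 2 :=
          sq_le_sq.2 ((hh j).trans (le_abs_self _))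
        have h7 := mul_le_mul_of_nonneg_left h6 (by positivity : 0 ≤ 1 + 4 * |τ| + τ ^ 2)
        refine h7.trans ?_
        rw [hT, mul_pow, ← mul_assoc]
        gcongr
        exact le_add_of_nonneg_right (by positivity))
      (fun j => by
        rw [abs_mul, abs_mul, abs_mul, abs_neg, abs_two, abs_of_pos hpi, hT]
        have := mul_le_mul_of_nonneg_left (abs_cutoff_le n a j)
          (by positivity : 0 ≤ 2 * Real.pi * |τ|)
        have h8 : 0 ≤ (1 + 4 * |τ| + τ ^ 2) * (Real.pi * M) ^ 2 := by positivity
        linarith)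
      (fun j => by
        have hl := one_le_rate hc hE
        rw [diagPert, perturb_eq]
        have e : gapSign A σ * sPi E * (α + ε * cutoff n b j - α) / (2 * Real.cos (A * Real.pi))
          = gapSign A σ / Real.cos (A * Real.pi) * (sPi E * ε * cutoff n b j / 2) := by
          field_simp; ring
        rw [e, gapSign_div hc]
        field_simp)
      (fun j => by
        rw [div_mul_eq_mul_div]
        refine (abs_slope_term_le hS0 hS hc hE hσ).trans ?_
        gcongr
        exact abs_cutoff_le n b j)
  refine ⟨h0, h2.le, hpos, fun σ E hσ hE j hj => (main σ E hσ hE j hj).1, fun σ E hσ hE => ?_⟩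
  have := (main σ E hσ hE (n + 1) le_rfl).2
  -- The two sums run over 0, …, n and 1, …, n + 1. Both reduce to 1, …, n, as the restricted
  -- sequences vanish at 0 and n + 1.
  rw [Finset.sum_sub_distrib, ← Finset.mul_sum, ← Finset.mul_sum, sum_range_cutoff,
    sum_range_cutoff_succ] at this
  rw [matching, slope, ← hτ]
  refine le_of_eq_of_le ?_ this
  rw [gapRatio]
  congr 1
  ring

end

/-! ### Eigenvalues under a weak perturbation -/

/-- For `σ = ± 1`, the part of the resolvent set in an energy interval where `η` has sign `σ`. -/
def gapSet (A α σ : ℝ) (m : ℕ) : Set ℝ :=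
  {E ∈ energyInterval m | |Real.cos (A * Real.pi)| < σ * eta α E}

section

variable {A α : ℝ} {n : ℕ} {a b : ℤ → ℝ} {ε σ E K : ℝ} {m : ℕ}

theorem sign_mul_le (hσ : σ ^ 2 = 1) (x : ℝ) : σ * x ≤ |x| := by
  have := le_abs_self (σ * x)
  rwa [abs_mul, abs_sign hσ, one_mul] at this

theorem sign_mul_eq (hσ : σ ^ 2 = 1) {x : ℝ} (hx : 0 ≤ σ * x) : σ * x = |x| := by
  rw [← abs_of_nonneg hx, abs_mul, abs_sign hσ, one_mul]

theorem rate_add_inv (hσ : σ ^ 2 = 1) (hc : Real.cos (A * Real.pi) ≠ 0)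
    (hE : |Real.cos (A * Real.pi)| ≤ σ * eta α E) :
    rate A α E + (rate A α E)⁻¹ = 2 * gapSign A σ * eta α E / Real.cos (A * Real.pi) := by
  rw [rate, growth_add_inv (one_le_quot hc (hE.trans (sign_mul_le hσ _))),
    ← sign_mul_eq hσ ((abs_nonneg _).trans hE),
    show 2 * gapSign A σ * eta α E / Real.cos (A * Real.pi)
      = 2 * (gapSign A σ / Real.cos (A * Real.pi)) * eta α E by ring, gapSign_div hc]
  ring

theorem one_lt_rate (hσ : σ ^ 2 = 1) (hc : Real.cos (A * Real.pi) ≠ 0)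
    (hE : |Real.cos (A * Real.pi)| < σ * eta α E) : 1 < rate A α E := by
  refine lt_of_lt_of_le ?_ (le_growth _)
  rw [lt_div_iff₀ (abs_pos.2 hc), one_mul]
  exact hE.trans_le (sign_mul_le hσ _)

theorem IsWeak.gapRatio_pos (hw : IsWeak A α n a b ε K) (hσ : σ ^ 2 = 1)
    (hc : Real.cos (A * Real.pi) ≠ 0) (hE : |Real.cos (A * Real.pi)| ≤ |eta α E|) {j : ℕ}
    (hj : j ≤ n + 1) : 0 < gapRatio A α n a b ε σ E j := by
  have h1 := hw.ratio_bound σ E hσ hE j hj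
  have h2 := hw.small
  have h3 := neg_abs_le (gapRatio A α n a b ε σ E j / rate A α E - 1)
  have h4 : 0 < gapRatio A α n a b ε σ E j / rate A α E := by linarith
  have h5 : 0 < rate A α E := by linarith [one_le_rate hc hE]
  exact (div_pos_iff_of_pos_right h5).1 h4

theorem matching_eq_zero_iff (hl : 0 < rate A α E) : matching A α n a b ε σ E = 0 ↔
    gapRatio A α n a b ε σ E (n + 1) = (rate A α E)⁻¹ := by
  rw [matching, sub_eq_zero, div_eq_iff hl.ne']
  have : (rate A α E ^ 2)⁻¹ * rate A α E = (rate A α E)⁻¹ := by field_simp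
  rw [this]

theorem IsWeak.isEigenvalue_iff (hw : IsWeak A α n a b ε K) (hσ : σ ^ 2 = 1)
    (hc : Real.cos (A * Real.pi) ≠ 0) (hE : E ∈ gapSet A α σ m) :
    IsEigenvalue (perturbedLaplacian A α n a b ε) E ↔ matching A α n a b ε σ E = 0 := by
  have hl := one_lt_rate hσ hc hE.2
  have hlam := rate_add_inv hσ hc hE.2.le
  have hr : ∀ j ≤ n, 0 < gapRatio A α n a b ε σ E j := fun j hj =>
    hw.gapRatio_pos hσ hc (hE.2.le.trans (sign_mul_le hσ _)) (by omega)
  rw [matching_eq_zero_iff (by linarith)]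
  constructor
  · intro h
    exact h.ratio_eq hc perturb_of_notMem perturb_of_notMem (sPi_ne_zero hE.1)
      (gapSign_sq hσ hc) hl hlam hw.offDiag_pos hr
  · intro h
    exact isEigenvalue_of_ratio_eq hc perturb_of_notMem perturb_of_notMem (sPi_ne_zero hE.1)
      (gapSign_sq hσ hc) hl hlam hw.offDiag_pos hr h

theorem IsWeak.isSimpleEigenvalue (hw : IsWeak A α n a b ε K) (hσ : σ ^ 2 = 1)
    (hc : Real.cos (A * Real.pi) ≠ 0) (hE : E ∈ gapSet A α σ m)
    (h : IsEigenvalue (perturbedLaplacian A α n a b ε) E) :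
    IsSimpleEigenvalue (perturbedLaplacian A α n a b ε) E :=
  IsEigenvalue.isSimpleEigenvalue h hc perturb_of_notMem perturb_of_notMem (sPi_ne_zero hE.1)
    (gapSign_sq hσ hc) (one_lt_rate hσ hc hE.2) (rate_add_inv hσ hc hE.2.le) hw.offDiag_pos

theorem exists_abs_slope_le (hc : Real.cos (A * Real.pi) ≠ 0) (α s t : ℝ) :
    ∃ Θ ≥ 0, ∀ σ E, σ ^ 2 = 1 → |Real.cos (A * Real.pi)| ≤ |eta α E| →
      |slope A α σ E s t| ≤ Θ := by
  obtain ⟨S, hS0, hS⟩ := exists_sPi_bound α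
  refine ⟨S * |s| / (2 * |Real.cos (A * Real.pi)|) + |2 * Real.pi * Real.tan (A * Real.pi) * t|,
    by positivity, fun σ E hσ hE => ?_⟩
  exact (abs_add_le _ _).trans (by gcongr; exact abs_slope_term_le hS0 hS hc hE hσ)

theorem inv_rate_sq_le_one (hc : Real.cos (A * Real.pi) ≠ 0)
    (hE : |Real.cos (A * Real.pi)| ≤ |eta α E|) : (rate A α E ^ 2)⁻¹ ≤ 1 :=
  inv_le_one_of_one_le₀ (one_le_pow₀ (one_le_rate hc hE))

/-- The point of an energy interval that serves as a reference point inside a gap. -/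
def midGap (A : ℝ) : ℝ := (1 + |Real.cos (A * Real.pi)|) / 2

/-- Beyond the level halfway between |cos Aπ| and 1, λ stays away from 1 in all gaps simultaneously,
so there 1 - λ^{-2} dominates every term of order ε. -/
theorem exists_rate_gap (hc : Real.cos (A * Real.pi) ≠ 0) (hc1 : |Real.cos (A * Real.pi)| < 1)
    (α : ℝ) : ∃ δ > 0, ∀ E, midGap A ≤ |eta α E| → δ ≤ 1 - (rate A α E ^ 2)⁻¹ := by
  have hc' := abs_pos.2 hc
  set z := midGap A / |Real.cos (A * Real.pi)| with hz
  have hz1 : 1 < z := by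
    rw [hz, lt_div_iff₀ hc', midGap]; linarith
  refine ⟨1 - (z ^ 2)⁻¹, sub_pos.2 (inv_lt_one_of_one_lt₀ (one_lt_pow₀ hz1 two_ne_zero)),
    fun E hE => ?_⟩
  have : z ≤ rate A α E := le_trans (by rw [hz]; gcongr) (le_growth _)
  gcongr

/-- No eigenvalues where the first order coefficient is positive or away from the bands. -/
theorem eventually_not_isEigenvalue (hc : Real.cos (A * Real.pi) ≠ 0)
    (hc1 : |Real.cos (A * Real.pi)| < 1) (α : ℝ) (n : ℕ) (a b : ℤ → ℝ) {θ : ℝ} (hθ : 0 < θ) :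
    ∀ᶠ ε in 𝓝[>] (0 : ℝ), ∀ σ m, σ ^ 2 = 1 → ∀ E ∈ gapSet A α σ m,
      (σ * eta α E < midGap A →
        θ ≤ slope A α σ E (∑ j ∈ Finset.Icc (1 : ℤ) n, b j) (∑ j ∈ Finset.Icc (1 : ℤ) n, a j)) →
      ¬ IsEigenvalue (perturbedLaplacian A α n a b ε) E := by
  obtain ⟨K, hK, hw⟩ := exists_isWeak hc α n a b
  obtain ⟨Θ, hΘ, hs⟩ := exists_abs_slope_le hc α (∑ j ∈ Finset.Icc (1 : ℤ) n, b j)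
    (∑ j ∈ Finset.Icc (1 : ℤ) n, a j)
  obtain ⟨δ, hδ, hd⟩ := exists_rate_gap hc hc1 α
  filter_upwards [hw, eventually_mul_lt K hθ, eventually_mul_lt (2 * (Θ + K)) hδ,
    eventually_mul_lt 1 one_pos] with ε hw h1 h2 h3 σ m hσ E hE hsl
  rw [hw.isEigenvalue_iff hσ hc hE]
  have hE' := hE.2.le.trans (sign_mul_le hσ _)
  have hx := inv_rate_sq_le_one hc hE'
  have hm := (abs_le.1 (hw.matching_bound σ E hσ hE')).1
  have h0 := hw.pos
  have h4 := hw.small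
  set Sl := slope A α σ E (∑ j ∈ Finset.Icc (1 : ℤ) n, b j) (∑ j ∈ Finset.Icc (1 : ℤ) n, a j)
  set x := (rate A α E ^ 2)⁻¹
  have h5 : K * ε * (1 - x) ≤ 1 / 2 * (1 - x) := by gcongr
  intro hz
  rw [hz] at hm
  -- Near the band edge εθ outweighs Kε², half of 1 - x having absorbed the other error term. Away
  -- from it 1 - x ≥ δ outweighs everything of order ε.
  rcases lt_or_ge (σ * eta α E) (midGap A) with hlt | hge
  · have h6 := mul_le_mul_of_nonneg_left (hsl hlt) h0.le
    have h7 := mul_lt_mul_of_pos_right h1 h0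
    nlinarith
  · have h6 := hd E (hge.trans (sign_mul_le hσ _))
    have h7 := mul_le_mul_of_nonneg_left (abs_le.1 (hs σ E hσ hE')).1 h0.le
    have h8 : K * ε * ε ≤ K * ε * 1 := by gcongr; linarith
    nlinarith

theorem IsWeak.gapRatio_le (hw : IsWeak A α n a b ε K) (hσ : σ ^ 2 = 1)
    (hc : Real.cos (A * Real.pi) ≠ 0) (hE : |Real.cos (A * Real.pi)| ≤ |eta α E|)
    (hz : matching A α n a b ε σ E = 0) (hK : 0 ≤ K) (j : ℕ) :
    gapRatio A α n a b ε σ E j ≤ rate A α E * (1 + K * ε) := by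
  have hl := one_le_rate hc hE
  have hε := hw.pos
  rcases le_or_gt j (n + 1) with hj | hj
  · have h1 := (abs_le.1 (hw.ratio_bound σ E hσ hE j hj)).2
    rw [mul_comm, ← div_le_iff₀ (by linarith)]
    linarith
  · obtain ⟨i, rfl⟩ := Nat.exists_eq_add_of_le hj.le
    rw [matching_eq_zero_iff (by linarith)] at hz
    rw [gapRatio, ratio_tail (offDiag_eq_one perturb_of_notMem hc)
      (diagPert_eq_zero perturb_of_notMem) hz]
    have : (rate A α E)⁻¹ ≤ 1 := inv_le_one_of_one_le₀ hl
    have h2 := mul_nonneg hK hε.le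
    nlinarith

/-- Each gap contains at most one eigenvalue. -/
theorem eventually_eigenvalue_unique (hc : Real.cos (A * Real.pi) ≠ 0)
    (hc1 : |Real.cos (A * Real.pi)| < 1) (α : ℝ) (n : ℕ) (a b : ℤ → ℝ) :
    ∀ᶠ ε in 𝓝[>] (0 : ℝ), ∀ σ m, σ ^ 2 = 1 → ∀ E ∈ gapSet A α σ m, ∀ E' ∈ gapSet A α σ m,
      IsEigenvalue (perturbedLaplacian A α n a b ε) E →
      IsEigenvalue (perturbedLaplacian A α n a b ε) E' → E = E' := by
  obtain ⟨K, hK, hw⟩ := exists_isWeak hc α n a b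
  obtain ⟨Θ, hΘ, hs⟩ := exists_abs_slope_le hc α (∑ j ∈ Finset.Icc (1 : ℤ) n, b j)
    (∑ j ∈ Finset.Icc (1 : ℤ) n, a j)
  have hc' := abs_pos.2 hc
  -- At a zero of the matching function the expansion gives 1 - λ^{-2} ≤ 2(Θ + K)ε = (L/2)ε, hence λ
  -- ≤ 1 + Lε. Eigenvalues therefore lie close to the band edge, and all ratios are at most (1 +
  -- Lε)(1 + Kε), which tends to 1.
  set L := 4 * (Θ + K) with hL
  have hL0 : 0 ≤ L := by positivity
  have hev : ∀ᶠ ε in 𝓝[>] (0 : ℝ),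
      |Real.cos (A * Real.pi)| * ((1 + L * ε) * (1 + K * ε)) < 1 := by
    have h : Tendsto (fun ε : ℝ => |Real.cos (A * Real.pi)| * ((1 + L * ε) * (1 + K * ε))) (𝓝 0)
        (𝓝 (|Real.cos (A * Real.pi)| * ((1 + L * 0) * (1 + K * 0)))) :=
      Continuous.tendsto (by fun_prop) 0
    simp only [mul_zero, add_zero, mul_one] at h
    exact (h.mono_left nhdsWithin_le_nhds).eventually (gt_mem_nhds hc1)
  filter_upwards [hw, hev, eventually_mul_lt L one_pos, eventually_mul_lt 1 one_pos]
    with ε hw h1 h2 h3 σ m hσ E hE E' hE' hev hev'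
  have h0 := hw.pos
  set κ := (1 + L * ε) * (1 + K * ε) with hκ
  have hKε : 0 ≤ K * ε := by positivity
  have hLε : 0 ≤ L * ε := by positivity
  have key : ∀ E ∈ gapSet A α σ m, IsEigenvalue (perturbedLaplacian A α n a b ε) E →
      matching A α n a b ε σ E = 0 ∧ rate A α E ≤ κ ∧
        ∀ j, gapRatio A α n a b ε σ E j ≤ κ := by
    intro E hE hev
    have hEa := hE.2.le.trans (sign_mul_le hσ _)
    have hl := one_le_rate hc hEa
    have hz := (hw.isEigenvalue_iff hσ hc hE).1 hev
    have hm := (abs_le.1 (hw.matching_bound σ E hσ hEa)).1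
    have hx := inv_rate_sq_le_one hc hEa
    rw [hz] at hm
    have h7 := mul_le_mul_of_nonneg_left (abs_le.1 (hs σ E hσ hEa)).1 h0.le
    have h5 : K * ε * (1 - (rate A α E ^ 2)⁻¹) ≤ 1 / 2 * (1 - (rate A α E ^ 2)⁻¹) := by
      gcongr
      exact hw.small
    have h8 : K * ε * ε ≤ K * ε * 1 := by gcongr; linarith
    have h9 : 1 - (rate A α E ^ 2)⁻¹ ≤ L / 2 * ε := by
      rw [hL]; nlinarith
    have h10 : rate A α E ≤ 1 + L * ε := by
      have hl2 : rate A α E ≤ rate A α E ^ 2 := by nlinarith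
      refine hl2.trans ?_
      have h11 : 1 - L / 2 * ε ≤ (rate A α E ^ 2)⁻¹ := by linarith
      rw [le_inv_comm₀ (by linarith) (by positivity)] at h11
      refine h11.trans ?_
      rw [inv_le_iff_one_le_mul₀ (by linarith)]
      nlinarith
    refine ⟨hz, h10.trans (le_mul_of_one_le_right (by linarith) (by linarith)), fun j => ?_⟩
    refine (hw.gapRatio_le hσ hc hEa hz hK j).trans ?_
    rw [hκ]
    gcongr
  -- The data required by `exists_quot_eq`; the last relation, free of α, shows how energy and
  -- coupling enter the diagonal.
  have prof : ∀ E ∈ gapSet A α σ m, IsEigenvalue (perturbedLaplacian A α n a b ε) E →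
      ∃ P D : ℤ → ℝ, (∀ j, 0 < P j) ∧ (Summable fun j => P j ^ 2) ∧
        (∀ j, offDiag (perturb A n a ε) A j * P (j + 1) ≤ κ * P j) ∧
        (∀ j, offDiag (perturb A n a ε) A j * P (j + 1)
          + offDiag (perturb A n a ε) A (j - 1) * P (j - 1) = D j * P j) ∧
        ∀ j, gapSign A σ * Real.cos (A * Real.pi) * D j
          = 2 * cPi E + sPi E * perturb α n b ε j / 2 := by
    intro E hE hev
    obtain ⟨hz, k1, k2⟩ := key E hE hev
    have hl := one_lt_rate hσ hc hE.2
    have hEa := hE.2.le.trans (sign_mul_le hσ _)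
    rw [matching_eq_zero_iff (by linarith)] at hz
    have hb1 := offDiag_eq_one (A := perturb A n a ε) perturb_of_notMem hc
    have hv0 : ∀ j ∉ Finset.Icc (1 : ℤ) n,
        diagPert (perturb α n b ε) A α (gapSign A σ) E j = 0 := diagPert_eq_zero perturb_of_notMem
    have hr := ratio_pos hl hb1 hv0 hz fun j hj => hw.gapRatio_pos hσ hc hEa (by omega)
    refine ⟨_, fun j => rate A α E + (rate A α E)⁻¹
        + diagPert (perturb α n b ε) A α (gapSign A σ) E j,
      profile_pos hl hw.offDiag_pos hr, profile_summable hl hb1 hv0 hz,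
      profile_succ_le hl hw.offDiag_pos hb1 hr k1 k2,
      profile_solvesRec hl hw.offDiag_pos hb1 hv0 hr, fun j => ?_⟩
    have hg := gapSign_sq hσ hc
    simp only [rate_add_inv hσ hc hE.2.le, diagPert, eta]
    field_simp
    linear_combination (16 * cPi E + 4 * sPi E * perturb α n b ε j) * hg
  obtain ⟨P, D, p1, p2, p3, p4, p5⟩ := prof E hE hev
  obtain ⟨P', D', q1, q2, q3, q4, q5⟩ := prof E' hE' hev'
  obtain ⟨t, ht, heq⟩ := exists_quot_eq hw.offDiag_pos p1 q1 p2 q2 p3 q3 p4 q4 p5 q5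
    (abs_sign (gapSign_sq hσ hc)) h1 (sPi_ne_zero hE.1) (sPi_ne_zero hE'.1)
  exact (strictAntiOn_quot m ht).injOn hE.1 hE'.1 heq

end

/-! ### Existence of eigenvalues -/

theorem ordConnected_energyInterval (m : ℕ) : (energyInterval m).OrdConnected := by
  refine ⟨fun x hx y hy z hz => ⟨hz.2.trans_lt hy.1, ?_⟩⟩
  exact hx.2.imp_right fun h => h.trans_le hz.1

section

variable {A α : ℝ} {n : ℕ} {a b : ℤ → ℝ} {ε σ E K : ℝ} {m : ℕ}

/-- `eta_sub_sign` for either sign σ. It turns inequalities for ση in an energy interval into order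
relations with the point where the level is attained. -/
theorem eta_sub_pos_iff {t e : ℝ} (ht : |t| < 1) (he : e ∈ energyInterval m)
    (het : eta α e = t) (hE : E ∈ energyInterval m) (hσ : σ ^ 2 = 1) :
    0 < σ * (eta α E - t) ↔ 0 < σ * (-1) ^ m * (e - E) := by
  have h1 := eta_sub_sign ht hE he het
  have hu : ((-1 : ℝ) ^ m) ^ 2 = 1 := by rw [← pow_mul, mul_comm, pow_mul]; simp
  generalize (-1 : ℝ) ^ m = u at h1 hu ⊢
  have h2 : e < E → u * (eta α E - t) < 0 := by
    intro h
    rcases lt_trichotomy (u * (eta α E - t)) 0 with h3 | h3 | h3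
    · exact h3
    · exfalso
      have hu0 : u ≠ 0 := by intro h0; rw [h0] at hu; norm_num at hu
      have h4 : eta α E = t := sub_eq_zero.1 ((mul_eq_zero.1 h3).resolve_left hu0)
      have := (eta_sub_sign ht he hE h4).2 h
      rw [het, sub_self, mul_zero] at this
      exact lt_irrefl _ this
    · exact absurd (h1.1 h3) (not_lt.2 h.le)
  have e1 : σ * (eta α E - t) = (σ * u) * (u * (eta α E - t)) := by
    linear_combination (-σ * (eta α E - t)) * hu
  have hτ : (σ * u) ^ 2 = 1 := by rw [mul_pow, hσ, hu, one_mul]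
  have h3 : 0 < u * (eta α E - t) ∧ 0 < e - E ∨ u * (eta α E - t) ≤ 0 ∧ e - E ≤ 0 ∧
      (e - E < 0 → u * (eta α E - t) < 0) ∧ (e - E = 0 → u * (eta α E - t) = 0) := by
    rcases lt_trichotomy E e with h | rfl | h
    · exact Or.inl ⟨h1.2 h, sub_pos.2 h⟩
    · right
      rw [het]
      simp
    · exact Or.inr ⟨(h2 h).le, by linarith, fun _ => h2 h, fun h' => by linarith⟩
  rw [e1]
  rcases sq_eq_one_iff.1 hτ with h | h
  · rw [h, one_mul, one_mul]
    rcases h3 with h3 | h3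
    · exact iff_of_true h3.1 h3.2
    · exact iff_of_false (not_lt.2 h3.1) (not_lt.2 h3.2.1)
  · rw [h, neg_one_mul, neg_one_mul, neg_pos, neg_pos]
    rcases h3 with h3 | ⟨h3, h4, h5, h6⟩
    · exact iff_of_false (not_lt.2 h3.1.le) (not_lt.2 h3.2.le)
    · refine ⟨fun h7 => lt_of_le_of_ne h4 fun h8 => ?_, h5⟩
      rw [h6 h8] at h7
      exact lt_irrefl _ h7

theorem abs_sign_mul_lt {x : ℝ} (hσ : σ ^ 2 = 1) (hx : |x| < 1) : |σ * x| < 1 := by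
  rwa [abs_mul, abs_sign hσ, one_mul]

theorem eq_sign_mul {x y : ℝ} (hσ : σ ^ 2 = 1) (h : σ * x = y) : x = σ * y := by
  rw [← h, ← mul_assoc, ← pow_two, hσ, one_mul]

/-- An edge `e` of an energy band bounds the adjacent gap. -/
theorem mem_gapSet_iff (hc1 : |Real.cos (A * Real.pi)| < 1) {e : ℝ} (he : e ∈ energyInterval m)
    (hσ : σ ^ 2 = 1) (het : σ * eta α e = |Real.cos (A * Real.pi)|) (hE : E ∈ energyInterval m) :
    E ∈ gapSet A α σ m ↔ 0 < σ * (-1) ^ m * (e - E) := by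
  rw [← eta_sub_pos_iff (abs_sign_mul_lt hσ (by rwa [abs_abs])) he (eq_sign_mul hσ het) hE hσ,
    mul_sub, ← mul_assoc, ← pow_two, hσ, one_mul, sub_pos]
  exact and_iff_right hE

theorem exists_sign_mul_eta (α : ℝ) (m : ℕ) (hσ : σ ^ 2 = 1) {t : ℝ} (ht : |t| < 1) :
    ∃ e ∈ energyInterval m, σ * eta α e = t := by
  obtain ⟨e, he, h⟩ := exists_eta_eq α m (abs_sign_mul_lt hσ ht)
  exact ⟨e, he, by rw [h, ← mul_assoc, ← pow_two, hσ, one_mul]⟩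

theorem midGap_mem (hc1 : |Real.cos (A * Real.pi)| < 1) :
    |Real.cos (A * Real.pi)| < midGap A ∧ |midGap A| < 1 := by
  have := abs_nonneg (Real.cos (A * Real.pi))
  have h : midGap A = (1 + |Real.cos (A * Real.pi)|) / 2 := rfl
  rw [abs_of_pos (by linarith : 0 < midGap A)]
  constructor <;> linarith

theorem sign_mul_neg_one_pow (hσ : σ ^ 2 = 1) (m : ℕ) :
    σ * (-1) ^ m = 1 ∨ σ * (-1) ^ m = -1 := by
  apply sq_eq_one_iff.1
  rw [mul_pow, hσ, one_mul, ← pow_mul, mul_comm, pow_mul]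
  simp

theorem rate_edge (hc : Real.cos (A * Real.pi) ≠ 0) (hσ : σ ^ 2 = 1)
    (hE : σ * eta α E = |Real.cos (A * Real.pi)|) : rate A α E = 1 := by
  rw [rate, ← sign_mul_eq hσ (by rw [hE]; positivity), hE, div_self (abs_pos.2 hc).ne', growth_one]

/-- Continuity reaches the band edges: the bounds that keep the ratios positive need only λ ≥ 1. -/
theorem IsWeak.continuousOn_gapRatio (hw : IsWeak A α n a b ε K) (hσ : σ ^ 2 = 1)
    (hc : Real.cos (A * Real.pi) ≠ 0) {j : ℕ} (hj : j ≤ n + 1) :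
    ContinuousOn (fun E => gapRatio A α n a b ε σ E j)
      {E | |Real.cos (A * Real.pi)| ≤ |eta α E|} := by
  induction j with
  | zero => exact (continuous_rate A α).continuousOn
  | succ j ih =>
    have hd : Continuous fun E => diagPert (perturb α n b ε) A α (gapSign A σ) E (j + 1 : ℤ) := by
      unfold diagPert
      have := continuous_sPi
      fun_prop
    refine ContinuousOn.sub (((continuous_rate A α).continuousOn.add
      ((continuous_rate A α).continuousOn.inv₀ fun E hE => ?_)).add hd.continuousOn)
      (continuousOn_const.div (ih (by omega)) fun E hE => ?_)
    · linarith [one_le_rate hc hE]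
    · exact (hw.gapRatio_pos hσ hc hE (by omega)).ne'

theorem IsWeak.continuousOn_matching (hw : IsWeak A α n a b ε K) (hσ : σ ^ 2 = 1)
    (hc : Real.cos (A * Real.pi) ≠ 0) :
    ContinuousOn (matching A α n a b ε σ) {E | |Real.cos (A * Real.pi)| ≤ |eta α E|} := by
  have h0 : ∀ E ∈ {E | |Real.cos (A * Real.pi)| ≤ |eta α E|}, rate A α E ≠ 0 := fun E hE => by
    linarith [one_le_rate hc hE]
  exact ((hw.continuousOn_gapRatio hσ hc le_rfl).div (continuous_rate A α).continuousOn h0).sub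
    (((continuous_rate A α).continuousOn.pow 2).inv₀ fun E hE => pow_ne_zero 2 (h0 E hE))

/-- A gap contains an eigenvalue if the first order coefficient is negative at its edge. -/
theorem eventually_exists_isEigenvalue (hc : Real.cos (A * Real.pi) ≠ 0)
    (hc1 : |Real.cos (A * Real.pi)| < 1) (α : ℝ) (n : ℕ) (a b : ℤ → ℝ) {θ : ℝ} (hθ : 0 < θ) :
    ∀ᶠ ε in 𝓝[>] (0 : ℝ), ∀ σ m, σ ^ 2 = 1 → ∀ e ∈ energyInterval m,
      σ * eta α e = |Real.cos (A * Real.pi)| →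
      slope A α σ e (∑ j ∈ Finset.Icc (1 : ℤ) n, b j) (∑ j ∈ Finset.Icc (1 : ℤ) n, a j) ≤ -θ →
      ∃ E ∈ gapSet A α σ m, IsEigenvalue (perturbedLaplacian A α n a b ε) E := by
  obtain ⟨K, hK, hw⟩ := exists_isWeak hc α n a b
  obtain ⟨Θ, hΘ, hs⟩ := exists_abs_slope_le hc α (∑ j ∈ Finset.Icc (1 : ℤ) n, b j)
    (∑ j ∈ Finset.Icc (1 : ℤ) n, a j)
  obtain ⟨δ, hδ, hd⟩ := exists_rate_gap hc hc1 α
  filter_upwards [hw, eventually_mul_lt K hθ, eventually_mul_lt (2 * (Θ + K)) hδ,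
    eventually_mul_lt 1 one_pos] with ε hw h1 h2 h3 σ m hσ e he het hsl
  have h0 := hw.pos
  have h4 := hw.small
  obtain ⟨hm1, hm2⟩ := midGap_mem hc1
  obtain ⟨E₁, hE₁, hE₁t⟩ := exists_sign_mul_eta α m hσ hm2
  have hE₁g : E₁ ∈ gapSet A α σ m := ⟨hE₁, by rwa [hE₁t]⟩
  have hpos := (mem_gapSet_iff hc1 he hσ het hE₁).1 hE₁g
  have hea : |Real.cos (A * Real.pi)| ≤ |eta α e| := het ▸ sign_mul_le hσ _
  have hE₁a := hE₁g.2.le.trans (sign_mul_le hσ _)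
  -- At the edge λ = 1, so only ε · slope and an error Kε² are left.
  have neg : matching A α n a b ε σ e < 0 := by
    have hm := (abs_le.1 (hw.matching_bound σ e hσ hea)).2
    rw [rate_edge hc hσ het] at hm
    have h5 := mul_le_mul_of_nonneg_left hsl h0.le
    have h6 := mul_lt_mul_of_pos_right h1 h0
    norm_num at hm
    nlinarith
  have pos : 0 < matching A α n a b ε σ E₁ := by
    have hm := (abs_le.1 (hw.matching_bound σ E₁ hσ hE₁a)).1
    have hx := inv_rate_sq_le_one hc hE₁a
    have h5 : K * ε * (1 - (rate A α E₁ ^ 2)⁻¹) ≤ 1 / 2 * (1 - (rate A α E₁ ^ 2)⁻¹) := by gcongr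
    have h6 := hd E₁ (by rw [← hE₁t]; exact sign_mul_le hσ _)
    have h7 := mul_le_mul_of_nonneg_left (abs_le.1 (hs σ E₁ hσ hE₁a)).1 h0.le
    have h8 : K * ε * ε ≤ K * ε * 1 := by gcongr; linarith
    nlinarith
  have hin : ∀ E ∈ uIcc e E₁, E ∈ energyInterval m := fun E hE =>
    (ordConnected_energyInterval m).uIcc_subset he hE₁ hE
  have hcont : ContinuousOn (matching A α n a b ε σ) (uIcc e E₁) := by
    refine (hw.continuousOn_matching hσ hc).mono fun E hE => ?_
    -- Between the edge and a point of the gap, only the edge itself fails to lie in the gap.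
    by_cases h : E ∈ gapSet A α σ m
    · exact h.2.le.trans (sign_mul_le hσ _)
    · rw [mem_gapSet_iff hc1 he hσ het (hin E hE)] at h
      have : E = e := by
        rcases sign_mul_neg_one_pow hσ m with hs | hs <;> rw [hs] at h hpos
        · rw [uIcc_of_ge (by linarith)] at hE
          linarith [hE.2]
        · rw [uIcc_of_le (by linarith)] at hE
          linarith [hE.1]
      rw [this]
      exact hea
  rcases sign_mul_neg_one_pow hσ m with hs | hs
  · have hlt : E₁ < e := by rw [hs] at hpos; linarith
    rw [uIcc_of_ge hlt.le] at hcont hin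
    obtain ⟨E, hE, hz⟩ := intermediate_value_Ioo' hlt.le hcont ⟨neg, pos⟩
    have hg : E ∈ gapSet A α σ m := by
      rw [mem_gapSet_iff hc1 he hσ het (hin E (Ioo_subset_Icc_self hE)), hs]
      linarith [hE.2]
    exact ⟨E, hg, (hw.isEigenvalue_iff hσ hc hg).2 hz⟩
  · have hlt : e < E₁ := by rw [hs] at hpos; linarith
    rw [uIcc_of_le hlt.le] at hcont hin
    obtain ⟨E, hE, hz⟩ := intermediate_value_Ioo hlt.le hcont ⟨neg, pos⟩
    have hg : E ∈ gapSet A α σ m := by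
      rw [mem_gapSet_iff hc1 he hσ het (hin E (Ioo_subset_Icc_self hE)), hs]
      linarith [hE.1]
    exact ⟨E, hg, (hw.isEigenvalue_iff hσ hc hg).2 hz⟩

theorem abs_sPi_le_inv (hm : m ≠ 0) (hE : E ∈ energyInterval m) : |sPi E| ≤ (m : ℝ)⁻¹ := by
  have hm' : (0 : ℝ) < m := by exact_mod_cast Nat.pos_of_ne_zero hm
  have h2 : (m : ℝ) ^ 2 < E := hE.2.resolve_left hm
  have h0 : 0 < E := lt_trans (by positivity) h2
  have hk : (m : ℝ) ≤ √E := Real.le_sqrt_of_sq_le h2.le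
  rw [sPi, sn_of_pos h0, abs_div, abs_of_nonneg (Real.sqrt_nonneg E), ← one_div]
  exact div_le_div₀ zero_le_one (Real.abs_sin_le_one _) hm' hk

/-- Near the edge of a gap of the first energy interval, the coupling term does not degenerate. -/
theorem exists_le_sPi_div_rate (hc : Real.cos (A * Real.pi) ≠ 0)
    (hc1 : |Real.cos (A * Real.pi)| < 1) (α : ℝ) (hσ : σ ^ 2 = 1) :
    ∃ q > 0, ∀ E ∈ gapSet A α σ 0, σ * eta α E < midGap A → q ≤ sPi E / rate A α E := by
  obtain ⟨hm1, hm2⟩ := midGap_mem hc1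
  obtain ⟨E₁, hE₁, hE₁t⟩ := exists_sign_mul_eta α 0 hσ hm2
  obtain ⟨e, he, het⟩ := exists_sign_mul_eta α 0 hσ (t := |Real.cos (A * Real.pi)|)
    (by rwa [abs_abs])
  -- The part of the gap with ση below `midGap A` lies between e and E₁, a compact interval even in
  -- the gap unbounded below. The maximum with 1 keeps the denominator nonzero and changes nothing
  -- on the gap, where λ ≥ 1.
  have hcont : ContinuousOn (fun E => sPi E / max 1 (rate A α E)) (uIcc e E₁) := by
    have h1 := continuous_rate A α
    have h2 := continuous_sPi
    exact (h2.div (by fun_prop) fun E => by positivity).continuousOn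
  obtain ⟨E₂, hE₂, hmin⟩ := isCompact_uIcc.exists_isMinOn nonempty_uIcc hcont
  have hE₂' := (ordConnected_energyInterval 0).uIcc_subset he hE₁ hE₂
  have hs := sPi_sign hE₂'
  rw [pow_zero, one_mul] at hs
  refine ⟨sPi E₂ / max 1 (rate A α E₂), by positivity, fun E hE hlt => ?_⟩
  have h1 := (mem_gapSet_iff hc1 he hσ het hE.1).1 hE
  have h2 := eta_sub_pos_iff (abs_sign_mul_lt hσ hm2) hE₁ (eq_sign_mul hσ hE₁t) hE.1 hσ
  have h3 : ¬ 0 < σ * (eta α E - σ * midGap A) := by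
    rw [mul_sub, ← mul_assoc, ← pow_two, hσ, one_mul, sub_pos]
    exact not_lt.2 hlt.le
  have hmem : E ∈ uIcc e E₁ := by
    rw [h2] at h3
    rw [mem_uIcc]
    rcases sign_mul_neg_one_pow hσ 0 with h | h <;> rw [h] at h1 h3
    · exact Or.inr ⟨by linarith, by linarith⟩
    · exact Or.inl ⟨by linarith, by linarith⟩
  have : sPi E₂ / max 1 (rate A α E₂) ≤ sPi E / max 1 (rate A α E) := hmin hmem
  rwa [max_eq_right (one_le_rate hc (hE.2.le.trans (sign_mul_le hσ _)))] at this

end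

/-! ### The enumeration of the gaps -/

/-- The sign of `η` on the gap with number `k + 1`. -/
def gapEtaSign (k : ℕ) : ℝ := (-1) ^ (k + k / 2)

/-- The gap with number `k + 1`. -/
def gap (A α : ℝ) (k : ℕ) : Set ℝ := gapSet A α (gapEtaSign k) (k / 2)

theorem gapEtaSign_sq (k : ℕ) : gapEtaSign k ^ 2 = 1 := by
  rw [gapEtaSign, ← pow_mul, mul_comm, pow_mul]
  simp

/-- The energy interval m holds the gaps k = 2m and k = 2m + 1; η has the sign (-1)^m on the lower
and the opposite sign on the upper one. Times the sign (-1)^m of sPi this leaves (-1)^k. -/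
theorem gapEtaSign_mul (k : ℕ) : gapEtaSign k * (-1) ^ (k / 2) = (-1) ^ k := by
  rw [gapEtaSign, pow_add, mul_assoc, ← pow_add, ← two_mul, pow_mul]
  simp

theorem gapEtaSign_mul_sPi {k : ℕ} {E : ℝ} (hE : E ∈ energyInterval (k / 2)) :
    gapEtaSign k * sPi E = (-1) ^ k * |sPi E| := by
  have h := sPi_sign hE
  have h2 : ((-1 : ℝ) ^ (k / 2)) ^ 2 = 1 := by rw [← pow_mul, mul_comm, pow_mul]; simp
  rw [← sign_mul_eq h2 h.le, ← mul_assoc, ← gapEtaSign_mul, mul_assoc (gapEtaSign k), ← pow_two, h2,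
    mul_one]

theorem energyInterval_lt {m m' : ℕ} (h : m < m') {x y : ℝ} (hx : x ∈ energyInterval m)
    (hy : y ∈ energyInterval m') : x < y := by
  have h1 : (m' : ℝ) ^ 2 < y := hy.2.resolve_left (by omega)
  have h2 : ((m : ℝ) + 1) ^ 2 ≤ (m' : ℝ) ^ 2 := by
    have : (m : ℝ) + 1 ≤ m' := by exact_mod_cast h
    gcongr
  linarith [hx.1]

section

variable {A α : ℝ}

theorem exists_gapSet_eq_gap {σ : ℝ} (hσ : σ ^ 2 = 1) (m : ℕ) : ∃ k, gapSet A α σ m = gap A α k := by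
  have hu : ((-1 : ℝ) ^ m) ^ 2 = 1 := by rw [← pow_mul, mul_comm, pow_mul]; simp
  have key : ∀ k, k / 2 = m → σ * (-1) ^ m = (-1) ^ k → gapSet A α σ m = gap A α k := by
    intro k hk h
    have h1 := gapEtaSign_mul k
    rw [hk, ← h] at h1
    have h2 : gapEtaSign k = σ := by
      refine mul_right_cancel₀ (fun h0 => ?_) h1
      rw [h0] at hu
      norm_num at hu
    rw [gap, hk, h2]
  rcases sign_mul_neg_one_pow hσ m with h | h
  · exact ⟨2 * m, key _ (by omega) (by rw [h, pow_mul]; simp)⟩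
  · exact ⟨2 * m + 1, key _ (by omega) (by rw [h, pow_succ, pow_mul]; simp)⟩

/-- Two gaps in one energy interval lie on opposite sides of the zero of η there. -/
theorem gap_lt {k l : ℕ} (h : k < l) {x y : ℝ} (hx : x ∈ gap A α k) (hy : y ∈ gap A α l) :
    x < y := by
  rcases (Nat.div_le_div_right h.le : k / 2 ≤ l / 2).lt_or_eq with h1 | h1
  · exact energyInterval_lt h1 hx.1 hy.1
  · have hk : (-1 : ℝ) ^ k = 1 := Even.neg_one_pow (by rw [Nat.even_iff]; omega)
    have hl : (-1 : ℝ) ^ l = -1 := Odd.neg_one_pow (by rw [Nat.odd_iff]; omega)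
    have hky := gapEtaSign_mul k
    have hly := gapEtaSign_mul l
    obtain ⟨z, hz, hz0⟩ := exists_eta_eq α (k / 2) (t := 0) (by simp)
    have ex := (eta_sub_pos_iff (by simp) hz hz0 hx.1 (gapEtaSign_sq k)).1 (by
      rw [sub_zero]; exact (abs_nonneg _).trans_lt hx.2)
    have ey := (eta_sub_pos_iff (by simp) (h1 ▸ hz) hz0 hy.1 (gapEtaSign_sq l)).1 (by
      rw [sub_zero]; exact (abs_nonneg _).trans_lt hy.2)
    rw [hky, hk] at ex
    rw [hly, hl] at ey
    linarith

theorem exists_edge (hc1 : |Real.cos (A * Real.pi)| < 1) (α : ℝ) (k : ℕ) :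
    ∃ e ∈ energyInterval (k / 2), gapEtaSign k * eta α e = |Real.cos (A * Real.pi)| :=
  exists_sign_mul_eta α _ (gapEtaSign_sq k) (by rwa [abs_abs])

theorem gap_nonempty (hc1 : |Real.cos (A * Real.pi)| < 1) (α : ℝ) (k : ℕ) :
    (gap A α k).Nonempty := by
  obtain ⟨hm1, hm2⟩ := midGap_mem hc1
  obtain ⟨E, hE, h⟩ := exists_sign_mul_eta α (k / 2) (gapEtaSign_sq k) hm2
  exact ⟨E, hE, by rwa [h]⟩

theorem gap_injective (hc1 : |Real.cos (A * Real.pi)| < 1) (α : ℝ) :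
    Function.Injective (gap A α) := by
  intro k l h
  obtain ⟨x, hx⟩ := gap_nonempty hc1 α k
  by_contra hne
  rcases lt_or_gt_of_ne hne with hlt | hlt
  · exact lt_irrefl _ (gap_lt hlt hx (h ▸ hx))
  · exact lt_irrefl _ (gap_lt hlt (h ▸ hx) hx)

theorem ordConnected_gap (hc1 : |Real.cos (A * Real.pi)| < 1) (α : ℝ) (k : ℕ) :
    (gap A α k).OrdConnected := by
  obtain ⟨e, he, het⟩ := exists_edge hc1 α k
  refine ⟨fun x hx y hy z hz => ?_⟩
  have hzm := (ordConnected_energyInterval _).out hx.1 hy.1 hz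
  rw [gap, mem_gapSet_iff hc1 he (gapEtaSign_sq k) het hx.1] at hx
  rw [gap, mem_gapSet_iff hc1 he (gapEtaSign_sq k) het hy.1] at hy
  rw [gap, mem_gapSet_iff hc1 he (gapEtaSign_sq k) het hzm]
  rcases sign_mul_neg_one_pow (gapEtaSign_sq k) (k / 2) with h | h <;> rw [h] at hx hy ⊢
  · linarith [hz.2]
  · linarith [hz.1]

/-- The complement of the essential spectrum, by its description in terms of `η`. -/
def resolventSet (A α : ℝ) : Set ℝ := {E | sPi E ≠ 0 ∧ |Real.cos (A * Real.pi)| < |eta α E|}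

theorem gap_subset_resolventSet (k : ℕ) : gap A α k ⊆ resolventSet A α := fun _ hE =>
  ⟨sPi_ne_zero hE.1, hE.2.trans_le (sign_mul_le (gapEtaSign_sq k) _)⟩

theorem exists_mem_gap {E : ℝ} (hE : E ∈ resolventSet A α) : ∃ k, E ∈ gap A α k := by
  rcases exists_energyInterval E with ⟨m, rfl⟩ | ⟨m, hm⟩
  · exact absurd (sPi_natCast_sq m) hE.1
  · obtain ⟨σ, hσ, h⟩ : ∃ σ : ℝ, σ ^ 2 = 1 ∧ σ * eta α E = |eta α E| := by
      rcases le_total 0 (eta α E) with h | h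
      · exact ⟨1, by simp, by rw [one_mul, abs_of_nonneg h]⟩
      · exact ⟨-1, by simp, by rw [neg_one_mul, abs_of_nonpos h]⟩
    obtain ⟨k, hk⟩ := exists_gapSet_eq_gap (A := A) (α := α) hσ m
    exact ⟨k, hk ▸ ⟨hm, by rw [h]; exact hE.2⟩⟩

/-- A connected set in the resolvent set can pass neither a flat band nor the band edge e, so it
cannot leave the gap it meets. -/
theorem connectedComponentIn_resolventSet (hc1 : |Real.cos (A * Real.pi)| < 1) {k : ℕ} {E : ℝ}
    (hE : E ∈ gap A α k) : connectedComponentIn (resolventSet A α) E = gap A α k := by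
  apply Subset.antisymm
  · intro y hy
    have hord := (isPreconnected_connectedComponentIn (F := resolventSet A α) (x := E)).ordConnected
    have hsub : uIcc E y ⊆ resolventSet A α :=
      (hord.uIcc_subset (mem_connectedComponentIn (gap_subset_resolventSet k hE)) hy).trans
        (connectedComponentIn_subset _ _)
    have hym : y ∈ energyInterval (k / 2) := by
      refine ⟨?_, ?_⟩
      · by_contra! h
        exact (hsub (mem_uIcc.2 (Or.inl ⟨hE.1.1.le, h⟩))).1 (sPi_natCast_sq _)
      · by_contra! h
        obtain ⟨m, hm⟩ := Nat.exists_eq_succ_of_ne_zero h.1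
        have h1 := hE.1.2.resolve_left h.1
        have h2 := (hsub (mem_uIcc.2 (Or.inr ⟨h.2, h1.le⟩))).1
        rw [hm] at h2
        push_cast at h2
        exact h2 (sPi_natCast_sq _)
    obtain ⟨e, he, het⟩ := exists_edge hc1 α k
    have hσ := gapEtaSign_sq k
    have hne : e ∉ uIcc E y := fun h => by
      have := (hsub h).2
      rw [← het, sign_mul_eq hσ (by rw [het]; positivity)] at this
      exact lt_irrefl _ this
    rw [gap, mem_gapSet_iff hc1 he hσ het hE.1] at hE
    rw [gap, mem_gapSet_iff hc1 he hσ het hym]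
    rw [mem_uIcc, not_or, not_and_or, not_and_or] at hne
    rcases sign_mul_neg_one_pow hσ (k / 2) with h | h <;> rw [h] at hE ⊢ <;>
      obtain ⟨h1 | h1, h2 | h2⟩ := hne <;> linarith
  · exact (ordConnected_gap hc1 α k).isPreconnected.subset_connectedComponentIn hE
      (gap_subset_resolventSet k)

end

section

variable {A α : ℝ} {T : ChainL2 →ₗ.[ℂ] ChainL2}

theorem gaps_eq_range (hc1 : |Real.cos (A * Real.pi)| < 1)
    (hT : (essentialSpectrum T)ᶜ = resolventSet A α) : gaps T = range (gap A α) := by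
  ext G
  rw [gaps, hT]
  constructor
  · rintro ⟨x, hx, rfl⟩
    obtain ⟨k, hk⟩ := exists_mem_gap hx
    exact ⟨k, (connectedComponentIn_resolventSet hc1 hk).symm⟩
  · rintro ⟨k, rfl⟩
    obtain ⟨x, hx⟩ := gap_nonempty hc1 α k
    exact ⟨x, gap_subset_resolventSet k hx, (connectedComponentIn_resolventSet hc1 hx).symm⟩

theorem gapNumber_gap (hc1 : |Real.cos (A * Real.pi)| < 1)
    (hT : (essentialSpectrum T)ᶜ = resolventSet A α) (k : ℕ) :
    gapNumber T (gap A α k) = (k + 1 : ℕ) := by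
  have h : {G' ∈ gaps T | ∀ x ∈ G', ∀ y ∈ gap A α k, x < y}
      = gap A α '' (Finset.range k : Set ℕ) := by
    rw [gaps_eq_range hc1 hT]
    ext G
    constructor
    · rintro ⟨⟨l, rfl⟩, hl⟩
      refine ⟨l, ?_, rfl⟩
      rw [Finset.coe_range, mem_Iio]
      by_contra! hkl
      obtain ⟨x, hx⟩ := gap_nonempty hc1 α l
      obtain ⟨y, hy⟩ := gap_nonempty hc1 α k
      rcases hkl.lt_or_eq with h | rfl
      · exact lt_asymm (hl x hx y hy) (gap_lt h hy hx)
      · exact lt_irrefl _ (hl x hx x hx)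
    · rintro ⟨l, hl, rfl⟩
      rw [Finset.coe_range, mem_Iio] at hl
      exact ⟨mem_range_self l, fun x hx y hy => gap_lt hl hx hy⟩
  rw [gapNumber, h, (gap_injective hc1 α).injOn.encard_image, encard_coe_eq_coe_finsetCard,
    Finset.card_range]
  push_cast
  rfl

end

/-- The right side is independent of ε, hence so are the gaps and their numbers. -/
theorem compl_essentialSpectrum {A : ℝ} (hc : Real.cos (A * Real.pi) ≠ 0) (α : ℝ) (n : ℕ)
    (a b : ℤ → ℝ) (ε : ℝ) :
    (essentialSpectrum (perturbedLaplacian A α n a b ε))ᶜ = resolventSet A α := by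
  ext E
  rw [mem_compl_iff, perturbedLaplacian,
    essentialSpectrum_laplacian perturb_of_notMem perturb_of_notMem hc, not_or, not_le]
  rfl

/-! ### Eigenvalues in the gaps of the perturbed chain -/

section

variable {A α : ℝ} {n : ℕ} {a b : ℤ → ℝ}

/-- A positive lower bound of the first order coefficient excludes eigenvalues. -/
theorem eventually_noGapEigenvaluesExcept (hc : Real.cos (A * Real.pi) ≠ 0)
    (hc1 : |Real.cos (A * Real.pi)| < 1) {F : Finset ℕ} {θ : ℝ} (hθ : 0 < θ)
    (h : ∀ k, k + 1 ∉ F → ∀ E ∈ gap A α k, θ ≤ slope A α (gapEtaSign k) E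
      (∑ j ∈ Finset.Icc (1 : ℤ) n, b j) (∑ j ∈ Finset.Icc (1 : ℤ) n, a j)) :
    ∀ᶠ ε in 𝓝[>] (0 : ℝ), NoGapEigenvaluesExcept (perturbedLaplacian A α n a b ε) F := by
  obtain ⟨K, hK, hw⟩ := exists_isWeak hc α n a b
  filter_upwards [hw, eventually_not_isEigenvalue hc hc1 α n a b hθ,
    eventually_eigenvalue_unique hc hc1 α n a b] with ε hw h1 h2 G hG
  have hT := compl_essentialSpectrum hc α n a b ε
  rw [gaps_eq_range hc1 hT] at hG
  obtain ⟨k, rfl⟩ := hG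
  have hσ := gapEtaSign_sq k
  refine ⟨⟨fun E hE => hw.isSimpleEigenvalue hσ hc hE, fun E hE E' hE' => h2 _ _ hσ E hE E' hE'⟩,
    fun hF E hE => h1 _ _ hσ E hE fun _ => h k (fun hk => ?_) E hE⟩
  exact hF _ hk (gapNumber_gap hc1 hT k)

/-- A negative upper bound of the first order coefficient at an edge yields an eigenvalue. -/
theorem eventually_exists_isEigenvalue_gap (hc : Real.cos (A * Real.pi) ≠ 0)
    (hc1 : |Real.cos (A * Real.pi)| < 1) {θ : ℝ} (hθ : 0 < θ) :
    ∀ᶠ ε in 𝓝[>] (0 : ℝ), ∀ k, ∀ e ∈ energyInterval (k / 2),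
      gapEtaSign k * eta α e = |Real.cos (A * Real.pi)| →
      slope A α (gapEtaSign k) e
        (∑ j ∈ Finset.Icc (1 : ℤ) n, b j) (∑ j ∈ Finset.Icc (1 : ℤ) n, a j) ≤ -θ →
      ∃ E ∈ gap A α k, IsEigenvalue (perturbedLaplacian A α n a b ε) E := by
  filter_upwards [eventually_exists_isEigenvalue hc hc1 α n a b hθ] with ε h k e he het hs
  exact h _ _ (gapEtaSign_sq k) e he het hs

theorem eventually_oneGapEigenvalueExcept (hc : Real.cos (A * Real.pi) ≠ 0)
    (hc1 : |Real.cos (A * Real.pi)| < 1) {F : Finset ℕ} {θ : ℝ} (hθ : 0 < θ)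
    (h : ∀ k, k + 1 ∉ F → ∀ e ∈ energyInterval (k / 2),
      |Real.cos (A * Real.pi)| ≤ |eta α e| → slope A α (gapEtaSign k) e
      (∑ j ∈ Finset.Icc (1 : ℤ) n, b j) (∑ j ∈ Finset.Icc (1 : ℤ) n, a j) ≤ -θ) :
    ∀ᶠ ε in 𝓝[>] (0 : ℝ), OneGapEigenvalueExcept (perturbedLaplacian A α n a b ε) F := by
  obtain ⟨K, hK, hw⟩ := exists_isWeak hc α n a b
  filter_upwards [hw, eventually_exists_isEigenvalue_gap (a := a) (b := b) hc hc1 hθ,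
    eventually_eigenvalue_unique hc hc1 α n a b] with ε hw h1 h2 G hG hF
  have hT := compl_essentialSpectrum hc α n a b ε
  rw [gaps_eq_range hc1 hT] at hG
  obtain ⟨k, rfl⟩ := hG
  have hσ := gapEtaSign_sq k
  obtain ⟨e, he, het⟩ := exists_edge hc1 α k
  obtain ⟨E, hE, hev⟩ := h1 k e he het
    (h k (fun hk => hF _ hk (gapNumber_gap hc1 hT k)) e he (het ▸ sign_mul_le hσ _))
  exact ⟨E, hE, hw.isSimpleEigenvalue hσ hc hE hev, fun E' hE' hev' =>
    h2 _ _ hσ E' hE' E hE hev' hev⟩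

/-! ### The coupling term against the flux term -/

/-- The contribution of the magnetic potential to the first order coefficient. -/
def fluxTerm (A t : ℝ) : ℝ := 2 * Real.pi * Real.tan (A * Real.pi) * t

/-- Since σ sPi = (-1)^k |sPi|, the coupling term has the sign of s in odd-numbered gaps (k even)
and the opposite sign in even-numbered ones. -/
theorem slope_gapEtaSign {k : ℕ} {E : ℝ} (hE : E ∈ energyInterval (k / 2)) (s t : ℝ) :
    slope A α (gapEtaSign k) E s t
      = (-1) ^ k * s * (|sPi E| / (2 * |Real.cos (A * Real.pi)| * rate A α E)) + fluxTerm A t := by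
  rw [slope, gapEtaSign_mul_sPi hE, fluxTerm]
  ring

theorem fluxTerm_le_slope {k : ℕ} {E s : ℝ} (hc : Real.cos (A * Real.pi) ≠ 0)
    (hE : E ∈ energyInterval (k / 2)) (hEa : |Real.cos (A * Real.pi)| ≤ |eta α E|)
    (hs : 0 ≤ (-1) ^ k * s) (t : ℝ) : fluxTerm A t ≤ slope A α (gapEtaSign k) E s t := by
  have hl := one_le_rate hc hEa
  rw [slope_gapEtaSign hE]
  exact le_add_of_nonneg_left (mul_nonneg hs (by positivity))

theorem slope_le_fluxTerm {k : ℕ} {E s : ℝ} (hc : Real.cos (A * Real.pi) ≠ 0)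
    (hE : E ∈ energyInterval (k / 2)) (hEa : |Real.cos (A * Real.pi)| ≤ |eta α E|)
    (hs : (-1) ^ k * s ≤ 0) (t : ℝ) : slope A α (gapEtaSign k) E s t ≤ fluxTerm A t := by
  have hl := one_le_rate hc hEa
  rw [slope_gapEtaSign hE]
  exact add_le_of_nonpos_left (mul_nonpos_of_nonpos_of_nonneg hs (by positivity))

/-- In the far gaps the first order coefficient is dominated by the magnetic potential. -/
theorem exists_slope_far (hc : Real.cos (A * Real.pi) ≠ 0) (α s : ℝ) {r : ℝ} (hr : 0 < r) :
    ∃ M, ∀ k, M ≤ k / 2 → ∀ E ∈ energyInterval (k / 2), |Real.cos (A * Real.pi)| ≤ |eta α E| →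
      ∀ t, |slope A α (gapEtaSign k) E s t - fluxTerm A t| ≤ r := by
  obtain ⟨M, hM⟩ := exists_nat_gt (|s| / (2 * |Real.cos (A * Real.pi)|) / r)
  have hc' := abs_pos.2 hc
  -- M + 1 instead of M, so that the energy interval has positive index and the bound |sPi| ≤ 1/m
  -- applies.
  refine ⟨M + 1, fun k hk E hE hEa t => ?_⟩
  have hl := one_le_rate hc hEa
  have hp := abs_sPi_le_inv (by omega) hE
  have hk' : (M : ℝ) ≤ (k / 2 : ℕ) := by exact_mod_cast (by omega : M ≤ k / 2)
  have hk0 : (0 : ℝ) < (k / 2 : ℕ) := by exact_mod_cast (by omega : 0 < k / 2)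
  rw [slope_gapEtaSign hE, add_sub_cancel_right, abs_mul, abs_mul, abs_pow, abs_neg, abs_one,
    one_pow, one_mul, abs_of_nonneg (by positivity : (0 : ℝ) ≤
      |sPi E| / (2 * |Real.cos (A * Real.pi)| * rate A α E))]
  have h1 : |sPi E| / (2 * |Real.cos (A * Real.pi)| * rate A α E)
      ≤ ((k / 2 : ℕ) : ℝ)⁻¹ / (2 * |Real.cos (A * Real.pi)|) := by
    apply div_le_div₀ (by positivity) hp (by positivity)
    exact le_mul_of_one_le_right (by positivity) hl
  refine (mul_le_mul_of_nonneg_left h1 (abs_nonneg s)).trans ?_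
  rw [div_lt_iff₀ hr] at hM
  have h2 : |s| * (((k / 2 : ℕ) : ℝ)⁻¹ / (2 * |Real.cos (A * Real.pi)|))
      = |s| / (2 * |Real.cos (A * Real.pi)|) * ((k / 2 : ℕ) : ℝ)⁻¹ := by ring
  rw [h2, ← div_eq_mul_inv, div_le_iff₀ hk0]
  nlinarith

/-- The coefficient is controlled by the magnetic potential in all gaps if the latter is large. -/
theorem exists_slope_bound (hc : Real.cos (A * Real.pi) ≠ 0) (α s : ℝ) :
    ∃ B > 0, ∀ k, ∀ E ∈ energyInterval (k / 2), |Real.cos (A * Real.pi)| ≤ |eta α E| →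
      ∀ t, |slope A α (gapEtaSign k) E s t - fluxTerm A t| ≤ B := by
  obtain ⟨S, hS0, hS⟩ := exists_sPi_bound α
  refine ⟨S * |s| / (2 * |Real.cos (A * Real.pi)|) + 1, by positivity, fun k E hE hEa t => ?_⟩
  rw [slope, fluxTerm, add_sub_cancel_right]
  exact (abs_slope_term_le hS0 hS hc hEa (gapEtaSign_sq k)).trans (by linarith)

/-- The gap numbers `2m + 1 + p` with `m < M`. -/
def initialNumbers (p M : ℕ) : Finset ℕ := (Finset.range M).image fun m => 2 * m + 1 + p

theorem le_of_notMem_initialNumbers {p M k : ℕ} (hp : k % 2 = p)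
    (h : k + 1 ∉ initialNumbers p M) : M ≤ k / 2 := by
  by_contra! hlt
  refine h (Finset.mem_image.2 ⟨k / 2, Finset.mem_range.2 hlt, by omega⟩)

theorem odd_of_mem_initialNumbers {M m : ℕ} (h : m ∈ initialNumbers 0 M) : Odd m := by
  obtain ⟨i, -, rfl⟩ := Finset.mem_image.1 h
  exact ⟨i, rfl⟩

theorem even_of_mem_initialNumbers {M m : ℕ} (h : m ∈ initialNumbers 1 M) : Even m := by
  obtain ⟨i, -, rfl⟩ := Finset.mem_image.1 h
  exact ⟨i + 1, by ring⟩

/-- Off the parity p the coupling term supports the positive flux term; for the parity p it is at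
most half of it from some gap on. Only finitely many gaps of that parity remain. -/
theorem exists_noGapEigenvaluesExcept (hc : Real.cos (A * Real.pi) ≠ 0)
    (hc1 : |Real.cos (A * Real.pi)| < 1) (α : ℝ)
    (ht : 0 < fluxTerm A (∑ j ∈ Finset.Icc (1 : ℤ) n, a j)) {p : ℕ}
    (hp : ∀ k : ℕ, k % 2 ≠ p → 0 ≤ (-1) ^ k * ∑ j ∈ Finset.Icc (1 : ℤ) n, b j) :
    ∃ M, ∀ᶠ ε in 𝓝[>] (0 : ℝ),
      NoGapEigenvaluesExcept (perturbedLaplacian A α n a b ε) (initialNumbers p M) := by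
  obtain ⟨M, hM⟩ := exists_slope_far hc α (∑ j ∈ Finset.Icc (1 : ℤ) n, b j) (half_pos ht)
  refine ⟨M, eventually_noGapEigenvaluesExcept hc hc1 (half_pos ht) fun k hk E hE => ?_⟩
  have hEa := hE.2.le.trans (sign_mul_le (gapEtaSign_sq k) _)
  by_cases h : k % 2 = p
  · have := (abs_le.1 (hM k (le_of_notMem_initialNumbers h hk) E hE.1 hEa
      (∑ j ∈ Finset.Icc (1 : ℤ) n, a j))).1
    linarith
  · linarith [fluxTerm_le_slope hc hE.1 hEa (hp k h) (∑ j ∈ Finset.Icc (1 : ℤ) n, a j)]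

/-- The same dichotomy with a negative flux term, now giving a negative slope and so an eigenvalue.
-/
theorem exists_oneGapEigenvalueExcept (hc : Real.cos (A * Real.pi) ≠ 0)
    (hc1 : |Real.cos (A * Real.pi)| < 1) (α : ℝ)
    (ht : fluxTerm A (∑ j ∈ Finset.Icc (1 : ℤ) n, a j) < 0) {p : ℕ}
    (hp : ∀ k : ℕ, k % 2 ≠ p → (-1) ^ k * ∑ j ∈ Finset.Icc (1 : ℤ) n, b j ≤ 0) :
    ∃ M, ∀ᶠ ε in 𝓝[>] (0 : ℝ),
      OneGapEigenvalueExcept (perturbedLaplacian A α n a b ε) (initialNumbers p M) := by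
  have ht' := half_pos (neg_pos.2 ht)
  obtain ⟨M, hM⟩ := exists_slope_far hc α (∑ j ∈ Finset.Icc (1 : ℤ) n, b j) ht'
  refine ⟨M, eventually_oneGapEigenvalueExcept hc hc1 ht' fun k hk E hE hEa => ?_⟩
  by_cases h : k % 2 = p
  · have := (abs_le.1 (hM k (le_of_notMem_initialNumbers h hk) E hE hEa
      (∑ j ∈ Finset.Icc (1 : ℤ) n, a j))).2
    linarith
  · linarith [slope_le_fluxTerm hc hE hEa (hp k h) (∑ j ∈ Finset.Icc (1 : ℤ) n, a j)]

end

/-! ### Signs and sizes of the two terms -/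

theorem neg_one_pow_mul_of_even {k : ℕ} (hk : k % 2 ≠ 1) (s : ℝ) : (-1) ^ k * s = s := by
  rw [Even.neg_one_pow (by rw [Nat.even_iff]; omega), one_mul]

theorem neg_one_pow_mul_of_odd {k : ℕ} (hk : k % 2 ≠ 0) (s : ℝ) : (-1) ^ k * s = -s := by
  rw [Odd.neg_one_pow (by rw [Nat.odd_iff]; omega), neg_one_mul]

theorem abs_cos_lt_one {A : ℝ} (hA : ∀ m : ℤ, A ≠ m) : |Real.cos (A * Real.pi)| < 1 := by
  have hs : Real.sin (A * Real.pi) ≠ 0 := by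
    rw [Ne, Real.sin_eq_zero_iff]
    rintro ⟨m, hm⟩
    exact hA m (mul_right_cancel₀ Real.pi_ne_zero hm).symm
  rw [← sq_lt_one_iff_abs_lt_one]
  have := Real.sin_sq_add_cos_sq (A * Real.pi)
  have := pow_pos (abs_pos.2 hs) 2
  rw [sq_abs] at this
  nlinarith

theorem cos_ne_zero_of_cot {A t : ℝ} (h : Real.cot (A * Real.pi) * t ≠ 0) :
    Real.cos (A * Real.pi) ≠ 0 := by
  rintro h0
  rw [Real.cot_eq_cos_div_sin, h0, zero_div, zero_mul] at h
  exact h rfl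

/-- tan = tan² · cot, so the flux term inherits the sign of cot(Aπ) t. -/
theorem fluxTerm_eq {A t : ℝ} (h : Real.cot (A * Real.pi) * t ≠ 0) :
    fluxTerm A t = 2 * Real.pi * Real.tan (A * Real.pi) ^ 2 * (Real.cot (A * Real.pi) * t) := by
  have hc := cos_ne_zero_of_cot h
  have hs : Real.sin (A * Real.pi) ≠ 0 := by
    intro h0
    rw [Real.cot_eq_cos_div_sin, h0, div_zero, zero_mul] at h
    exact h rfl
  rw [fluxTerm, Real.cot_eq_cos_div_sin, Real.tan_eq_sin_div_cos]
  field_simp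

theorem tan_ne_zero_of_cot {A t : ℝ} (h : Real.cot (A * Real.pi) * t ≠ 0) :
    Real.tan (A * Real.pi) ≠ 0 := by
  rw [Real.tan_eq_sin_div_cos]
  refine div_ne_zero (fun h0 => ?_) (cos_ne_zero_of_cot h)
  rw [Real.cot_eq_cos_div_sin, h0, div_zero, zero_mul] at h
  exact h rfl

theorem fluxTerm_pos {A t : ℝ} (h : 0 < Real.cot (A * Real.pi) * t) : 0 < fluxTerm A t := by
  rw [fluxTerm_eq h.ne']
  have := tan_ne_zero_of_cot h.ne'
  positivity

theorem fluxTerm_neg {A t : ℝ} (h : Real.cot (A * Real.pi) * t < 0) : fluxTerm A t < 0 := by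
  rw [fluxTerm_eq h.ne]
  have := tan_ne_zero_of_cot h.ne
  exact mul_neg_of_pos_of_neg (by positivity) h

theorem abs_fluxTerm (A t : ℝ) :
    |fluxTerm A t| = 2 * Real.pi * |Real.tan (A * Real.pi)| * |t| := by
  rw [fluxTerm, abs_mul, abs_mul, abs_of_pos (by positivity : 0 < 2 * Real.pi)]

theorem abs_fluxTerm_lt {A t r : ℝ} (h : |t| < r / (2 * Real.pi * (|Real.tan (A * Real.pi)| + 1))) :
    |fluxTerm A t| < r := by
  rw [lt_div_iff₀ (by positivity)] at h
  rw [abs_fluxTerm]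
  have := mul_nonneg Real.pi_pos.le (abs_nonneg t)
  linarith

section

variable {A s : ℝ} {k : ℕ}

/-- A weak magnetic perturbation leaves an eigenvalue in a given gap where the coupling term
favours it. -/
theorem exists_isEigenvalue_of_abs_lt (hc : Real.cos (A * Real.pi) ≠ 0)
    (hc1 : |Real.cos (A * Real.pi)| < 1) (α : ℝ) (hk : (-1) ^ k * s < 0) :
    ∃ c > 0, ∀ (n : ℕ) (a b : ℤ → ℝ), ∑ j ∈ Finset.Icc (1 : ℤ) n, b j = s →
      |∑ j ∈ Finset.Icc (1 : ℤ) n, a j| < c →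
        ∀ᶠ ε in 𝓝[>] (0 : ℝ), ∃ G ∈ gaps (perturbedLaplacian A α n a b ε),
          gapNumber (perturbedLaplacian A α n a b ε) G = (k + 1 : ℕ) ∧
          ∃ E ∈ G, IsEigenvalue (perturbedLaplacian A α n a b ε) E := by
  obtain ⟨e, he, het⟩ := exists_edge hc1 α k
  have hs := abs_pos.2 (sPi_ne_zero he)
  have hc' := abs_pos.2 hc
  -- The size of the negative coupling term at the band edge, where λ = 1.
  set r := -((-1) ^ k * s) * (|sPi e| / (2 * |Real.cos (A * Real.pi)|)) with hr
  have hr0 : 0 < r := mul_pos (neg_pos.2 hk) (by positivity)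
  -- This bound on |∑ A_j| makes the flux term smaller than r/2, so the slope at the edge is at most
  -- -r/2.
  refine ⟨r / 2 / (2 * Real.pi * (|Real.tan (A * Real.pi)| + 1)), by positivity,
    fun n a b hb ha => ?_⟩
  have hf := (abs_lt.1 (abs_fluxTerm_lt ha)).2
  filter_upwards [eventually_exists_isEigenvalue_gap (α := α) (a := a) (b := b) hc hc1
    (half_pos hr0)] with ε h
  have hT := compl_essentialSpectrum hc α n a b ε
  refine ⟨gap A α k, by rw [gaps_eq_range hc1 hT]; exact mem_range_self k, gapNumber_gap hc1 hT k,
    h k e he het ?_⟩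
  rw [slope_gapEtaSign he, hb, rate_edge hc (gapEtaSign_sq k) het, mul_one]
  linarith

/-- A weak magnetic perturbation does not create an eigenvalue in one of the first two gaps where
the coupling term excludes it. -/
theorem exists_noEigenvalueIn_of_abs_lt (hc : Real.cos (A * Real.pi) ≠ 0)
    (hc1 : |Real.cos (A * Real.pi)| < 1) (α : ℝ) (hk2 : k / 2 = 0) (hk : 0 < (-1) ^ k * s) :
    ∃ c > 0, ∀ (n : ℕ) (a b : ℤ → ℝ), ∑ j ∈ Finset.Icc (1 : ℤ) n, b j = s →
      |∑ j ∈ Finset.Icc (1 : ℤ) n, a j| < c →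
        ∀ᶠ ε in 𝓝[>] (0 : ℝ), ∀ G ∈ gaps (perturbedLaplacian A α n a b ε),
          gapNumber (perturbedLaplacian A α n a b ε) G = (k + 1 : ℕ) →
          NoEigenvalueIn (perturbedLaplacian A α n a b ε) G := by
  obtain ⟨q, hq, hqb⟩ := exists_le_sPi_div_rate hc hc1 α (gapEtaSign_sq k)
  have hc' := abs_pos.2 hc
  -- A lower bound for the coupling term near the edge. It is uniform there, because q bounds sPi/λ
  -- from below.
  set r := (-1) ^ k * s * (q / (2 * |Real.cos (A * Real.pi)|)) with hr
  have hr0 : 0 < r := mul_pos hk (by positivity)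
  refine ⟨r / 2 / (2 * Real.pi * (|Real.tan (A * Real.pi)| + 1)), by positivity,
    fun n a b hb ha => ?_⟩
  have hf := (abs_lt.1 (abs_fluxTerm_lt ha)).1
  filter_upwards [eventually_not_isEigenvalue hc hc1 α n a b (half_pos hr0)] with ε h G hG hGk
  have hT := compl_essentialSpectrum hc α n a b ε
  rw [gaps_eq_range hc1 hT] at hG
  obtain ⟨l, rfl⟩ := hG
  rw [gapNumber_gap hc1 hT] at hGk
  obtain rfl : l = k := by
    have : l + 1 = k + 1 := by exact_mod_cast hGk
    omega
  intro E hE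
  refine h _ _ (gapEtaSign_sq l) E hE fun hlt => ?_
  rw [slope_gapEtaSign hE.1, hb]
  have hE0 : E ∈ gapSet A α (gapEtaSign l) 0 := hk2 ▸ hE
  have h1 : q / (2 * |Real.cos (A * Real.pi)|)
      ≤ |sPi E| / (2 * |Real.cos (A * Real.pi)| * rate A α E) := by
    rw [mul_comm (2 * |Real.cos (A * Real.pi)|) (rate A α E), ← div_div |sPi E|]
    have hl := one_lt_rate (gapEtaSign_sq l) hc hE.2
    refine div_le_div_of_nonneg_right ((hqb E hE0 hlt).trans ?_) (by positivity)
    exact div_le_div_of_nonneg_right (le_abs_self _) (by linarith)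
  have h2 := mul_le_mul_of_nonneg_left h1 hk.le
  linarith

/-- A strong magnetic perturbation dominates the coupling term in all gaps. -/
theorem exists_bound_of_tan_ne_zero (hc : Real.cos (A * Real.pi) ≠ 0)
    (ht : Real.tan (A * Real.pi) ≠ 0) (α s : ℝ) :
    ∃ C > 0, ∀ t, C < |t| → ∀ k, ∀ E ∈ energyInterval (k / 2),
      |Real.cos (A * Real.pi)| ≤ |eta α E| →
      |slope A α (gapEtaSign k) E s t - fluxTerm A t| + 1 ≤ |fluxTerm A t| := by
  obtain ⟨B, hB0, hB⟩ := exists_slope_bound hc α s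
  -- Beyond this size of t the flux term exceeds B + 1 in absolute value, while the coupling term is
  -- at most B in every gap.
  refine ⟨(B + 1) / (2 * Real.pi * |Real.tan (A * Real.pi)|), by positivity,
    fun t hlt k E hE hEa => ?_⟩
  rw [div_lt_iff₀ (by positivity)] at hlt
  have := hB k E hE hEa t
  rw [abs_fluxTerm]
  linarith

end

end RingChain

end

/-! ### Assembly of the theorem -/

theorem mainTheorem7 (A α : ℝ) (hA : ∀ m : ℤ, A ≠ m) :
    -- The case of a positive sign: finitely many gaps may contain an eigenvalue.
    (∀ (n : ℕ) (a b : ℤ → ℝ),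
      0 < Real.cot (A * Real.pi) * ∑ j ∈ Finset.Icc (1 : ℤ) n, a j →
      (0 < ∑ j ∈ Finset.Icc (1 : ℤ) n, b j →
        ∃ F : Finset ℕ, (∀ m ∈ F, Even m) ∧ ∀ᶠ ε in 𝓝[>] (0 : ℝ),
          RingChain.NoGapEigenvaluesExcept (RingChain.perturbedLaplacian A α n a b ε) F) ∧
      (∑ j ∈ Finset.Icc (1 : ℤ) n, b j < 0 →
        ∃ F : Finset ℕ, (∀ m ∈ F, Odd m) ∧ ∀ᶠ ε in 𝓝[>] (0 : ℝ),
          RingChain.NoGapEigenvaluesExcept (RingChain.perturbedLaplacian A α n a b ε) F)) ∧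
    (∀ s : ℝ, s ≠ 0 → ∃ C > 0, ∀ (n : ℕ) (a b : ℤ → ℝ),
      0 < Real.cot (A * Real.pi) * ∑ j ∈ Finset.Icc (1 : ℤ) n, a j →
      ∑ j ∈ Finset.Icc (1 : ℤ) n, b j = s → C < |∑ j ∈ Finset.Icc (1 : ℤ) n, a j| →
        ∀ᶠ ε in 𝓝[>] (0 : ℝ),
          RingChain.NoGapEigenvaluesExcept (RingChain.perturbedLaplacian A α n a b ε) ∅) ∧
    (∀ s : ℝ, s ≠ 0 → ∃ c > 0, ∀ (n : ℕ) (a b : ℤ → ℝ),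
      0 < Real.cot (A * Real.pi) * ∑ j ∈ Finset.Icc (1 : ℤ) n, a j →
      ∑ j ∈ Finset.Icc (1 : ℤ) n, b j = s → |∑ j ∈ Finset.Icc (1 : ℤ) n, a j| < c →
        ∀ᶠ ε in 𝓝[>] (0 : ℝ),
          ∃ G ∈ RingChain.gaps (RingChain.perturbedLaplacian A α n a b ε),
            RingChain.gapNumber (RingChain.perturbedLaplacian A α n a b ε) G
              = (if 0 < s then 2 else 1) ∧
            ∃ E ∈ G, RingChain.IsEigenvalue (RingChain.perturbedLaplacian A α n a b ε) E) ∧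
    -- The case of a negative sign: all but finitely many gaps contain exactly one eigenvalue.
    (∀ (n : ℕ) (a b : ℤ → ℝ),
      Real.cot (A * Real.pi) * ∑ j ∈ Finset.Icc (1 : ℤ) n, a j < 0 →
      (0 < ∑ j ∈ Finset.Icc (1 : ℤ) n, b j →
        ∃ F : Finset ℕ, (∀ m ∈ F, Odd m) ∧ ∀ᶠ ε in 𝓝[>] (0 : ℝ),
          RingChain.OneGapEigenvalueExcept (RingChain.perturbedLaplacian A α n a b ε) F) ∧
      (∑ j ∈ Finset.Icc (1 : ℤ) n, b j < 0 →
        ∃ F : Finset ℕ, (∀ m ∈ F, Even m) ∧ ∀ᶠ ε in 𝓝[>] (0 : ℝ),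
          RingChain.OneGapEigenvalueExcept (RingChain.perturbedLaplacian A α n a b ε) F)) ∧
    (∀ s : ℝ, s ≠ 0 → ∃ C > 0, ∀ (n : ℕ) (a b : ℤ → ℝ),
      Real.cot (A * Real.pi) * ∑ j ∈ Finset.Icc (1 : ℤ) n, a j < 0 →
      ∑ j ∈ Finset.Icc (1 : ℤ) n, b j = s → C < |∑ j ∈ Finset.Icc (1 : ℤ) n, a j| →
        ∀ᶠ ε in 𝓝[>] (0 : ℝ),
          RingChain.OneGapEigenvalueExcept (RingChain.perturbedLaplacian A α n a b ε) ∅) ∧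
    (∀ s : ℝ, s ≠ 0 → ∃ c > 0, ∀ (n : ℕ) (a b : ℤ → ℝ),
      Real.cot (A * Real.pi) * ∑ j ∈ Finset.Icc (1 : ℤ) n, a j < 0 →
      ∑ j ∈ Finset.Icc (1 : ℤ) n, b j = s → |∑ j ∈ Finset.Icc (1 : ℤ) n, a j| < c →
        ∀ᶠ ε in 𝓝[>] (0 : ℝ),
          ∀ G ∈ RingChain.gaps (RingChain.perturbedLaplacian A α n a b ε),
            RingChain.gapNumber (RingChain.perturbedLaplacian A α n a b ε) G
              = (if 0 < s then 1 else 2) →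
            RingChain.NoEigenvalueIn (RingChain.perturbedLaplacian A α n a b ε) G) := by
  have hc1 := RingChain.abs_cos_lt_one hA
  refine ⟨fun n a b h => ?_, fun s hs => ?_, fun s hs => ?_, fun n a b h => ?_, fun s hs => ?_,
    fun s hs => ?_⟩
  · have hc := RingChain.cos_ne_zero_of_cot h.ne'
    have hf := RingChain.fluxTerm_pos h
    refine ⟨fun hs => ?_, fun hs => ?_⟩
    -- Here p is the parity of k and the gap number is k + 1, so p = 1 stands for even gap numbers.
    · obtain ⟨M, hM⟩ := RingChain.exists_noGapEigenvaluesExcept hc hc1 α (p := 1) (b := b) hf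
        fun k hk => by rw [RingChain.neg_one_pow_mul_of_even hk]; exact hs.le
      exact ⟨_, fun m => RingChain.even_of_mem_initialNumbers, hM⟩
    · obtain ⟨M, hM⟩ := RingChain.exists_noGapEigenvaluesExcept hc hc1 α (p := 0) (b := b) hf
        fun k hk => by rw [RingChain.neg_one_pow_mul_of_odd hk]; linarith
      exact ⟨_, fun m => RingChain.odd_of_mem_initialNumbers, hM⟩
  -- If the cotangent vanishes, the sign hypothesis cannot hold and any constant serves.
  · by_cases hcot : Real.cot (A * Real.pi) = 0
    · exact ⟨1, one_pos, fun n a b h => by rw [hcot, zero_mul] at h; exact absurd h (lt_irrefl _)⟩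
    have hcot' : Real.cot (A * Real.pi) * 1 ≠ 0 := by rwa [mul_one]
    have hc := RingChain.cos_ne_zero_of_cot hcot'
    obtain ⟨C, hC, hb⟩ := RingChain.exists_bound_of_tan_ne_zero hc
      (RingChain.tan_ne_zero_of_cot hcot') α s
    refine ⟨C, hC, fun n a b h hs' ht => RingChain.eventually_noGapEigenvaluesExcept hc hc1 one_pos
      fun k _ E hE => ?_⟩
    have h1 := hb _ ht k E hE.1 (hE.2.le.trans
      (RingChain.sign_mul_le (RingChain.gapEtaSign_sq k) _))
    rw [abs_of_pos (RingChain.fluxTerm_pos h)] at h1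
    rw [hs']
    -- The term supplied is -|x| ≤ x for x the coupling part of the slope.
    linarith [(abs_le.1 (le_refl |RingChain.slope A α (RingChain.gapEtaSign k) E s
      (∑ j ∈ Finset.Icc (1 : ℤ) n, a j)
      - RingChain.fluxTerm A (∑ j ∈ Finset.Icc (1 : ℤ) n, a j)|)).1]
  · by_cases hc : Real.cos (A * Real.pi) = 0
    · exact ⟨1, one_pos, fun n a b h => absurd hc (RingChain.cos_ne_zero_of_cot h.ne')⟩
    rcases lt_or_gt_of_ne hs with h0 | h0
    -- k = 0 is the first gap, where a negative s lowers the slope; k = 1 is the second, where a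
    -- positive s does.
    · obtain ⟨c, hc0, h⟩ := RingChain.exists_isEigenvalue_of_abs_lt (k := 0) hc hc1 α
        (by simpa using h0)
      refine ⟨c, hc0, fun n a b _ hb ha => ?_⟩
      rw [if_neg (not_lt.2 h0.le)]
      exact_mod_cast h n a b hb ha
    · obtain ⟨c, hc0, h⟩ := RingChain.exists_isEigenvalue_of_abs_lt (k := 1) hc hc1 α
        (by simpa using h0)
      refine ⟨c, hc0, fun n a b _ hb ha => ?_⟩
      rw [if_pos h0]
      exact_mod_cast h n a b hb ha
  · have hc := RingChain.cos_ne_zero_of_cot h.ne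
    have hf := RingChain.fluxTerm_neg h
    refine ⟨fun hs => ?_, fun hs => ?_⟩
    · obtain ⟨M, hM⟩ := RingChain.exists_oneGapEigenvalueExcept hc hc1 α (p := 0) (b := b) hf
        fun k hk => by rw [RingChain.neg_one_pow_mul_of_odd hk]; linarith
      exact ⟨_, fun m => RingChain.odd_of_mem_initialNumbers, hM⟩
    · obtain ⟨M, hM⟩ := RingChain.exists_oneGapEigenvalueExcept hc hc1 α (p := 1) (b := b) hf
        fun k hk => by rw [RingChain.neg_one_pow_mul_of_even hk]; exact hs.le
      exact ⟨_, fun m => RingChain.even_of_mem_initialNumbers, hM⟩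
  · by_cases hcot : Real.cot (A * Real.pi) = 0
    · exact ⟨1, one_pos, fun n a b h => by rw [hcot, zero_mul] at h; exact absurd h (lt_irrefl _)⟩
    have hcot' : Real.cot (A * Real.pi) * 1 ≠ 0 := by rwa [mul_one]
    have hc := RingChain.cos_ne_zero_of_cot hcot'
    obtain ⟨C, hC, hb⟩ := RingChain.exists_bound_of_tan_ne_zero hc
      (RingChain.tan_ne_zero_of_cot hcot') α s
    refine ⟨C, hC, fun n a b h hs' ht => RingChain.eventually_oneGapEigenvalueExcept hc hc1 one_pos
      fun k _ E hE hEa => ?_⟩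
    have h1 := hb _ ht k E hE hEa
    rw [abs_of_neg (RingChain.fluxTerm_neg h)] at h1
    rw [hs']
    linarith [le_abs_self (RingChain.slope A α (RingChain.gapEtaSign k) E s
      (∑ j ∈ Finset.Icc (1 : ℤ) n, a j)
      - RingChain.fluxTerm A (∑ j ∈ Finset.Icc (1 : ℤ) n, a j))]
  · by_cases hc : Real.cos (A * Real.pi) = 0
    · exact ⟨1, one_pos, fun n a b h => absurd hc (RingChain.cos_ne_zero_of_cot h.ne)⟩
    rcases lt_or_gt_of_ne hs with h0 | h0
    · obtain ⟨c, hc0, h⟩ := RingChain.exists_noEigenvalueIn_of_abs_lt (k := 1) hc hc1 α rfl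
        (by simpa using h0)
      refine ⟨c, hc0, fun n a b _ hb ha => ?_⟩
      rw [if_neg (not_lt.2 h0.le)]
      exact_mod_cast h n a b hb ha
    · obtain ⟨c, hc0, h⟩ := RingChain.exists_noEigenvalueIn_of_abs_lt (k := 0) hc hc1 α rfl
        (by simpa using h0)
      refine ⟨c, hc0, fun n a b _ hb ha => ?_⟩
      rw [if_pos h0]
      exact_mod_cast h n a b hb ha
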